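/- Strings $A,B\in\Sigma^n$ are compared by the edit distance $\mathrm{ED}(A,B)$, the least number of insertions, deletions and substitutions of single characters that turn $A$ into $B$. The machine is a word RAM with words of $\Theta(\log n+\log|\Sigma|)$ bits, unit-cost word operations and random access to memory and to the input strings. An algorithm with one-sided preprocessing consists of two fixed programs, both of which are given $n,k,\ell,|\Sigma|$: a randomized preprocessing program, which can draw uniformly random words and has access to $A$ but not to $B$, and a deterministic query program, which has access to $A$, to $B$ and to the memory contents left by the preprocessing. Theorem. For every constant $a\in\mathbb N$ there are a constant $b\in\mathbb N$ and an algorithm with one-sided preprocessing such that the following holds for all integers $1\le\ell\le k\le n$, every finite alphabet $\Sigma$ and every $A\in\Sigma^n$, where $L:=\lfloor\log_2 n\rfloor+1$. 1. The expected running time of the preprocessing of $A$ is at most $b\,L^{b}\cdot\frac{nk}{\ell}$, i.e. $\tilde O(nk/\ell)$. 2. For every $B\in\Sigma^n$ and every outcome of the preprocessing, the query halts after at most $b\,L^{b}\cdot\frac{n+k^2}{\ell}$ steps, i.e. in $\tilde O\big(\frac{n+k^2}{\ell}\big)$ time. 3. For every $B\in\Sigma^n$ (fixed independently of the random bits), with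 probability at least $1-\frac1n$ over the random bits used in the preprocessing, the query answers SMALL if $\mathrm{ED}(A,B)\le a\,L^{a}\cdot k$, and LARGE if $\mathrm{ED}(A,B)\ge b\,L^{b}\cdot k\ell$. That is, it distinguishes $\mathrm{ED}(A,B)\le\tilde O(k)$ from $\mathrm{ED}(A,B)\ge\tilde\Omega(k\ell)$. The constants and the programs depend on $a$ only; they do not depend on $n,k,\ell,\Sigma,A,B$. -/

import Mathlib

/-!
A randomized word RAM, presented as a structured programming language with an explicit step count.
A program is a finite piece of syntax; it has registers and a random-access memory of `w`-bit words,
random access to two input strings, and an instruction that draws a uniformly random word.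
-/

namespace WordRAM

/-- Word operations; arithmetic is modulo the number `M` of words, comparisons give `0` or `1`. -/
inductive Op
  | add | sub | mul | div | mod | lt | eq

/-- The result of a word operation, for words `x, y < M`. Division by `0` gives `0`. -/
def Op.eval (M : ℕ) : Op → ℕ → ℕ → ℕ
  | .add, x, y => (x + y) % M
  | .sub, x, y => (x + M - y) % M
  | .mul, x, y => (x * y) % M
  | .div, x, y => x / y
  | .mod, x, y => x % y
  | .lt, x, y => if x < y then 1 else 0
  | .eq, x, y => if x = y then 1 else 0

/-- Expressions: constants, registers, word operations, the memory word at a computed address, and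
the character at a computed position of the first or of the second input string. -/
inductive Expr
  | const (c : ℕ)
  | reg (r : ℕ)
  | op (o : Op) (e₁ e₂ : Expr)
  | load (e : Expr)
  | readA (e : Expr)
  | readB (e : Expr)

/-- Programs. `random r` puts a fresh random word into register `r`. -/
inductive Prog
  | skip
  | assign (r : ℕ) (e : Expr)
  | store (addr val : Expr)
  | random (r : ℕ)
  | seq (p q : Prog)
  | ite (e : Expr) (p q : Prog)
  | loop (e : Expr) (p : Prog)

/-- The program contains no `random` instruction, i.e. it is deterministic. -/
def Prog.RandomFree : Prog → Prop
  | .skip => True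
  | .assign _ _ => True
  | .store _ _ => True
  | .random _ => False
  | .seq p q => p.RandomFree ∧ q.RandomFree
  | .ite _ p q => p.RandomFree ∧ q.RandomFree
  | .loop _ p => p.RandomFree

/-- What is fixed during a run: the number `M` of words, the two input strings (as functions of the
position), and the sequence of random words. -/
structure Env where
  M : ℕ
  strA : ℕ → ℕ
  strB : ℕ → ℕ
  tape : ℕ → ℕ

/-- What changes during a run: registers, memory, and the number of random words already used. -/
structure State where
  reg : ℕ → ℕ
  mem : ℕ → ℕ
  used : ℕ

/-- The value of an expression. -/
def Expr.eval (E : Env) (s : State) : Expr → ℕ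
  | .const c => c % E.M
  | .reg r => s.reg r
  | .op o e₁ e₂ => o.eval E.M (e₁.eval E s) (e₂.eval E s)
  | .load e => s.mem (e.eval E s)
  | .readA e => E.strA (e.eval E s)
  | .readB e => E.strB (e.eval E s)

/-- The number of steps for evaluating an expression: one for each node. -/
def Expr.cost : Expr → ℕ
  | .const _ => 1
  | .reg _ => 1
  | .op _ e₁ e₂ => e₁.cost + e₂.cost + 1
  | .load e => e.cost + 1
  | .readA e => e.cost + 1
  | .readB e => e.cost + 1

/-- `Exec E p s s' t`: started in state `s`, the program `p` halts in state `s'` after `t` steps. -/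
inductive Exec (E : Env) : Prog → State → State → ℕ → Prop
  | skip (s : State) : Exec E .skip s s 1
  | assign (s : State) (r : ℕ) (e : Expr) :
      Exec E (.assign r e) s { s with reg := Function.update s.reg r (e.eval E s) } (e.cost + 1)
  | store (s : State) (addr val : Expr) :
      Exec E (.store addr val) s
        { s with mem := Function.update s.mem (addr.eval E s) (val.eval E s) }
        (addr.cost + val.cost + 1)
  | random (s : State) (r : ℕ) :
      Exec E (.random r) s
        { s with reg := Function.update s.reg r (E.tape s.used), used := s.used + 1 } 1
  | seq {p q : Prog} {s s' s'' : State} {t t' : ℕ} :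
      Exec E p s s' t → Exec E q s' s'' t' → Exec E (.seq p q) s s'' (t + t')
  | ite_true {e : Expr} {p q : Prog} {s s' : State} {t : ℕ} :
      e.eval E s ≠ 0 → Exec E p s s' t → Exec E (.ite e p q) s s' (e.cost + 1 + t)
  | ite_false {e : Expr} {p q : Prog} {s s' : State} {t : ℕ} :
      e.eval E s = 0 → Exec E q s s' t → Exec E (.ite e p q) s s' (e.cost + 1 + t)
  | loop_true {e : Expr} {p : Prog} {s s' s'' : State} {t t' : ℕ} :
      e.eval E s ≠ 0 → Exec E p s s' t → Exec E (.loop e p) s' s'' t' →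
        Exec E (.loop e p) s s'' (e.cost + 1 + t + t')
  | loop_false {e : Expr} {p : Prog} {s : State} :
      e.eval E s = 0 → Exec E (.loop e p) s s (e.cost + 1)

/-- The final state and the number of steps are determined by the initial state. -/
theorem Exec.unique {E : Env} {p : Prog} {s s₁ s₂ : State} {t₁ t₂ : ℕ}
    (h₁ : Exec E p s s₁ t₁) (h₂ : Exec E p s s₂ t₂) : s₁ = s₂ ∧ t₁ = t₂ := by
  induction h₁ generalizing s₂ t₂ with
  | skip | assign | store | random => cases h₂; exact ⟨rfl, rfl⟩
  | seq _ _ ih ih' =>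
    cases h₂ with
    | seq a b =>
      obtain ⟨rfl, rfl⟩ := ih a
      obtain ⟨rfl, rfl⟩ := ih' b
      exact ⟨rfl, rfl⟩
  | ite_true h _ ih =>
    cases h₂ with
    | ite_true _ a => obtain ⟨rfl, rfl⟩ := ih a; exact ⟨rfl, rfl⟩
    | ite_false g _ => exact absurd g h
  | ite_false h _ ih =>
    cases h₂ with
    | ite_true g _ => exact absurd h g
    | ite_false _ a => obtain ⟨rfl, rfl⟩ := ih a; exact ⟨rfl, rfl⟩
  | loop_true h _ _ ih ih' =>
    cases h₂ with
    | loop_true _ a b =>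
      obtain ⟨rfl, rfl⟩ := ih a
      obtain ⟨rfl, rfl⟩ := ih' b
      exact ⟨rfl, rfl⟩
    | loop_false g => exact absurd g h
  | loop_false h =>
    cases h₂ with
    | loop_true g _ _ => exact absurd h g
    | loop_false _ => exact ⟨rfl, rfl⟩

/-- The running time of a program; it is `∞` if the program does not halt. -/
noncomputable def runningTime (E : Env) (p : Prog) (s : State) : ENNReal :=
  ⨅ (t : ℕ) (_ : ∃ s', Exec E p s s' t), (t : ENNReal)

end WordRAM

open WordRAM

/-- One edit: the insertion, the deletion or the substitution of a single character. -/
inductive EditStep {α : Type*} : List α → List α → Prop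
  | insert (u v : List α) (x : α) : EditStep (u ++ v) (u ++ x :: v)
  | delete (u v : List α) (x : α) : EditStep (u ++ x :: v) (u ++ v)
  | subst (u v : List α) (x y : α) : EditStep (u ++ x :: v) (u ++ y :: v)

/-- `EditSeq xs ys d`: there is a sequence of `d` edits that turns `xs` into `ys`. -/
inductive EditSeq {α : Type*} : List α → List α → ℕ → Prop
  | refl (xs : List α) : EditSeq xs xs 0
  | step {xs ys zs : List α} {d : ℕ} : EditSeq xs ys d → EditStep ys zs → EditSeq xs zs (d + 1)

/-- The edit distance: the least number of edits that turn `A` into `B`. -/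
noncomputable def editDist {n σ : ℕ} (A B : Fin n → Fin σ) : ℕ :=
  sInf {d | EditSeq (List.ofFn A) (List.ofFn B) d}

/-- The character at position `i` (counted from `0`), as a number below `σ`;
beyond the end of the string it is the extra symbol `σ`. -/
def charAt {n σ : ℕ} (A : Fin n → Fin σ) (i : ℕ) : ℕ :=
  if h : i < n then (A ⟨i, h⟩ : ℕ) else σ

/-- The number of bits of a word: `c` times `log n + log σ`, up to rounding. -/
def wordBits (c n σ : ℕ) : ℕ := c * (Nat.log 2 n + Nat.log 2 σ + 1)

/-- The distribution of a sequence of independent uniformly random `w`-bit words. -/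
noncomputable def tapeMeasure (w : ℕ) : MeasureTheory.Measure (ℕ → Fin (2 ^ w)) :=
  MeasureTheory.Measure.infinitePi fun _ => (PMF.uniformOfFintype (Fin (2 ^ w))).toMeasure

/-- At the start of each phase the registers `0, 1, 2, 3` hold `n, k, ℓ, σ`, and the others `0`. -/
def inputRegs (n k ℓ σ : ℕ) : ℕ → ℕ
  | 0 => n
  | 1 => k
  | 2 => ℓ
  | 3 => σ
  | _ => 0

/-- Preprocessing: the first string is `A`, and there is no second string (it is empty). -/
def preEnv {n σ : ℕ} (w : ℕ) (A : Fin n → Fin σ) (ω : ℕ → Fin (2 ^ w)) : Env where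
  M := 2 ^ w
  strA := charAt A
  strB := fun _ => σ
  tape := fun i => ω i

/-- Preprocessing starts with an empty memory. -/
def preInit (n k ℓ σ : ℕ) : State where
  reg := inputRegs n k ℓ σ
  mem := fun _ => 0
  used := 0

/-- Query: random access to both strings, and no random words. -/
def queryEnv {n σ : ℕ} (w : ℕ) (A B : Fin n → Fin σ) : Env where
  M := 2 ^ w
  strA := charAt A
  strB := charAt B
  tape := fun _ => 0

/-- A query starts with the memory that preprocessing has left. -/
def queryInit (n k ℓ σ : ℕ) (s : State) : State where
  reg := inputRegs n k ℓ σ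
  mem := s.mem
  used := 0

/-- The answer of a query is in register `0`: `1` stands for small and `0` for large. -/
def CorrectAnswer (d : ℕ) (small large : ℝ) (s : State) : Prop :=
  ((d : ℝ) ≤ small → s.reg 0 = 1) ∧ (large ≤ (d : ℝ) → s.reg 0 = 0)

/-- The polylogarithmic factor `b (log n + 1) ^ b`, with the logarithm to base `2` rounded down. -/
def polylog (b n : ℕ) : ℕ := b * (Nat.log 2 n + 1) ^ b

/-! Let `l` be the largest power of two up to ℓ. Cut the strings into `N = n / l` leaf blocks of
length `l`, dropping the remainder, and put `K = a L^a k`. The preprocessing draws one uniform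
position `q i` in each leaf block and stores the characters of A at `q i + t - K` for all `T = 2K +
1` values of `t`. The query reads B only at the positions `q i`.

A sequence of leaf blocks matches for shift `t` if all its sampled characters agree. Blocks of
dyadic length are compared through names: a longer block is named by the least shift at which A
shows the same samples, and a dictionary built from A alone sends the names of two halves to the
name of the whole (`blockName_double`). A second table records whether a name occurs for some shift
of a given class, a class being `l` consecutive shifts. The query thus names all dyadic blocks of B
by about `N log N` lookups, and tests a block against a whole class of shifts by one lookup.

The query then computes `furthest`: for each of the `R = 2K / l + 1` classes and `E = (L + 2)(K +
1)` rounds, the furthest leaf block reached. A round jumps over the longest matching dyadic block,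
or passes one leaf block unconditionally, or takes over the value of a neighbouring class. The
answer is SMALL if some class reaches `N`. Up to logarithms, preprocessing takes `N T` steps and the
query `N + E R` steps.

Small distance (`exists_furthest_of_editSeq`): an alignment of cost at most `K` has constant shift
while its cost is constant, so it is a chain of matching runs. Greedy dyadic jumps finish a run in
`L` rounds, one more round passes the leaf block where an edit occurs, and the change of class takes
no more rounds than the increase of the cost. So `L + 2` rounds per unit of cost suffice.

Large distance (`prefixDist_furthest`, `editDist_le_of_furthest`): conversely, reaching `N` yields
an alignment. If every matching block has at most `H l` real mismatches, a round costs at most `(H +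
2) l` edits.

Sampling (`block_avoid_le`, `tapeMeasure_detecting`): a block with `m` mismatches for a shift passes
the test with probability at most `exp (-m / l)`, because the samples in distinct leaf blocks are
independent. A union bound with `H = (3a + 5) L` gives failure probability at most `1 / n`.

The contents of the tables, both time bounds and the answer SMALL are right for every random tape;
randomness matters only for the answer LARGE. -/

namespace WordRAM

/-! ### Reasoning about programs -/

/-- The state after register `r` has received the value `v`. -/
def State.setReg (s : State) (r v : ℕ) : State := { s with reg := Function.update s.reg r v }

/-- The state after the memory word at address `x` has received the value `v`. -/
def State.setMem (s : State) (x v : ℕ) : State := { s with mem := Function.update s.mem x v }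

/-- The state after a random word `v` has been put into register `r`. -/
def State.draw (s : State) (r v : ℕ) : State :=
  { s with reg := Function.update s.reg r v, used := s.used + 1 }

section
variable (s : State) (r v x y : ℕ)

@[simp] theorem State.setReg_reg : (s.setReg r v).reg x = if x = r then v else s.reg x := by
  simp [State.setReg, Function.update_apply]
@[simp] theorem State.setReg_mem : (s.setReg r v).mem = s.mem := rfl
@[simp] theorem State.setReg_used : (s.setReg r v).used = s.used := rfl
@[simp] theorem State.setMem_reg : (s.setMem x v).reg = s.reg := rfl
@[simp] theorem State.setMem_mem : (s.setMem x v).mem y = if y = x then v else s.mem y := by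
  simp [State.setMem, Function.update_apply]
@[simp] theorem State.setMem_used : (s.setMem x v).used = s.used := rfl
@[simp] theorem State.draw_reg : (s.draw r v).reg x = if x = r then v else s.reg x := by
  simp [State.draw, Function.update_apply]
@[simp] theorem State.draw_mem : (s.draw r v).mem = s.mem := rfl
@[simp] theorem State.draw_used : (s.draw r v).used = s.used + 1 := rfl
end

/-- Started in state `s`, the program halts within `T` steps in a state that satisfies `Q`. -/
def Runs (E : Env) (p : Prog) (s : State) (T : ℕ) (Q : State → Prop) : Prop :=
  ∃ s' t, Exec E p s s' t ∧ t ≤ T ∧ Q s'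

variable {E : Env} {s : State} {p q : Prog} {T T' : ℕ} {Q Q' : State → Prop}

theorem Runs.mono (h : Runs E p s T Q) (hT : T ≤ T') (hQ : ∀ s, Q s → Q' s) :
    Runs E p s T' Q' := by
  obtain ⟨s', t, h₁, h₂, h₃⟩ := h
  exact ⟨s', t, h₁, h₂.trans hT, hQ _ h₃⟩

theorem Runs.le (h : Runs E p s T Q) (hT : T ≤ T') : Runs E p s T' Q := h.mono hT fun _ => id

theorem Runs.skip (h : Q s) : Runs E .skip s 1 Q := ⟨s, 1, .skip s, le_rfl, h⟩

theorem Runs.assign {r v : ℕ} {e : Expr} (he : e.eval E s = v) (h : Q (s.setReg r v)) :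
    Runs E (.assign r e) s (e.cost + 1) Q := by
  subst he; exact ⟨_, _, .assign s r e, le_rfl, h⟩

theorem Runs.store {x v : ℕ} {e f : Expr} (he : e.eval E s = x) (hf : f.eval E s = v)
    (h : Q (s.setMem x v)) : Runs E (.store e f) s (e.cost + f.cost + 1) Q := by
  subst he hf; exact ⟨_, _, .store s e f, le_rfl, h⟩

theorem Runs.random {r : ℕ} (h : Q (s.draw r (E.tape s.used))) :
    Runs E (.random r) s 1 Q := ⟨_, _, .random s r, le_rfl, h⟩

theorem Runs.seq (h : Runs E p s T fun s' => Runs E q s' T' Q) :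
    Runs E (.seq p q) s (T + T') Q := by
  obtain ⟨s₁, t₁, h₁, h₂, s₂, t₂, h₃, h₄, h₅⟩ := h
  exact ⟨s₂, _, .seq h₁ h₃, by omega, h₅⟩

theorem Runs.seq_mid {R : State → Prop} (h : Runs E p s T R)
    (h' : ∀ s', R s' → Runs E q s' T' Q) : Runs E (.seq p q) s (T + T') Q :=
  .seq (h.mono le_rfl h')

theorem Runs.seq_assign {r v : ℕ} {e : Expr} (he : e.eval E s = v)
    (h : Runs E q (s.setReg r v) T' Q) : Runs E (.seq (.assign r e) q) s (e.cost + 1 + T') Q :=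
  .seq (.assign he h)

theorem Runs.seq_store {x v : ℕ} {e f : Expr} (he : e.eval E s = x) (hf : f.eval E s = v)
    (h : Runs E q (s.setMem x v) T' Q) :
    Runs E (.seq (.store e f) q) s (e.cost + f.cost + 1 + T') Q :=
  .seq (.store he hf h)

theorem Runs.ite {e : Expr} (h : e.eval E s ≠ 0 → Runs E p s T Q)
    (h' : e.eval E s = 0 → Runs E q s T Q) : Runs E (.ite e p q) s (e.cost + 1 + T) Q := by
  by_cases he : e.eval E s = 0
  · obtain ⟨s', t, h₁, h₂, h₃⟩ := h' he
    exact ⟨s', _, .ite_false he h₁, by omega, h₃⟩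
  · obtain ⟨s', t, h₁, h₂, h₃⟩ := h he
    exact ⟨s', _, .ite_true he h₁, by omega, h₃⟩

/-- A loop that makes exactly `m` rounds, with an invariant. -/
theorem Runs.loop {e : Expr} (m : ℕ) (I : ℕ → State → Prop)
    (hbody : ∀ i < m, ∀ s, I i s → e.eval E s ≠ 0 ∧ Runs E p s T (I (i + 1)))
    (hend : ∀ s, I m s → e.eval E s = 0) (h0 : I 0 s) :
    Runs E (.loop e p) s (m * (T + e.cost + 1) + (e.cost + 1)) (I m) := by
  have key : ∀ d i s, i + d = m → I i s →
      Runs E (.loop e p) s (d * (T + e.cost + 1) + (e.cost + 1)) (I m) := by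
    intro d
    induction d with
    | zero =>
      intro i s hi hI
      obtain rfl : i = m := by omega
      exact ⟨s, _, .loop_false (hend s hI), by omega, hI⟩
    | succ d ih =>
      intro i s hi hI
      obtain ⟨he, s₁, t₁, h₁, h₂, h₃⟩ := hbody i (by omega) s hI
      obtain ⟨s₂, t₂, h₄, h₅, h₆⟩ := ih (i + 1) s₁ (by omega) h₃
      refine ⟨s₂, _, .loop_true he h₁ h₄, ?_, h₆⟩
      rw [Nat.succ_mul]; omega
  exact key m 0 s (by omega) h0

/-! ### Evaluating expressions -/

instance : Add Expr := ⟨.op .add⟩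
instance : Sub Expr := ⟨.op .sub⟩
instance : Mul Expr := ⟨.op .mul⟩
instance : Div Expr := ⟨.op .div⟩
instance : Mod Expr := ⟨.op .mod⟩

/-- The expression `e < f`, with value `0` or `1`. -/
def Expr.less (e f : Expr) : Expr := .op .lt e f

section
variable (e f : Expr)
@[simp] theorem Expr.cost_add : (e + f).cost = e.cost + f.cost + 1 := rfl
@[simp] theorem Expr.cost_sub : (e - f).cost = e.cost + f.cost + 1 := rfl
@[simp] theorem Expr.cost_mul : (e * f).cost = e.cost + f.cost + 1 := rfl
@[simp] theorem Expr.cost_div : (e / f).cost = e.cost + f.cost + 1 := rfl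
@[simp] theorem Expr.cost_mod : (e % f).cost = e.cost + f.cost + 1 := rfl
@[simp] theorem Expr.cost_less : (e.less f).cost = e.cost + f.cost + 1 := rfl
attribute [simp] Expr.cost
end

variable {e f : Expr} {x y c r : ℕ}

theorem Expr.eval_const (h : c < E.M) : (Expr.const c).eval E s = c := Nat.mod_eq_of_lt h
theorem Expr.eval_reg (h : s.reg r = x) : (Expr.reg r).eval E s = x := h
theorem Expr.eval_add (he : e.eval E s = x) (hf : f.eval E s = y) (h : x + y < E.M) :
    (e + f).eval E s = x + y := by subst he hf; exact Nat.mod_eq_of_lt h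
theorem Expr.eval_mul (he : e.eval E s = x) (hf : f.eval E s = y) (h : x * y < E.M) :
    (e * f).eval E s = x * y := by subst he hf; exact Nat.mod_eq_of_lt h
theorem Expr.eval_sub (he : e.eval E s = x) (hf : f.eval E s = y) :
    (e - f).eval E s = (x + E.M - y) % E.M := by subst he hf; rfl
theorem Expr.eval_sub_of_le (he : e.eval E s = x) (hf : f.eval E s = y) (hy : y ≤ x)
    (hx : x < E.M) : (e - f).eval E s = x - y := by
  rw [Expr.eval_sub he hf, show x + E.M - y = x - y + E.M by omega, Nat.add_mod_right,
    Nat.mod_eq_of_lt (by omega)]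
theorem Expr.eval_div (he : e.eval E s = x) (hf : f.eval E s = y) :
    (e / f).eval E s = x / y := by subst he hf; rfl
theorem Expr.eval_mod (he : e.eval E s = x) (hf : f.eval E s = y) :
    (e % f).eval E s = x % y := by subst he hf; rfl
theorem Expr.eval_load (he : e.eval E s = x) : (Expr.load e).eval E s = s.mem x := by
  subst he; rfl
theorem Expr.eval_readA (he : e.eval E s = x) : (Expr.readA e).eval E s = E.strA x := by
  subst he; rfl
theorem Expr.eval_readB (he : e.eval E s = x) : (Expr.readB e).eval E s = E.strB x := by
  subst he; rfl
theorem Expr.eval_less_ne (he : e.eval E s = x) (hf : f.eval E s = y) :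
    (e.less f).eval E s ≠ 0 ↔ x < y := by
  subst he hf; simp [Expr.less, Expr.eval, Op.eval]
theorem Expr.eval_less_eq (he : e.eval E s = x) (hf : f.eval E s = y) :
    (e.less f).eval E s = 0 ↔ y ≤ x := by
  subst he hf; simp [Expr.less, Expr.eval, Op.eval]

/-- The power of an expression. -/
def Expr.pow (e : Expr) : ℕ → Expr
  | 0 => .const 1
  | m + 1 => e.pow m * e

theorem Expr.eval_pow (he : e.eval E s = x) (hx : 0 < x) (m : ℕ) (h : x ^ m < E.M) :
    (e.pow m).eval E s = x ^ m := by
  induction m with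
  | zero => exact Expr.eval_const (by simpa using h)
  | succ m ih =>
    have : x ^ m ≤ x ^ (m + 1) := Nat.pow_le_pow_right hx (by omega)
    exact Expr.eval_mul (ih (by omega)) he h

theorem Expr.cost_pow (e : Expr) (m : ℕ) : (e.pow m).cost = m * (e.cost + 1) + 1 := by
  induction m with
  | zero => simp [Expr.pow]
  | succ m ih => simp only [Expr.pow, Expr.cost_mul, ih]; ring

/-! ### Addresses -/

/-- An injective pairing function without division or case distinction. -/
def pr (x y : ℕ) : ℕ := (x + y) * (x + y) + y

/-- The value lies between `(x + y)^2` and `(x + y + 1)^2`, the latter excluded, so it determines `x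
+ y` and then `y`. -/
theorem pr_inj {x y x' y' : ℕ} : pr x y = pr x' y' ↔ x = x' ∧ y = y' := by
  refine ⟨fun h => ?_, by rintro ⟨rfl, rfl⟩; rfl⟩
  unfold pr at h
  have : x + y = x' + y' := by
    rcases lt_trichotomy (x + y) (x' + y') with g | g | g
    · nlinarith
    · exact g
    · nlinarith
  rw [this] at h
  omega

theorem pr_lt {x y Z : ℕ} (hx : x < Z) (hy : y < Z) : pr x y < 4 * Z ^ 2 := by
  unfold pr; nlinarith

/-- The address of an entry with four indices in the table number `g`. -/
def adr (g u v x y : ℕ) : ℕ := pr (pr g u) (pr (pr v x) y)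

@[simp] theorem adr_inj {g u v x y g' u' v' x' y' : ℕ} :
    adr g u v x y = adr g' u' v' x' y' ↔ g = g' ∧ u = u' ∧ v = v' ∧ x = x' ∧ y = y' := by
  simp only [adr, pr_inj]; tauto

/-- An expression for the pairing function. -/
def Expr.pr (e f : Expr) : Expr := (e + f) * (e + f) + f

/-- An expression for an address. -/
def Expr.adr (g : ℕ) (u v x y : Expr) : Expr :=
  ((Expr.const g).pr u).pr ((v.pr x).pr y)

@[simp] theorem Expr.cost_pr : (e.pr f).cost = 2 * e.cost + 3 * f.cost + 4 := by
  simp [Expr.pr]; ring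
@[simp] theorem Expr.cost_adr {g : ℕ} {u v x y : Expr} : (Expr.adr g u v x y).cost =
    6 * u.cost + 12 * v.cost + 18 * x.cost + 9 * y.cost + 52 := by
  simp [Expr.adr]; ring

theorem Expr.eval_pr (he : e.eval E s = x) (hf : f.eval E s = y)
    (h : WordRAM.pr x y < E.M) : (e.pr f).eval E s = WordRAM.pr x y := by
  unfold WordRAM.pr at *
  have : x + y ≤ (x + y) * (x + y) := Nat.le_mul_self _
  exact eval_add (eval_mul (eval_add he hf (by omega)) (eval_add he hf (by omega))
    (by omega)) hf h

/-- Each level of pairing turns a bound `Z` into `4 Z^2`. The three levels give `4 Z^2`, `64 Z^4`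
and `2^14 Z^8`, which is where the requirement on the number of words comes from. -/
theorem Expr.eval_adr {g u v x y Z : ℕ} {eu ev ex ey : Expr} (hZ : 2 ^ 14 * Z ^ 8 ≤ E.M)
    (hu : eu.eval E s = u) (hv : ev.eval E s = v) (hx : ex.eval E s = x) (hy : ey.eval E s = y)
    (hg : g < Z) (hu' : u < Z) (hv' : v < Z) (hx' : x < Z) (hy' : y < Z) :
    (Expr.adr g eu ev ex ey).eval E s = WordRAM.adr g u v x y := by
  have h2 : Z ≤ Z ^ 2 := Nat.le_self_pow (by norm_num) _
  have h4 : Z ^ 2 ≤ Z ^ 4 := Nat.pow_le_pow_right (by omega) (by norm_num)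
  have h8 : Z ^ 4 ≤ Z ^ 8 := Nat.pow_le_pow_right (by omega) (by norm_num)
  have p1 := pr_lt hg hu'
  have p2 := pr_lt hv' hx'
  have p3 := pr_lt p2 (show y < 4 * Z ^ 2 by omega)
  have e4 : 4 * (4 * Z ^ 2) ^ 2 = 64 * Z ^ 4 := by ring
  have e8 : 4 * (4 * (4 * Z ^ 2) ^ 2) ^ 2 = 2 ^ 14 * Z ^ 8 := by ring
  have p4 := pr_lt (show WordRAM.pr g u < 4 * (4 * Z ^ 2) ^ 2 by omega) p3
  exact eval_pr (eval_pr (eval_const (by omega)) hu (by omega))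
    (eval_pr (eval_pr hv hx (by omega)) hy (by omega)) (by omega)

end WordRAM

namespace GapEditDistance

/-! ### The programs -/

/-- Computes the parameters: register 4 holds `⌊log n⌋ + 1`, register 5 the length `l` of a leaf
block (a power of two), 6 the number of leaf blocks, 7 the largest shift `K`, 9 the number of shifts,
10 the number of classes of shifts, 11 the number of rounds. -/
def setupProg (a : ℕ) : Prog :=
  .seq (.assign 12 (.reg 0)) <|
  .seq (.loop (.reg 12) (.seq (.assign 12 (.reg 12 / .const 2))
    (.assign 4 (.reg 4 + .const 1)))) <|
  .seq (.assign 5 (.const 1)) <|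
  .seq (.loop ((Expr.reg 5 * .const 2).less (.reg 2 + .const 1))
    (.assign 5 (.reg 5 * .const 2))) <|
  .seq (.assign 6 (.reg 0 / .reg 5)) <|
  .seq (.assign 7 (.const a * (Expr.reg 4).pow a * .reg 1)) <|
  .seq (.assign 9 (.reg 7 * .const 2 + .const 1)) <|
  .seq (.assign 10 (.reg 7 * .const 2 / .reg 5 + .const 1)) <|
  .assign 11 ((.reg 4 + .const 2) * (.reg 7 + .const 1))

/-- Draws a position in every leaf block and reads the first string there, for every shift. -/
def sampleProg : Prog :=
  .seq (.assign 13 (.const 0)) <|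
  .loop ((Expr.reg 13).less (.reg 6)) <|
  .seq (.random 15) <|
  .seq (.assign 15 (.reg 13 * .reg 5 + .reg 15 % .reg 5)) <|
  .seq (.store (.adr 0 (.const 1) (.reg 13) (.const 0) (.const 0)) (.reg 15)) <|
  .seq (.assign 14 (.const 0)) <|
  .seq (.loop ((Expr.reg 14).less (.reg 9)) <|
    .seq (.store (.adr 1 (.const 1) (.reg 13) (.reg 14) (.const 0))
      (.readA (.reg 15 + .reg 14 - .reg 7))) <|
    .assign 14 (.reg 14 + .const 1)) <|
  .assign 13 (.reg 13 + .const 1)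

/-- Names the sampled block of twice the length in register 12 that starts at the leaf block in
register 13, for the shift in register 14. -/
def nameProg : Prog :=
  .seq (.assign 15 (.adr 2 (.reg 12 * .const 2) (.reg 13)
    (.load (.adr 1 (.reg 12) (.reg 13) (.reg 14) (.const 0)))
    (.load (.adr 1 (.reg 12) (.reg 13 + .reg 12) (.reg 14) (.const 0))))) <|
  .seq (.ite (.load (.reg 15)) .skip (.store (.reg 15) (.reg 14 + .const 1))) <|
  .seq (.assign 16 (.load (.reg 15))) <|
  .seq (.store (.adr 1 (.reg 12 * .const 2) (.reg 13) (.reg 14) (.const 0)) (.reg 16)) <|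
  .seq (.store (.adr 3 (.reg 12 * .const 2) (.reg 13) (.reg 16)
    (.reg 14 / .reg 5 + .const 1)) (.const 1)) <|
  .assign 14 (.reg 14 + .const 1)

/-- Runs `p` for all block lengths `2 h ≤ N` and all positions of the block. -/
def levelsProg (p : Prog) : Prog :=
  .seq (.assign 12 (.const 1)) <|
  .loop ((Expr.reg 12 * .const 2).less (.reg 6 + .const 1)) <|
  .seq (.assign 13 (.const 0)) <|
  .seq (.loop ((Expr.reg 13 + .reg 12 * .const 2).less (.reg 6 + .const 1)) <|
    .seq p (.assign 13 (.reg 13 + .const 1))) <|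
  .assign 12 (.reg 12 * .const 2)

/-- Names the sampled blocks for all shifts. -/
def shiftsProg : Prog :=
  .seq (.assign 14 (.const 0)) <| .loop ((Expr.reg 14).less (.reg 9)) nameProg

/-- The preprocessing. -/
def preProg (a : ℕ) : Prog :=
  .seq (setupProg a) <| .seq sampleProg (levelsProg shiftsProg)

/-- Reads the second string at the sampled positions. -/
def readProg : Prog :=
  .seq (.assign 13 (.const 0)) <|
  .loop ((Expr.reg 13).less (.reg 6)) <|
  .seq (.store (.adr 4 (.const 1) (.reg 13) (.const 0) (.const 0))
    (.readB (.load (.adr 0 (.const 1) (.reg 13) (.const 0) (.const 0))))) <|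
  .assign 13 (.reg 13 + .const 1)

/-- Looks up the name of a block of the second string. -/
def lookupProg : Prog :=
  .store (.adr 4 (.reg 12 * .const 2) (.reg 13) (.const 0) (.const 0))
    (.load (.adr 2 (.reg 12 * .const 2) (.reg 13)
      (.load (.adr 4 (.reg 12) (.reg 13) (.const 0) (.const 0)))
      (.load (.adr 4 (.reg 12) (.reg 13 + .reg 12) (.const 0) (.const 0)))))

/-- Puts the maximum of register 16 and a value into register 16. -/
def maxProg (e : Expr) : Prog :=
  .seq (.assign 15 e) <|
  .ite ((Expr.reg 16).less (.reg 15)) (.assign 16 (.reg 15)) .skip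

/-- The end of the longest block that starts at the position in register 13 and matches in the class
in register 18. -/
def jumpProg : Prog :=
  .seq (.assign 16 (.reg 13 + .const 1)) <|
  .seq (.assign 12 (.const 2)) <|
  .loop ((Expr.reg 13 + .reg 12).less (.reg 6 + .const 1)) <|
  .seq (.ite (.load (.adr 3 (.reg 12) (.reg 13)
      (.load (.adr 4 (.reg 12) (.reg 13) (.const 0) (.const 0))) (.reg 18)))
    (.assign 16 (.reg 13 + .reg 12)) .skip) <|
  .assign 12 (.reg 12 * .const 2)

/-- One entry of the table of furthest positions. -/
def entryProg : Prog :=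
  .seq (.assign 13 (.load (.adr 5 (.reg 17) (.reg 18) (.const 0) (.const 0)))) <|
  .seq jumpProg <|
  .seq (maxProg (.load (.adr 5 (.reg 17) (.reg 18 - .const 1) (.const 0) (.const 0)))) <|
  .seq (maxProg (.load (.adr 5 (.reg 17) (.reg 18 + .const 1) (.const 0) (.const 0)))) <|
  .seq (.store (.adr 5 (.reg 17 + .const 1) (.reg 18) (.const 0) (.const 0)) (.reg 16)) <|
  .assign 18 (.reg 18 + .const 1)

/-- The table of furthest positions. -/
def tableProg : Prog :=
  .seq (.assign 17 (.const 0)) <|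
  .loop ((Expr.reg 17).less (.reg 11)) <|
  .seq (.assign 18 (.const 1)) <|
  .seq (.loop ((Expr.reg 18).less (.reg 10 + .const 1)) entryProg) <|
  .assign 17 (.reg 17 + .const 1)

/-- Tests whether the end of the string has been reached. -/
def answerProg : Prog :=
  .seq (.assign 0 (.const 0)) <|
  .seq (.assign 18 (.const 1)) <|
  .loop ((Expr.reg 18).less (.reg 10 + .const 1)) <|
  .seq (.ite ((Expr.load (.adr 5 (.reg 11) (.reg 18) (.const 0) (.const 0))).less (.reg 6))
    .skip (.assign 0 (.const 1))) <|
  .assign 18 (.reg 18 + .const 1)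

/-- The query. -/
def queryProg (a : ℕ) : Prog :=
  .seq (setupProg a) <| .seq readProg <| .seq (levelsProg lookupProg) <| .seq tableProg answerProg

theorem queryProg_randomFree (a : ℕ) : (queryProg a).RandomFree := by
  simp [queryProg, setupProg, readProg, levelsProg, lookupProg, tableProg, entryProg, jumpProg,
    maxProg, answerProg, Prog.RandomFree]

/-! ### Parameters -/

/-- The parameters that are computed at the start, and the bounds that exclude overflows. -/
structure Params where
  (l N K T R E Z M : ℕ)
  hl : 0 < l
  hN : 0 < N
  hT : T = 2 * K + 1
  hR : R = 2 * K / l + 1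
  hNlZ : N * l < Z
  hNEZ : 2 * N + E + 2 < Z
  hTZ : T + 1 < Z
  hRZ : R + 2 < Z
  h6Z : 6 ≤ Z
  hM : 2 ^ 14 * Z ^ 8 ≤ M

theorem Params.four_mul_le (P : Params) : 4 * P.Z ≤ P.M := by
  have h := P.hM
  have := Nat.le_self_pow (show 8 ≠ 0 by norm_num) P.Z
  omega

/-- The registers hold the parameters. -/
def Params.Regs (P : Params) (f : ℕ → ℕ) : Prop :=
  f 5 = P.l ∧ f 6 = P.N ∧ f 7 = P.K ∧ f 9 = P.T ∧ f 10 = P.R ∧ f 11 = P.E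

theorem Params.Regs.of_eq {P : Params} {f g : ℕ → ℕ} (h : P.Regs f)
    (hg : ∀ r, 5 ≤ r → r < 12 → g r = f r) : P.Regs g := by
  obtain ⟨h1, h2, h3, h4, h5, h6⟩ := h
  refine ⟨?_, ?_, ?_, ?_, ?_, ?_⟩ <;> rw [hg _ (by norm_num) (by norm_num)] <;> assumption

theorem Params.Regs.setReg {P : Params} {s : State} (h : P.Regs s.reg) {r v : ℕ}
    (hr : r < 5 ∨ 12 ≤ r) : P.Regs (s.setReg r v).reg :=
  h.of_eq fun x _ _ => by rw [State.setReg_reg, if_neg (by omega)]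

theorem Params.Regs.draw {P : Params} {s : State} (h : P.Regs s.reg) {r v : ℕ}
    (hr : r < 5 ∨ 12 ≤ r) : P.Regs (s.draw r v).reg :=
  h.of_eq fun x _ _ => by rw [State.draw_reg, if_neg (by omega)]

/-! ### Names of sampled blocks -/

open Classical in
/-- One more than the least number below `m` with property `p`, and `0` if there is none. -/
noncomputable def firstBelow (p : ℕ → Prop) : ℕ → ℕ
  | 0 => 0
  | m + 1 => if firstBelow p m = 0 then if p m then m + 1 else 0 else firstBelow p m

section
variable {p q : ℕ → Prop} {m m' t : ℕ}

theorem firstBelow_congr (h : ∀ t < m, (p t ↔ q t)) : firstBelow p m = firstBelow q m := by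
  induction m with
  | zero => rfl
  | succ m ih =>
    rw [firstBelow, firstBelow, ih fun t ht => h t (by omega)]
    have hm := h m (by omega)
    by_cases hp : p m
    · rw [if_pos hp, if_pos (hm.1 hp)]
    · rw [if_neg hp, if_neg fun hq => hp (hm.2 hq)]

theorem firstBelow_le : firstBelow p m ≤ m := by
  induction m with
  | zero => rfl
  | succ m ih => unfold firstBelow; split_ifs <;> omega

theorem firstBelow_ne_zero (ht : t < m) (h : p t) : firstBelow p m ≠ 0 := by
  induction m with
  | zero => omega
  | succ m ih =>
    unfold firstBelow
    rcases eq_or_ne (firstBelow p m) 0 with h0 | h0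
    · have : t = m := by
        by_contra hne
        exact ih (by omega) h0
      subst this
      simp [h0, h]
    · simp [h0]

theorem firstBelow_spec (h : firstBelow p m = t + 1) : t < m ∧ p t := by
  induction m with
  | zero => simp [firstBelow] at h
  | succ m ih =>
    unfold firstBelow at h
    split_ifs at h with h1 h2
    · obtain rfl : m = t := by omega
      exact ⟨by omega, h2⟩
    · exact ⟨by have := (ih h).1; omega, (ih h).2⟩

/-- This is why names can be assigned while the shifts are processed in increasing order: a nonzero
dictionary entry never changes later. -/
theorem firstBelow_stable (h : firstBelow p m ≠ 0) (hm : m ≤ m') :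
    firstBelow p m' = firstBelow p m := by
  induction m', hm using Nat.le_induction with
  | base => rfl
  | succ k _ ih => rw [firstBelow, if_neg (by rwa [ih]), ih]

theorem firstBelow_succ_of_not (h : ¬ p m) : firstBelow p (m + 1) = firstBelow p m := by
  rw [firstBelow]; split_ifs with h1
  · exact h1.symm
  · rfl

theorem firstBelow_succ_of (h : p m) :
    firstBelow p (m + 1) = if firstBelow p m = 0 then m + 1 else firstBelow p m := by
  rw [firstBelow, if_pos h]
end

/-- The name of the block of `h` leaf blocks from `p` on in a sequence `f`: its character if
`h = 1`, otherwise the least shift `t < T` (plus one) where it agrees with `a`, or `0`. -/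
noncomputable def blockName (a : ℕ → ℕ → ℕ) (T h p : ℕ) (f : ℕ → ℕ) : ℕ :=
  if h = 1 then f p else firstBelow (fun t => ∀ i, p ≤ i → i < p + h → a i t = f i) T

section
variable {a : ℕ → ℕ → ℕ} {T h p t : ℕ} {f : ℕ → ℕ}

/-- The samples of A at shift `t` occur at least once, so their name points to a shift that shows
them, and equal names point to the same shift. The bound `t < T` is essential: all sequences that
occur for no shift share the name `0`. -/
theorem blockName_eq_iff (ht : t < T) (hh : 1 ≤ h) :
    blockName a T h p (fun i => a i t) = blockName a T h p f ↔
      ∀ i, p ≤ i → i < p + h → a i t = f i := by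
  unfold blockName
  split_ifs with h1
  · subst h1
    exact ⟨fun g i hi hi' => by obtain rfl : i = p := by omega
                                exact g, fun g => g p le_rfl (by omega)⟩
  · constructor
    · intro g
      have h0 := firstBelow_ne_zero (p := fun t' => ∀ i, p ≤ i → i < p + h → a i t' = a i t) ht
        fun _ _ _ => rfl
      obtain ⟨u, hu⟩ := Nat.exists_eq_succ_of_ne_zero h0
      have h1 := (firstBelow_spec hu).2
      rw [g] at hu
      have h2 := (firstBelow_spec hu).2
      exact fun i hi hi' => (h1 i hi hi').symm.trans (h2 i hi hi')
    · intro g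
      exact firstBelow_congr fun t' _ => ⟨fun k i hi hi' => (k i hi hi').trans (g i hi hi'),
        fun k i hi hi' => (k i hi hi').trans (g i hi hi').symm⟩

/-- The property that is looked up for a pair of names. -/
def PairAt (a : ℕ → ℕ → ℕ) (T h p x y t : ℕ) : Prop :=
  blockName a T h p (fun i => a i t) = x ∧ blockName a T h (p + h) (fun i => a i t) = y

/-- A shift agrees with `f` on the whole block exactly if it agrees on both halves, and for shifts
below `T` agreement on a half is equality of names. So the name of the whole depends only on the two
names of the halves. -/
theorem blockName_double (hh : 1 ≤ h) : blockName a T (h * 2) p f =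
    firstBelow (PairAt a T h p (blockName a T h p f) (blockName a T h (p + h) f)) T := by
  rw [blockName, if_neg (by omega)]
  refine firstBelow_congr fun m hm => ?_
  rw [PairAt, blockName_eq_iff hm hh, blockName_eq_iff hm hh]
  constructor
  · exact fun g => ⟨fun i _ _ => g i (by omega) (by omega),
      fun i _ _ => g i (by omega) (by omega)⟩
  · rintro ⟨g1, g2⟩ i hi hi'
    rcases lt_or_ge i (p + h) with hlt | hge
    · exact g1 i hi hlt
    · exact g2 i hge (by omega)

theorem blockName_lt {Z : ℕ} (hT : T < Z) (hf : f p < Z) : blockName a T h p f < Z := by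
  unfold blockName
  split_ifs
  · exact hf
  · exact firstBelow_le.trans_lt hT

end

end GapEditDistance

namespace GapEditDistance

/-! ### Correctness of the preprocessing -/

/-- The contents of the memory during the preprocessing, where the shifts below `τ h p` have been
processed for the block of length `h` at `p`. -/
structure Tables (P : Params) (a : ℕ → ℕ → ℕ) (q : ℕ → ℕ) (τ : ℕ → ℕ → ℕ) (mem : ℕ → ℕ) :
    Prop where
  pos : ∀ p < P.N, mem (adr 0 1 p 0 0) = q p
  name : ∀ h p t, t < τ h p → mem (adr 1 h p t 0) = blockName a P.T h p fun i => a i t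
  dict : ∀ h p x y, 1 ≤ h →
    mem (adr 2 (h * 2) p x y) = firstBelow (PairAt a P.T h p x y) (τ (h * 2) p)
  good : ∀ h p x r, 2 ≤ h → (mem (adr 3 h p x r) ≠ 0 ↔
    ∃ t < τ h p, t / P.l + 1 = r ∧ blockName a P.T h p (fun i => a i t) = x)
  free : ∀ g u v x y, 4 ≤ g → mem (adr g u v x y) = 0

theorem Tables.congr {P : Params} {a : ℕ → ℕ → ℕ} {q : ℕ → ℕ} {τ τ' : ℕ → ℕ → ℕ} {mem : ℕ → ℕ}
    (h : Tables P a q τ mem) (hτ : ∀ x y, τ' x y = τ x y) : Tables P a q τ' mem := by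
  rwa [show τ' = τ from funext fun x => funext fun y => hτ x y]

/-- Shift `t` itself has the pair of names `(x, y)`, so the search below `t + 1` has already
succeeded, and by stability `v` is the final name. Every other pair is not attained by `t`, so its
dictionary entry rightly stays as it is. -/
theorem Tables.step {P : Params} {a : ℕ → ℕ → ℕ} {q : ℕ → ℕ} {τ τ' : ℕ → ℕ → ℕ} {mem mem' : ℕ → ℕ}
    (H : Tables P a q τ mem) {h p t x y v : ℕ} (hh : 1 ≤ h) (ht : t < P.T) (hτ : τ (h * 2) p = t)
    (hx : x = blockName a P.T h p fun i => a i t)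
    (hy : y = blockName a P.T h (p + h) fun i => a i t)
    (hv : v = firstBelow (PairAt a P.T h p x y) (t + 1))
    (hτ' : ∀ h' p', τ' h' p' = if h' = h * 2 ∧ p' = p then t + 1 else τ h' p')
    (hmem : ∀ z, mem' z = if z = adr 3 (h * 2) p v (t / P.l + 1) then 1 else
      if z = adr 1 (h * 2) p t 0 then v else if z = adr 2 (h * 2) p x y then v else mem z) :
    Tables P a q τ' mem' := by
  have hP : PairAt a P.T h p x y t := ⟨hx.symm, hy.symm⟩
  have hv' : v = blockName a P.T (h * 2) p fun i => a i t := by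
    rw [blockName_double hh, ← hx, ← hy, hv]
    exact (firstBelow_stable (firstBelow_ne_zero (Nat.lt_succ_self t) hP) ht).symm
  constructor
  · intro p' hp'
    rw [hmem]; simpa using H.pos p' hp'
  · intro h' p' t' ht'
    rw [hmem]
    rw [hτ'] at ht'
    by_cases hk : h' = h * 2 ∧ p' = p
    · obtain ⟨rfl, rfl⟩ := hk
      rw [if_pos ⟨rfl, rfl⟩] at ht'
      rcases eq_or_ne t' t with rfl | hne
      · simpa using hv'
      · simpa [hne] using H.name (h * 2) p' t' (by omega)
    · rw [if_neg hk] at ht'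
      have : ¬ (h' = h * 2 ∧ p' = p ∧ t' = t) := fun g => hk ⟨g.1, g.2.1⟩
      simpa [this] using H.name h' p' t' ht'
  · intro h' p' x' y' hh'
    rw [hmem, hτ']
    by_cases hk : h' = h ∧ p' = p
    · obtain ⟨rfl, rfl⟩ := hk
      rcases eq_or_ne x' x with rfl | hxne
      · rcases eq_or_ne y' y with rfl | hyne
        · simpa using hv
        · have : ¬ PairAt a P.T h' p' x' y' t := fun g => hyne (g.2.symm.trans hy.symm)
          simp only [adr_inj, hyne]
          simpa [firstBelow_succ_of_not this, hτ] using H.dict h' p' x' y' hh'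
      · have : ¬ PairAt a P.T h' p' x' y' t := fun g => hxne (g.1.symm.trans hx.symm)
        simp only [adr_inj, hxne]
        simpa [firstBelow_succ_of_not this, hτ] using H.dict h' p' x' y' hh'
    · have h1 : ¬ (h' = h ∧ p' = p ∧ x' = x ∧ y' = y) := fun g => hk ⟨g.1, g.2.1⟩
      have h2 : ¬ (h' * 2 = h * 2 ∧ p' = p) := fun g => hk ⟨by omega, g.2⟩
      simpa [h1, hk] using H.dict h' p' x' y' hh'
  · intro h' p' x' r' hh'
    rw [hmem, hτ']
    by_cases hk : h' = h * 2 ∧ p' = p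
    · obtain ⟨rfl, rfl⟩ := hk
      have := H.good (h * 2) p' x' r' hh'
      rw [hτ] at this
      by_cases hc : x' = v ∧ r' = t / P.l + 1
      · obtain ⟨rfl, rfl⟩ := hc
        simp only [if_true, and_self]
        exact ⟨fun _ => ⟨t, by omega, rfl, hv'.symm⟩, fun _ => one_ne_zero⟩
      · simp only [adr_inj, hc, and_false, true_and, if_false, and_self, if_true]
        norm_num
        rw [← ne_eq, this]
        constructor
        · rintro ⟨t', h1, h2⟩; exact ⟨t', by omega, h2⟩
        · rintro ⟨t', h1, h2, h3⟩
          refine ⟨t', ?_, h2, h3⟩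
          by_contra hlt
          obtain rfl : t' = t := by omega
          exact hc ⟨h3.symm.trans hv'.symm, h2.symm⟩
    · have h1 : ¬ (h' = h * 2 ∧ p' = p ∧ x' = v ∧ r' = t / P.l + 1) := fun g => hk ⟨g.1, g.2.1⟩
      simpa [h1, hk] using H.good h' p' x' r' hh'
  · intro g u v x y hg
    rw [hmem]
    have h1 : g ≠ 1 := by omega
    have h2 : g ≠ 2 := by omega
    have h3 : g ≠ 3 := by omega
    simpa [h1, h2, h3] using H.free g u v x y hg

variable {P : Params} {E : Env} {a : ℕ → ℕ → ℕ} {q : ℕ → ℕ}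

theorem runs_nameProg (hE : E.M = P.M) (ha : ∀ i t, a i t < P.Z) {τ τ' : ℕ → ℕ → ℕ} {s : State}
    {h p t : ℕ} (hs : P.Regs s.reg) (h12 : s.reg 12 = h) (h13 : s.reg 13 = p) (h14 : s.reg 14 = t)
    (H : Tables P a q τ s.mem) (hh : 1 ≤ h) (hp : p + h * 2 ≤ P.N) (ht : t < P.T)
    (hτ : τ (h * 2) p = t) (hτ1 : τ h p = P.T) (hτ2 : τ h (p + h) = P.T)
    (hτ' : ∀ h' p', τ' h' p' = if h' = h * 2 ∧ p' = p then t + 1 else τ h' p') :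
    Runs E nameProg s 6000 fun s' => P.Regs s'.reg ∧ s'.reg 12 = h ∧ s'.reg 13 = p ∧
      s'.reg 14 = t + 1 ∧ Tables P a q τ' s'.mem := by
  have hM := P.hM
  rw [← hE] at hM
  have h4 := P.four_mul_le
  rw [← hE] at h4
  have hNZ := P.hNEZ
  have hTZ := P.hTZ
  have hRZ := P.hRZ
  set x := blockName a P.T h p fun i => a i t with hx
  set y := blockName a P.T h (p + h) fun i => a i t with hy
  set v := firstBelow (PairAt a P.T h p x y) (t + 1) with hv
  have hxZ : x < P.Z := blockName_lt (by omega) (ha _ _)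
  have hyZ : y < P.Z := blockName_lt (by omega) (ha _ _)
  have hvZ : v < P.Z := firstBelow_le.trans_lt (by omega)
  have htR : t / P.l + 1 ≤ P.R := by
    rw [P.hR]
    have := Nat.div_le_div_right (c := P.l) (show t ≤ 2 * P.K by have := P.hT; omega)
    omega
  have hx' : s.mem (adr 1 h p t 0) = x := H.name h p t (by omega)
  have hy' : s.mem (adr 1 h (p + h) t 0) = y := H.name h (p + h) t (by omega)
  have hP : PairAt a P.T h p x y t := ⟨rfl, rfl⟩
  have hd := H.dict h p x y hh
  rw [hτ] at hd
  have c0 : (Expr.const 0).eval E s = 0 := Expr.eval_const (by omega)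
  have e12 : (Expr.reg 12 * .const 2).eval E s = h * 2 :=
    Expr.eval_mul h12 (Expr.eval_const (by omega)) (by omega)
  unfold nameProg
  refine Runs.le (T := ?T) ?run ?bound
  case run =>
    -- Whether the dictionary entry is kept or set to `t + 1`, it ends up as the result of the
    -- search below `t + 1`; both branches therefore meet in the same intermediate assertion.
    refine .seq_assign (v := adr 2 (h * 2) p x y) ?_ <| .seq_mid (T' := 2600)
      (R := fun s' => s'.reg = (s.setReg 15 (adr 2 (h * 2) p x y)).reg ∧
        ∀ z, s'.mem z = if z = adr 2 (h * 2) p x y then v else s.mem z)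
      (.ite (T := 100) (fun h0 => (Runs.skip ?_).le (by norm_num))
        (fun h0 => (Runs.store (x := adr 2 (h * 2) p x y) (v := t + 1) ?_ ?_ ?_).le ?_))
      fun s₁ hs₁ => ?_
    · refine Expr.eval_adr hM e12 h13 (Expr.eval_load ?_ |>.trans hx')
        (Expr.eval_load ?_ |>.trans hy') (by omega) (by omega) (by omega) hxZ hyZ
      · exact Expr.eval_adr hM h12 h13 h14 c0 (by omega) (by omega) (by omega) (by omega) (by omega)
      · exact Expr.eval_adr hM h12 (Expr.eval_add h13 h12 (by omega)) h14 c0 (by omega) (by omega)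
          (by omega) (by omega) (by omega)
    · refine ⟨rfl, fun z => ?_⟩
      simp only [Expr.eval, State.setReg_reg, State.setReg_mem, if_true, hd] at h0 ⊢
      split_ifs with hz
      · rw [hz, hd, hv, firstBelow_succ_of hP, if_neg h0]
      · rfl
    · simp [Expr.eval]
    · exact Expr.eval_add (by simpa [Expr.eval] using h14) (Expr.eval_const (by omega)) (by omega)
    · refine ⟨rfl, fun z => ?_⟩
      simp only [Expr.eval, State.setReg_reg, State.setReg_mem, if_true, hd] at h0
      simp [hv, firstBelow_succ_of hP, h0]
    · simp
    obtain ⟨hr, hm⟩ := hs₁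
    have k5 : s₁.reg 5 = P.l := by rw [hr]; simpa using hs.1
    have k12 : s₁.reg 12 = h := by rw [hr]; simpa using h12
    have k13 : s₁.reg 13 = p := by rw [hr]; simpa using h13
    have k14 : s₁.reg 14 = t := by rw [hr]; simpa using h14
    have k15 : s₁.reg 15 = adr 2 (h * 2) p x y := by rw [hr]; simp
    have kR : P.Regs s₁.reg := hs.of_eq fun r _ _ => by
      rw [hr, State.setReg_reg, if_neg (by omega)]
    have e12 : ∀ s₂ : State, s₂.reg 12 = h → (Expr.reg 12 * .const 2).eval E s₂ = h * 2 :=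
      fun s₂ g => Expr.eval_mul g (Expr.eval_const (by omega)) (by omega)
    have c0 : ∀ s₂, (Expr.const 0).eval E s₂ = 0 := fun _ => Expr.eval_const (by omega)
    have c1 : ∀ s₂, (Expr.const 1).eval E s₂ = 1 := fun _ => Expr.eval_const (by omega)
    refine Runs.le (.seq_assign (v := v) ((Expr.eval_load (Expr.eval_reg k15)).trans ?_) <|
      .seq_store (x := adr 1 (h * 2) p t 0) (v := v) ?_ (Expr.eval_reg (by simp)) <|
      .seq_store (x := adr 3 (h * 2) p v (t / P.l + 1)) (v := 1) ?_ (c1 _) <|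
      .assign (v := t + 1) ?_ ⟨?_, ?_, ?_, ?_, ?_⟩) ?_
    · rw [hm, if_pos rfl]
    · exact Expr.eval_adr hM (e12 _ (by simpa using k12)) (Expr.eval_reg (by simpa using k13))
        (Expr.eval_reg (by simpa using k14)) (c0 _) (by omega) (by omega) (by omega) (by omega)
        (by omega)
    · refine Expr.eval_adr hM (e12 _ (by simpa using k12)) (Expr.eval_reg (by simpa using k13))
        (Expr.eval_reg (by simp)) (Expr.eval_add (Expr.eval_div (Expr.eval_reg (by simpa using k14))
        (Expr.eval_reg (by simpa using k5))) (c1 _) (by omega)) (by omega) (by omega) (by omega)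
        (by omega) (by omega)
    · exact Expr.eval_add (Expr.eval_reg (by simpa using k14)) (c1 _) (by omega)
    · exact (kR.setReg (.inr (by norm_num))).setReg (.inr (by norm_num))
    · simpa using k12
    · simpa using k13
    · simp
    · exact H.step hh ht hτ hx hy hv hτ' fun z => by simp [hm]
    · simp
  case bound => simp

theorem two_pow_succ_le_iff {N i : ℕ} (hN : 0 < N) : 2 ^ i * 2 ≤ N ↔ i < Nat.log 2 N := by
  rw [← pow_succ, ← Nat.le_log_iff_pow_le (by norm_num) hN.ne', Nat.succ_le_iff]

/-- The assertion `J` is left abstract because the same traversal serves twice: naming the blocks of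
A and looking up the names of the blocks of B. Its two indices are the exponent of the length and
the position already reached. -/
theorem runs_levelsProg (hE : E.M = P.M) {body : Prog} {C : ℕ} (J : ℕ → ℕ → (ℕ → ℕ) → Prop)
    (hbody : ∀ i p s, p + 2 ^ i * 2 ≤ P.N → P.Regs s.reg → s.reg 12 = 2 ^ i → s.reg 13 = p →
      J i p s.mem → Runs E body s C fun s' => P.Regs s'.reg ∧ s'.reg 12 = 2 ^ i ∧ s'.reg 13 = p ∧
        J i (p + 1) s'.mem)
    (hnext : ∀ i mem, 2 ^ i * 2 ≤ P.N → J i (P.N + 1 - 2 ^ i * 2) mem → J (i + 1) 0 mem)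
    {s : State} (hs : P.Regs s.reg) (h0 : J 0 0 s.mem) :
    Runs E (levelsProg body) s (Nat.log 2 P.N * (P.N * (C + 20) + 40) + 20) fun s' =>
      P.Regs s'.reg ∧ J (Nat.log 2 P.N) 0 s'.mem := by
  have h4 := P.four_mul_le
  rw [← hE] at h4
  have hNZ := P.hNEZ
  have c0 : ∀ s₂, (Expr.const 0).eval E s₂ = 0 := fun _ => Expr.eval_const (by omega)
  have c1 : ∀ s₂, (Expr.const 1).eval E s₂ = 1 := fun _ => Expr.eval_const (by omega)
  have c2 : ∀ s₂, (Expr.const 2).eval E s₂ = 2 := fun _ => Expr.eval_const (by omega)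
  have e6 : ∀ s₂, P.Regs s₂.reg → (Expr.reg 6 + .const 1).eval E s₂ = P.N + 1 :=
    fun s₂ g => Expr.eval_add (Expr.eval_reg g.2.1) (c1 _) (by omega)
  unfold levelsProg
  refine Runs.le (.seq_assign (v := 1) (c1 _) <| (Runs.loop (T := P.N * (C + 20) + 30)
    (Nat.log 2 P.N) (fun i s' => P.Regs s'.reg ∧ s'.reg 12 = 2 ^ i ∧ J i 0 s'.mem) ?_ ?_ ?_).mono
    le_rfl fun s' g => ⟨g.1, g.2.2⟩) ?_
  · rintro i hi s₁ ⟨h1, h2, h3⟩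
    have hiN := (two_pow_succ_le_iff P.hN).2 hi
    refine ⟨(Expr.eval_less_ne (Expr.eval_mul (Expr.eval_reg h2) (c2 _) (by omega)) (e6 _ h1)).2 (by omega), ?_⟩
    refine Runs.le (.seq_assign (v := 0) (c0 _) <| .seq_mid (Runs.loop (T := C + 4)
      (P.N + 1 - 2 ^ i * 2) (fun p s' => P.Regs s'.reg ∧ s'.reg 12 = 2 ^ i ∧ s'.reg 13 = p ∧
        J i p s'.mem) ?_ ?_ ⟨h1.setReg (.inr (by norm_num)), by simpa using h2, by simp, h3⟩)
        fun s₂ hs₂ => .assign (v := 2 ^ i * 2) ?_ ?_) ?_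
    · rintro p hp s₂ ⟨k1, k2, k3, k4⟩
      refine ⟨(Expr.eval_less_ne (Expr.eval_add (Expr.eval_reg k3) (Expr.eval_mul (Expr.eval_reg k2) (c2 _) (by omega))
        (by omega)) (e6 _ k1)).2 (by omega), ?_⟩
      refine Runs.le (.seq_mid (hbody i p s₂ (by omega) k1 k2 k3 k4) fun s₃ ⟨l1, l2, l3, l4⟩ =>
        .assign (v := p + 1) (Expr.eval_add (Expr.eval_reg l3) (c1 _) (by omega))
        ⟨l1.setReg (.inr (by norm_num)), by simpa using l2, by simp, l4⟩) (by simp)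
    · rintro s₂ ⟨k1, k2, k3, k4⟩
      exact (Expr.eval_less_eq (Expr.eval_add (Expr.eval_reg k3) (Expr.eval_mul (Expr.eval_reg k2) (c2 _) (by omega))
        (by omega)) (e6 _ k1)).2 (by omega)
    · exact Expr.eval_mul (Expr.eval_reg hs₂.2.1) (c2 _) (by omega)
    · exact ⟨hs₂.1.setReg (.inr (by norm_num)), by simp [pow_succ], hnext i _ hiN hs₂.2.2.2⟩
    · simp only [Expr.cost_less, Expr.cost]
      have : (P.N + 1 - 2 ^ i * 2) * (C + 4 + (1 + (1 + 1 + 1) + 1 + (1 + 1 + 1) + 1) + 1) ≤ P.N * (C + 20) :=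
        Nat.mul_le_mul (by have := Nat.one_le_two_pow (n := i); omega) (by omega)
      omega
  · rintro s₁ ⟨h1, h2, h3⟩
    have hiN := (two_pow_succ_le_iff P.hN (i := Nat.log 2 P.N)).not.2 (lt_irrefl _)
    have := Nat.pow_log_le_self 2 P.hN.ne'
    exact (Expr.eval_less_eq (Expr.eval_mul (Expr.eval_reg h2) (c2 _) (by omega)) (e6 _ h1)).2 (by omega)
  · exact ⟨hs.setReg (.inr (by norm_num)), by simp, h0⟩
  · simp only [Expr.cost_less, Expr.cost]
    have : Nat.log 2 P.N * (P.N * (C + 20) + 30 + (1 + 1 + 1 + (1 + 1 + 1) + 1) + 1) ≤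
      Nat.log 2 P.N * (P.N * (C + 20) + 40) := Nat.mul_le_mul_left _ (by omega)
    omega

/-- The tables after the blocks of length at most `2 ^ i` and the first `p` blocks of the next
length have been processed. -/
def TablesAt (P : Params) (a : ℕ → ℕ → ℕ) (q : ℕ → ℕ) (i p : ℕ) (mem : ℕ → ℕ) : Prop :=
  ∃ τ : ℕ → ℕ → ℕ, Tables P a q τ mem ∧
    (∀ j ≤ i, ∀ p', p' + 2 ^ j ≤ P.N → τ (2 ^ j) p' = P.T) ∧
    (∀ p' < p, τ (2 ^ i * 2) p' = P.T) ∧ (∀ p' ≥ p, τ (2 ^ i * 2) p' = 0) ∧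
    ∀ h > 2 ^ i * 2, ∀ p', τ h p' = 0

theorem runs_shiftsProg (hE : E.M = P.M) (ha : ∀ i t, a i t < P.Z) {s : State} {i p : ℕ}
    (hp : p + 2 ^ i * 2 ≤ P.N) (hs : P.Regs s.reg) (h12 : s.reg 12 = 2 ^ i) (h13 : s.reg 13 = p)
    (H : TablesAt P a q i p s.mem) :
    Runs E shiftsProg s (P.T * 6004 + 10) fun s' => P.Regs s'.reg ∧ s'.reg 12 = 2 ^ i ∧
      s'.reg 13 = p ∧ TablesAt P a q i (p + 1) s'.mem := by
  have h4 := P.four_mul_le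
  rw [← hE] at h4
  have hTZ := P.hTZ
  have hi := Nat.one_le_two_pow (n := i)
  obtain ⟨τ, H, H1, H2, H3, H4⟩ := H
  set τt : ℕ → ℕ → ℕ → ℕ := fun t h' p' => if h' = 2 ^ i * 2 ∧ p' = p then t else τ h' p' with hτt
  have hold : ∀ t j p', j ≤ i → p' + 2 ^ j ≤ P.N → τt t (2 ^ j) p' = P.T := by
    intro t j p' hj hp'
    have := Nat.pow_le_pow_right (n := 2) (by norm_num) hj
    simp only [hτt]
    rw [if_neg (by omega), H1 j hj p' hp']
  unfold shiftsProg
  refine Runs.le (.seq_assign (v := 0) (Expr.eval_const (by omega)) <| (Runs.loop (T := 6000) P.T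
    (fun t s' => P.Regs s'.reg ∧ s'.reg 12 = 2 ^ i ∧ s'.reg 13 = p ∧ s'.reg 14 = t ∧
      Tables P a q (τt t) s'.mem) ?_ ?_ ?_).mono le_rfl ?_) ?_
  · rintro t ht s₁ ⟨k1, k2, k3, k4, k5⟩
    refine ⟨(Expr.eval_less_ne (Expr.eval_reg k4) (Expr.eval_reg k1.2.2.2.1)).2 ht, ?_⟩
    refine runs_nameProg hE ha k1 k2 k3 k4 k5 hi hp ht (by simp [hτt])
      (hold t i p le_rfl (by omega)) (hold t i _ le_rfl (by omega)) fun h' p' => ?_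
    simp only [hτt]
    split_ifs <;> rfl
  · rintro s₁ ⟨k1, k2, k3, k4, k5⟩
    exact (Expr.eval_less_eq (Expr.eval_reg k4) (Expr.eval_reg k1.2.2.2.1)).2 le_rfl
  · refine ⟨hs.setReg (.inr (by norm_num)), by simpa using h12, by simpa using h13, by simp,
      H.congr fun h' p' => ?_⟩
    simp only [hτt]
    split_ifs with hc
    · rw [hc.1, hc.2, H3 p le_rfl]
    · rfl
  · rintro s₁ ⟨k1, k2, k3, k4, k5⟩
    refine ⟨k1, k2, k3, τt P.T, k5, fun j hj p' => hold P.T j p' hj, fun p' hp' => ?_, fun p' hp' => ?_,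
      fun h hh p' => ?_⟩
    · simp only [hτt]
      split_ifs with hc
      · rfl
      · exact H2 p' (by simp only [true_and] at hc; omega)
    · simp only [hτt]
      rw [if_neg (by omega), H3 p' (by omega)]
    · simp only [hτt]
      rw [if_neg (by omega), H4 h hh p']
  · simp; omega

/-- The shifted position is taken modulo the number of words, as the machine computes it. A position
to the left of the string becomes huge and will be read as padding. -/
theorem runs_sampleProg (hE : E.M = P.M) (hq : ∀ i, q i = i * P.l + E.tape i % P.l)
    (ha : ∀ i t, a i t = E.strA ((q i + t + E.M - P.K) % E.M)) {s : State}
    (hs : P.Regs s.reg) (hu : s.used = 0) (hmem : ∀ x, s.mem x = 0) :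
    Runs E sampleProg s (P.N * (P.T * 200 + 300) + 10) fun s' => P.Regs s'.reg ∧
      TablesAt P a q 0 0 s'.mem := by
  have hM := P.hM
  rw [← hE] at hM
  have h4 := P.four_mul_le
  rw [← hE] at h4
  have hTZ := P.hTZ
  have hNZ := P.hNEZ
  have hNlZ := P.hNlZ
  have hqZ : ∀ p < P.N, p * P.l + P.l ≤ P.N * P.l := fun p hp => by
    rw [← Nat.succ_mul]; exact Nat.mul_le_mul_right _ hp
  have c0 : ∀ s₂, (Expr.const 0).eval E s₂ = 0 := fun _ => Expr.eval_const (by omega)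
  have c1 : ∀ s₂, (Expr.const 1).eval E s₂ = 1 := fun _ => Expr.eval_const (by omega)
  unfold sampleProg
  refine Runs.le (.seq_assign (v := 0) (c0 _) <| (Runs.loop (T := P.T * 190 + 280) P.N
    (fun p s' => P.Regs s'.reg ∧ s'.reg 13 = p ∧ s'.used = p ∧
      (∀ p' < p, s'.mem (adr 0 1 p' 0 0) = q p') ∧
      (∀ p' < p, ∀ t < P.T, s'.mem (adr 1 1 p' t 0) = a p' t) ∧
      ∀ g u v x y, 2 ≤ g → s'.mem (adr g u v x y) = 0) ?_ ?_ ?_).mono le_rfl ?_) ?_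
  · rintro p hp s₁ ⟨k1, k2, k3, k4, k5, k6⟩
    have hlt := Nat.mod_lt (E.tape p) P.hl
    have hqp := hq p
    have := hqZ p hp
    refine ⟨(Expr.eval_less_ne (Expr.eval_reg k2) (Expr.eval_reg k1.2.1)).2 hp, ?_⟩
    refine Runs.le (.seq (.random (.seq_assign (v := q p) ?_ <|
      .seq_store (x := adr 0 1 p 0 0) (v := q p) ?_ (Expr.eval_reg (by simp)) <|
      .seq_assign (v := 0) (c0 _) <| .seq_mid (Runs.loop (T := 180) P.T
      (fun t s' => P.Regs s'.reg ∧ s'.reg 13 = p ∧ s'.reg 14 = t ∧ s'.reg 15 = q p ∧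
        s'.used = p + 1 ∧
        (∀ p' < p + 1, s'.mem (adr 0 1 p' 0 0) = q p') ∧
        (∀ p' t', (p' < p ∧ t' < P.T ∨ p' = p ∧ t' < t) → s'.mem (adr 1 1 p' t' 0) = a p' t') ∧
        ∀ g u v x y, 2 ≤ g → s'.mem (adr g u v x y) = 0) ?_ ?_ ?_) fun s₂ hs₂ =>
      .assign (v := p + 1) ?_ ?_))) ?_
    · rw [hqp]
      exact Expr.eval_add (Expr.eval_mul (Expr.eval_reg (by simpa using k2))
        (Expr.eval_reg (by simpa using k1.1)) (by omega))
        (Expr.eval_mod (Expr.eval_reg (by simp [k3])) (Expr.eval_reg (by simpa using k1.1)))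
        (by omega)
    · exact Expr.eval_adr hM (c1 _) (Expr.eval_reg (by simpa using k2)) (c0 _) (c0 _) (by omega)
        (by omega) (by omega) (by omega) (by omega)
    · rintro t ht s₂ ⟨j1, j2, j3, j4, j5, j6, j7, j8⟩
      refine ⟨(Expr.eval_less_ne (Expr.eval_reg j3) (Expr.eval_reg j1.2.2.2.1)).2 ht, ?_⟩
      refine Runs.le (.seq_store (x := adr 1 1 p t 0) (v := a p t) ?_ ?_ <|
        .assign (v := t + 1) (Expr.eval_add (Expr.eval_reg j3) (c1 _) (by omega))
        ⟨j1.setReg (.inr (by norm_num)), by simpa using j2, by simp, by simpa using j4,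
          by simpa using j5, ?_, ?_, ?_⟩) ?_
      · exact Expr.eval_adr hM (c1 _) (Expr.eval_reg j2) (Expr.eval_reg j3) (c0 _) (by omega)
          (by omega) (by omega) (by omega) (by omega)
      · rw [ha]
        exact Expr.eval_readA (Expr.eval_sub (Expr.eval_add (Expr.eval_reg j4) (Expr.eval_reg j3)
          (by omega)) (Expr.eval_reg j1.2.2.1))
      · intro p' hp'
        simpa using j6 p' hp'
      · intro p' t' h
        by_cases hc : p' = p ∧ t' = t
        · simp [hc]
        · simpa [hc] using j7 p' t' (by omega)
      · intro g u v x y hg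
        have : g ≠ 1 := by omega
        simpa [this] using j8 g u v x y hg
      · simp
    · rintro s₂ ⟨j1, j2, j3, -⟩
      exact (Expr.eval_less_eq (Expr.eval_reg j3) (Expr.eval_reg j1.2.2.2.1)).2 le_rfl
    · refine ⟨((k1.draw (.inr (by norm_num))).setReg (.inr (by norm_num))).setReg
        (.inr (by norm_num)), by simpa using k2, by simp, by simp, by simpa using k3, ?_, ?_, ?_⟩
      · intro p' hp'
        rcases eq_or_ne p' p with rfl | hne
        · simp
        · simpa [hne] using k4 p' (by omega)
      · intro p' t' h
        simpa using k5 p' (by omega) t' (by omega)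
      · intro g u v x y hg
        have : g ≠ 0 := by omega
        simpa [this] using k6 g u v x y hg
    · exact Expr.eval_add (Expr.eval_reg hs₂.2.1) (c1 _) (by omega)
    · obtain ⟨j1, j2, j3, j4, j5, j6, j7, j8⟩ := hs₂
      exact ⟨j1.setReg (.inr (by norm_num)), by simp, by simpa using j5, by simpa using j6,
        fun p' hp' t ht => by simpa using j7 p' t (by omega), by simpa using j8⟩
    · simp; omega
  · rintro s₁ ⟨k1, k2, -⟩
    exact (Expr.eval_less_eq (Expr.eval_reg k2) (Expr.eval_reg k1.2.1)).2 le_rfl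
  · exact ⟨hs.setReg (.inr (by norm_num)), by simp, hu, by simp, by simp, fun g u v x y _ => hmem _⟩
  · rintro s₁ ⟨k1, k2, k3, k4, k5, k6⟩
    -- Names of single leaf blocks are the characters just stored, so length one counts as processed
    -- for all shifts; dictionary and class table are still empty.
    refine ⟨k1, fun h p => if h = 1 ∧ p < P.N then P.T else 0, ⟨k4, ?_, ?_, ?_, ?_⟩, ?_, ?_, ?_, ?_⟩
    · intro h p t ht
      split_ifs at ht with hc
      · obtain ⟨rfl, hp⟩ := hc
        simp only [blockName, if_true]
        exact k5 p hp t ht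
      · omega
    · intro h p x y hh
      rw [if_neg (by omega), k6 _ _ _ _ _ le_rfl]
      rfl
    · intro h p x r hh
      simp [k6, show h ≠ 1 by omega]
    · exact fun g u v x y hg => k6 g u v x y (by omega)
    · intro j hj p' hp'
      obtain rfl : j = 0 := by omega
      simp only [pow_zero, true_and]
      rw [if_pos (by simpa using hp')]
    · simp
    · simp
    · intro h hh p'
      have : h ≠ 1 := by norm_num at hh; omega
      simp [this]
  · simp only [Expr.cost_less, Expr.cost]
    have : P.N * (P.T * 190 + 280 + (1 + 1 + 1) + 1) ≤ P.N * (P.T * 200 + 300) :=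
      Nat.mul_le_mul_left _ (by omega)
    omega

end GapEditDistance

namespace GapEditDistance

variable {P : Params} {E : Env} {a : ℕ → ℕ → ℕ} {q b : ℕ → ℕ}

/-! ### Correctness of the query -/

/-- What the query uses from the tables of the preprocessing. -/
structure FinalTables (P : Params) (a : ℕ → ℕ → ℕ) (q : ℕ → ℕ) (mem : ℕ → ℕ) : Prop where
  pos : ∀ p < P.N, mem (adr 0 1 p 0 0) = q p
  dict : ∀ i p x y, p + 2 ^ i * 2 ≤ P.N →
    mem (adr 2 (2 ^ i * 2) p x y) = firstBelow (PairAt a P.T (2 ^ i) p x y) P.T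
  good : ∀ i p x r, p + 2 ^ i * 2 ≤ P.N → (mem (adr 3 (2 ^ i * 2) p x r) ≠ 0 ↔
    ∃ t < P.T, t / P.l + 1 = r ∧ blockName a P.T (2 ^ i * 2) p (fun i => a i t) = x)

/-- A block of length `2 ^ i * 2` that fits into `N` has exponent at most `log N`, so after the last
level all `T` shifts have been processed for it. -/
theorem TablesAt.final {mem : ℕ → ℕ} (h : TablesAt P a q (Nat.log 2 P.N) 0 mem) :
    FinalTables P a q mem ∧ ∀ g u v x y, 4 ≤ g → mem (adr g u v x y) = 0 := by
  obtain ⟨τ, H, H1, -⟩ := h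
  have key : ∀ i p, p + 2 ^ i * 2 ≤ P.N → τ (2 ^ i * 2) p = P.T := fun i p hp => by
    rw [← pow_succ] at hp ⊢
    exact H1 _ (Nat.le_log_of_pow_le (by norm_num) (by omega)) p hp
  refine ⟨⟨H.pos, fun i p x y hp => ?_, fun i p x r hp => ?_⟩, H.free⟩
  · rw [H.dict _ _ _ _ Nat.one_le_two_pow, key i p hp]
  · rw [H.good _ _ _ _ (by have := Nat.one_le_two_pow (n := i); omega), key i p hp]

theorem TablesAt.next {i : ℕ} {mem : ℕ → ℕ} (hi : 2 ^ i * 2 ≤ P.N)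
    (h : TablesAt P a q i (P.N + 1 - 2 ^ i * 2) mem) : TablesAt P a q (i + 1) 0 mem := by
  obtain ⟨τ, H, H1, H2, H3, H4⟩ := h
  have := Nat.one_le_two_pow (n := i)
  refine ⟨τ, H, fun j hj p hp => ?_, by simp, fun p _ => H4 _ (by rw [pow_succ]; omega) p,
    fun h hh => H4 h (by rw [pow_succ] at hh; omega)⟩
  rcases Nat.lt_or_ge j (i + 1) with hlt | hge
  · exact H1 j (by omega) p hp
  · obtain rfl : j = i + 1 := by omega
    rw [pow_succ] at hp ⊢
    exact H2 p (by omega)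

theorem FinalTables.of_eq {mem mem' : ℕ → ℕ} (h : FinalTables P a q mem)
    (h' : ∀ g u v x y, g < 4 → mem' (adr g u v x y) = mem (adr g u v x y)) :
    FinalTables P a q mem' where
  pos p hp := by rw [h' _ _ _ _ _ (by norm_num), h.pos p hp]
  dict i p x y hp := by rw [h' _ _ _ _ _ (by norm_num), h.dict i p x y hp]
  good i p x r hp := by rw [h' _ _ _ _ _ (by norm_num), h.good i p x r hp]

/-- The memory during the query while the names of the blocks of the second string are looked up. -/
structure NamesAt (P : Params) (a : ℕ → ℕ → ℕ) (q b : ℕ → ℕ) (i p : ℕ) (mem : ℕ → ℕ) : Prop where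
  final : FinalTables P a q mem
  name : ∀ j ≤ i, ∀ p', p' + 2 ^ j ≤ P.N →
    mem (adr 4 (2 ^ j) p' 0 0) = blockName a P.T (2 ^ j) p' b
  next : ∀ p' < p, p' + 2 ^ i * 2 ≤ P.N →
    mem (adr 4 (2 ^ i * 2) p' 0 0) = blockName a P.T (2 ^ i * 2) p' b
  free : ∀ u v x y, mem (adr 5 u v x y) = 0

theorem runs_readProg (hE : E.M = P.M) (hb : ∀ i, b i = E.strB (q i))
    {s : State} (hs : P.Regs s.reg) (hmem : FinalTables P a q s.mem)
    (hfree : ∀ u v x y, s.mem (adr 5 u v x y) = 0) :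
    Runs E readProg s (P.N * 300 + 10) fun s' => P.Regs s'.reg ∧ NamesAt P a q b 0 0 s'.mem := by
  have hM := P.hM
  rw [← hE] at hM
  have h4 := P.four_mul_le
  rw [← hE] at h4
  have hNZ := P.hNEZ
  have c0 : ∀ s₂, (Expr.const 0).eval E s₂ = 0 := fun _ => Expr.eval_const (by omega)
  have c1 : ∀ s₂, (Expr.const 1).eval E s₂ = 1 := fun _ => Expr.eval_const (by omega)
  unfold readProg
  refine Runs.le (.seq_assign (v := 0) (c0 _) <| (Runs.loop (T := 290) P.N
    (fun p s' => P.Regs s'.reg ∧ s'.reg 13 = p ∧ FinalTables P a q s'.mem ∧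
      (∀ p' < p, s'.mem (adr 4 1 p' 0 0) = b p') ∧
      ∀ u v x y, s'.mem (adr 5 u v x y) = 0) ?_ ?_ ?_).mono le_rfl ?_) ?_
  · rintro p hp s₁ ⟨k1, k2, k3, k4, k5⟩
    refine ⟨(Expr.eval_less_ne (Expr.eval_reg k2) (Expr.eval_reg k1.2.1)).2 hp, ?_⟩
    have ea : ∀ g < 5, (Expr.adr g (.const 1) (.reg 13) (.const 0) (.const 0)).eval E s₁ =
        adr g 1 p 0 0 := fun g hg => Expr.eval_adr hM (c1 _) (Expr.eval_reg k2) (c0 _) (c0 _)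
      (by omega) (by omega) (by omega) (by omega) (by omega)
    refine Runs.le (.seq_store (x := adr 4 1 p 0 0) (v := b p) (ea 4 (by norm_num)) ?_ <|
        .assign (v := p + 1) (Expr.eval_add (Expr.eval_reg k2) (c1 _) (by omega))
        ⟨k1.setReg (.inr (by norm_num)), by simp, ?_, ?_, ?_⟩) (by simp)
    · rw [hb, ← k3.pos p hp]
      exact Expr.eval_readB (Expr.eval_load (ea 0 (by norm_num)))
    · refine k3.of_eq fun g u v x y hg => ?_
      have : g ≠ 4 := by omega
      simp [this]
    · intro p' hp'
      rcases eq_or_ne p' p with rfl | hne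
      · simp
      · simpa [hne] using k4 p' (by omega)
    · simpa using k5
  · rintro s₁ ⟨k1, k2, -⟩
    exact (Expr.eval_less_eq (Expr.eval_reg k2) (Expr.eval_reg k1.2.1)).2 le_rfl
  · exact ⟨hs.setReg (.inr (by norm_num)), by simp, hmem, by simp, hfree⟩
  · rintro s₁ ⟨k1, k2, k3, k4, k5⟩
    refine ⟨k1, k3, fun j hj p hp => ?_, by simp, k5⟩
    obtain rfl : j = 0 := by omega
    simp only [blockName, pow_zero, if_true]
    exact k4 p (by simpa using hp)
  · simp; omega

theorem NamesAt.next_level {i : ℕ} {mem : ℕ → ℕ} (hi : 2 ^ i * 2 ≤ P.N)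
    (h : NamesAt P a q b i (P.N + 1 - 2 ^ i * 2) mem) : NamesAt P a q b (i + 1) 0 mem := by
  refine ⟨h.final, fun j hj p hp => ?_, by simp, h.free⟩
  rcases Nat.lt_or_ge j (i + 1) with hlt | hge
  · exact h.name j (by omega) p hp
  · obtain rfl : j = i + 1 := by omega
    rw [pow_succ] at hp ⊢
    exact h.next p (by omega) hp

/-- A pair of names that no shift of A shows was never entered, and the default `0` of the memory is
exactly the name of a block without a match. So B needs no case distinction. -/
theorem runs_lookupProg (hE : E.M = P.M) (hb : ∀ i, b i < P.Z) {s : State} {i p : ℕ}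
    (hp : p + 2 ^ i * 2 ≤ P.N) (hs : P.Regs s.reg) (h12 : s.reg 12 = 2 ^ i) (h13 : s.reg 13 = p)
    (H : NamesAt P a q b i p s.mem) : Runs E lookupProg s 5000 fun s' => P.Regs s'.reg ∧
      s'.reg 12 = 2 ^ i ∧ s'.reg 13 = p ∧ NamesAt P a q b i (p + 1) s'.mem := by
  have hM := P.hM
  rw [← hE] at hM
  have h4 := P.four_mul_le
  rw [← hE] at h4
  have hNZ := P.hNEZ
  have hTZ := P.hTZ
  have h1 := Nat.one_le_two_pow (n := i)
  have c0 : (Expr.const 0).eval E s = 0 := Expr.eval_const (by omega)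
  have e12 : (Expr.reg 12 * .const 2).eval E s = 2 ^ i * 2 :=
    Expr.eval_mul h12 (Expr.eval_const (by omega)) (by omega)
  have hx := H.name i le_rfl p (by omega)
  have hy := H.name i le_rfl (p + 2 ^ i) (by omega)
  refine Runs.le (.store (x := adr 4 (2 ^ i * 2) p 0 0) (v := blockName a P.T (2 ^ i * 2) p b)
    (Expr.eval_adr hM e12 h13 c0 c0 (by omega) (by omega) (by omega) (by omega) (by omega))
    ?_ ⟨hs, h12, h13, ?_, ?_, ?_, ?_⟩) (by simp)
  · rw [blockName_double h1, ← H.final.dict i p _ _ hp]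
    refine Expr.eval_load (Expr.eval_adr hM e12 h13 ((Expr.eval_load ?_).trans hx)
      ((Expr.eval_load ?_).trans hy) (by omega) (by omega) (by omega)
      (blockName_lt (by omega) (hb _)) (blockName_lt (by omega) (hb _)))
    · exact Expr.eval_adr hM h12 h13 c0 c0 (by omega) (by omega) (by omega) (by omega) (by omega)
    · exact Expr.eval_adr hM h12 (Expr.eval_add h13 h12 (by omega)) c0 c0 (by omega) (by omega)
        (by omega) (by omega) (by omega)
  · refine H.final.of_eq fun g u v x y hg => ?_
    have : g ≠ 4 := by omega
    simp [this]
  · intro j hj p' hp'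
    have := Nat.pow_le_pow_right (n := 2) (by norm_num) hj
    have hne : 2 ^ j ≠ 2 ^ i * 2 := by omega
    simpa [hne] using H.name j hj p' hp'
  · intro p' hp' hp''
    rcases eq_or_ne p' p with rfl | hne
    · simp
    · simpa [hne] using H.next p' (by omega) hp''
  · simpa using H.free

/-! ### The table of furthest positions -/

open Classical in
/-- The end of the longest block of one of the lengths `2, 4, …, 2 ^ i` that starts at `p` and
matches in class `r`, or `p + 1`. -/
noncomputable def jump (good : ℕ → ℕ → ℕ → Prop) (p r : ℕ) : ℕ → ℕ
  | 0 => p + 1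
  | i + 1 => if good (2 ^ i * 2) p r then p + 2 ^ i * 2 else jump good p r i

/-- The furthest position that is reached in `e` rounds when the last class is `r`. -/
noncomputable def furthest (good : ℕ → ℕ → ℕ → Prop) (N R : ℕ) : ℕ → ℕ → ℕ
  | 0, _ => 0
  | e + 1, r => if 1 ≤ r ∧ r ≤ R then
      max (max (jump good (furthest good N R e r) r (Nat.log 2 (N - furthest good N R e r)))
        (furthest good N R e (r - 1))) (furthest good N R e (r + 1)) else 0

theorem jump_le {good : ℕ → ℕ → ℕ → Prop} {p r N i : ℕ} (hi : i ≤ Nat.log 2 (N - p)) :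
    jump good p r i ≤ max (p + 1) N := by
  induction i with
  | zero => simp [jump]
  | succ i ih =>
    unfold jump
    split_ifs
    · have hne : N - p ≠ 0 := by intro h; simp [h] at hi
      have := Nat.pow_le_of_le_log hne hi
      rw [pow_succ] at this
      omega
    · exact ih (by omega)

/-- A round always advances by at least one, so values can pass `N`. The bound serves to exclude
overflow when the query computes with them. -/
theorem furthest_le {good : ℕ → ℕ → ℕ → Prop} {N R e r : ℕ} :
    furthest good N R e r ≤ N + e := by
  induction e generalizing r with
  | zero => simp [furthest]
  | succ e ih =>
    unfold furthest
    split_ifs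
    · have h1 := jump_le (good := good) (r := r) (le_refl (Nat.log 2 (N - furthest good N R e r)))
      have h2 := ih (r := r)
      have h3 := ih (r := r - 1)
      have h4 := ih (r := r + 1)
      omega
    · omega

/-- The sampled characters of the block of length `h` at `p` match for a shift of class `r`. -/
def MatchIn (P : Params) (a : ℕ → ℕ → ℕ) (b : ℕ → ℕ) (h p r : ℕ) : Prop :=
  ∃ t < P.T, t / P.l + 1 = r ∧ ∀ i, p ≤ i → i < p + h → a i t = b i

/-- The memory during the query while the table of furthest positions is computed. -/
structure FurthestAt (P : Params) (a : ℕ → ℕ → ℕ) (q b : ℕ → ℕ) (e r : ℕ) (mem : ℕ → ℕ) :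
    Prop where
  final : FinalTables P a q mem
  name : ∀ j p, p + 2 ^ j ≤ P.N → mem (adr 4 (2 ^ j) p 0 0) = blockName a P.T (2 ^ j) p b
  entry : ∀ e' r', (e' ≤ e ∨ (e' = e + 1 ∧ r' < r)) →
    mem (adr 5 e' r' 0 0) = furthest (MatchIn P a b) P.N P.R e' r'
  free : ∀ e' r', r' < 1 ∨ P.R < r' → mem (adr 5 e' r' 0 0) = 0

/-- Row `0` and the border classes outside `1, …, R` have value `0`, which is what unwritten memory
contains; neither is ever written. -/
theorem NamesAt.furthestAt {mem : ℕ → ℕ} (h : NamesAt P a q b (Nat.log 2 P.N) 0 mem) :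
    FurthestAt P a q b 0 1 mem where
  final := h.final
  name j p hp := h.name j (Nat.le_log_of_pow_le (by norm_num) (by omega)) p hp
  entry e' r' h' := by
    rw [h.free]
    rcases h' with h' | ⟨rfl, h'⟩
    · obtain rfl : e' = 0 := by omega
      rfl
    · rw [furthest, if_neg (by omega)]
  free _ _ _ := h.free _ _ _ _

theorem FurthestAt.next {mem : ℕ → ℕ} {e : ℕ} (h : FurthestAt P a q b e (P.R + 1) mem) :
    FurthestAt P a q b (e + 1) 1 mem where
  final := h.final
  name := h.name
  entry e' r' h' := by
    by_cases hr : r' < P.R + 1 ∧ e' ≤ e + 1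
    · exact h.entry e' r' (by omega)
    · by_cases hr' : r' < 1 ∨ P.R < r'
      · rw [h.free e' r' hr']
        cases e' with
        | zero => rfl
        | succ e' => rw [furthest, if_neg (by omega)]
      · omega
  free := h.free

theorem runs_jumpProg (hE : E.M = P.M) (hb : ∀ i, b i < P.Z) {s : State} {e r r₀ p : ℕ}
    (hs : P.Regs s.reg) (h17 : s.reg 17 = e) (h18 : s.reg 18 = r) (h13 : s.reg 13 = p)
    (hp : p ≤ P.N + P.E) (hr : r ≤ P.R) (H : FurthestAt P a q b e r₀ s.mem) :
    Runs E jumpProg s (Nat.log 2 P.N * 3000 + 100) fun s' => P.Regs s'.reg ∧ s'.reg 17 = e ∧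
      s'.reg 18 = r ∧ s'.reg 16 = jump (MatchIn P a b) p r (Nat.log 2 (P.N - p)) ∧
      s'.mem = s.mem := by
  have hM := P.hM
  rw [← hE] at hM
  have h4 := P.four_mul_le
  rw [← hE] at h4
  have hNZ := P.hNEZ
  have hTZ := P.hTZ
  have hRZ := P.hRZ
  have h6Z := P.h6Z
  have c0 : ∀ s₂, (Expr.const 0).eval E s₂ = 0 := fun _ => Expr.eval_const (by omega)
  have c1 : ∀ s₂, (Expr.const 1).eval E s₂ = 1 := fun _ => Expr.eval_const (by omega)
  have c2 : ∀ s₂, (Expr.const 2).eval E s₂ = 2 := fun _ => Expr.eval_const (by omega)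
  have e6 : ∀ s₂, P.Regs s₂.reg → (Expr.reg 6 + .const 1).eval E s₂ = P.N + 1 :=
    fun s₂ g => Expr.eval_add (Expr.eval_reg g.2.1) (c1 _) (by omega)
  have hlog : Nat.log 2 (P.N - p) ≤ Nat.log 2 P.N := Nat.log_mono_right (by omega)
  have hlt : ∀ i < Nat.log 2 (P.N - p), p + 2 ^ i * 2 ≤ P.N := fun i hi => by
    have hne : 0 < P.N - p := by
      by_contra h
      rw [show P.N - p = 0 by omega, Nat.log_zero_right] at hi
      omega
    have := (two_pow_succ_le_iff hne).2 hi
    omega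
  have hend : P.N < p + 2 ^ Nat.log 2 (P.N - p) * 2 := by
    have := Nat.lt_pow_succ_log_self (b := 2) (by norm_num) (P.N - p)
    rw [pow_succ] at this
    omega
  -- This is the length at which the loop stops, and it must still fit into a word. For `p` at or
  -- beyond `N` the truncated difference and its logarithm are `0`, so the length is `2`; the
  -- summand `2` covers this case.
  have hend' : 2 ^ Nat.log 2 (P.N - p) * 2 ≤ 2 * P.N + 2 := by
    rcases Nat.eq_zero_or_pos (P.N - p) with h | h
    · simp [h]
    · have := Nat.pow_log_le_self 2 h.ne'
      omega
  unfold jumpProg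
  refine Runs.le (.seq_assign (v := p + 1) (Expr.eval_add h13 (c1 _) (by omega)) <|
    .seq_assign (v := 2) (c2 _) <| (Runs.loop (T := 2800) (Nat.log 2 (P.N - p))
    (fun i s' => P.Regs s'.reg ∧ s'.reg 17 = e ∧ s'.reg 18 = r ∧ s'.reg 13 = p ∧
      s'.reg 12 = 2 ^ i * 2 ∧ s'.reg 16 = jump (MatchIn P a b) p r i ∧ s'.mem = s.mem)
      ?_ ?_ ?_).mono le_rfl ?_) ?_
  · rintro i hi s₁ ⟨k1, k2, k3, k4, k5, k6, k7⟩
    have hpi := hlt i hi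
    refine ⟨(Expr.eval_less_ne (Expr.eval_add (Expr.eval_reg k4) (Expr.eval_reg k5) (by omega))
      (e6 _ k1)).2 (by omega), ?_⟩
    have hname := H.name (i + 1) p (by rw [pow_succ]; exact hpi)
    rw [pow_succ] at hname
    -- The table only answers whether the name of B occurs for a shift of the class. Since such
    -- shifts are below `T`, equality of names is equality of all samples, which is `MatchIn`.
    have ev : (Expr.load (.adr 3 (.reg 12) (.reg 13) (.load (.adr 4 (.reg 12) (.reg 13) (.const 0)
        (.const 0))) (.reg 18))).eval E s₁ ≠ 0 ↔ MatchIn P a b (2 ^ i * 2) p r := by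
      rw [Expr.eval_load (Expr.eval_adr hM (Expr.eval_reg k5) (Expr.eval_reg k4)
        (Expr.eval_load (Expr.eval_adr hM (Expr.eval_reg k5) (Expr.eval_reg k4) (c0 _) (c0 _)
        (by omega) (by omega) (by omega) (by omega) (by omega))) (Expr.eval_reg k3) (by omega)
        (by omega) (by omega)
        (by rw [k7, hname]; exact blockName_lt (by omega) (hb _)) (by omega)), k7, hname,
        H.final.good i p _ r hpi]
      refine exists_congr fun t => and_congr_right fun ht => and_congr_right fun _ => ?_
      exact blockName_eq_iff ht (by have := Nat.one_le_two_pow (n := i); omega)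
    refine Runs.le (.seq_mid (T' := 10) (R := fun s' => P.Regs s'.reg ∧ s'.reg 17 = e ∧
        s'.reg 18 = r ∧ s'.reg 13 = p ∧ s'.reg 12 = 2 ^ i * 2 ∧
        s'.reg 16 = jump (MatchIn P a b) p r (i + 1) ∧ s'.mem = s.mem)
      (.ite (T := 10) (fun h0 => (Runs.assign (v := p + 2 ^ i * 2) (Expr.eval_add (Expr.eval_reg k4)
        (Expr.eval_reg k5) (by omega)) ⟨k1.setReg (.inr (by norm_num)), by simpa using k2,
        by simpa using k3, by simpa using k4, by simpa using k5, ?_, k7⟩).le (by simp))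
        (fun h0 => (Runs.skip ⟨k1, k2, k3, k4, k5, ?_, k7⟩).le (by norm_num)))
      fun s₂ hs₂ => ?_) (by simp)
    · obtain ⟨l1, l2, l3, l4, l5, l6, l7⟩ := hs₂
      refine Runs.le (.assign (v := 2 ^ (i + 1) * 2) ?_ ⟨l1.setReg (.inr (by norm_num)),
        by simpa using l2, by simpa using l3, by simpa using l4, by simp, by simpa using l6, l7⟩)
        (by simp)
      rw [pow_succ]
      exact Expr.eval_mul (Expr.eval_reg l5) (c2 _) (by omega)
    · simp [jump, ev.1 h0]
    · rw [k6, jump, if_neg fun hc => ev.2 hc h0]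
  · rintro s₁ ⟨k1, k2, k3, k4, k5, -⟩
    exact (Expr.eval_less_eq (Expr.eval_add (Expr.eval_reg k4) (Expr.eval_reg k5) (by omega))
      (e6 _ k1)).2 (by omega)
  · exact ⟨(hs.setReg (.inr (by norm_num))).setReg (.inr (by norm_num)), by simpa using h17,
      by simpa using h18, by simpa using h13, by simp, by simp [jump], rfl⟩
  · exact fun s₁ ⟨k1, k2, k3, k4, k5, k6, k7⟩ => ⟨k1, k2, k3, k6, k7⟩
  · have := Nat.mul_le_mul_right 3000 hlog
    simp only [Expr.cost_less, Expr.cost]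
    omega

theorem runs_maxProg {e : Expr} {s : State} {x y : ℕ} (hx : s.reg 16 = x)
    (he : e.eval E s = y) : Runs E (maxProg e) s (e.cost + 20) fun s' =>
      s'.reg 16 = max x y ∧ (∀ r, r ≠ 15 → r ≠ 16 → s'.reg r = s.reg r) ∧ s'.mem = s.mem := by
  unfold maxProg
  have ex : (Expr.reg 16).eval E (s.setReg 15 y) = x := Expr.eval_reg (by simpa using hx)
  have ey : (Expr.reg 15).eval E (s.setReg 15 y) = y := Expr.eval_reg (by simp)
  refine Runs.le (.seq_assign (v := y) he <| .ite (T := 10)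
    (fun h0 => (Runs.assign (v := y) ey ⟨?_, ?_, rfl⟩).le (by simp))
    (fun h0 => (Runs.skip ⟨?_, ?_, rfl⟩).le (by norm_num))) (by simp)
  · have := (Expr.eval_less_ne ex ey).1 h0
    simp; omega
  · intro r h1 h2; simp [h1, h2]
  · have := (Expr.eval_less_eq ex ey).1 h0
    simp [hx]; omega
  · intro r h1 h2; simp [h1]

end GapEditDistance

namespace GapEditDistance

variable {P : Params} {E : Env} {a : ℕ → ℕ → ℕ} {q b : ℕ → ℕ}

theorem runs_entryProg (hE : E.M = P.M) (hb : ∀ i, b i < P.Z) {s : State} {e r : ℕ}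
    (hs : P.Regs s.reg) (h17 : s.reg 17 = e) (h18 : s.reg 18 = r) (he : e < P.E) (hr1 : 1 ≤ r)
    (hr : r ≤ P.R) (H : FurthestAt P a q b e r s.mem) :
    Runs E entryProg s (Nat.log 2 P.N * 3000 + 1000) fun s' => P.Regs s'.reg ∧ s'.reg 17 = e ∧
      s'.reg 18 = r + 1 ∧ FurthestAt P a q b e (r + 1) s'.mem := by
  have hM := P.hM
  rw [← hE] at hM
  have h4 := P.four_mul_le
  rw [← hE] at h4
  have hNZ := P.hNEZ
  have hRZ := P.hRZ
  have h6Z := P.h6Z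
  have c0 : ∀ s₂, (Expr.const 0).eval E s₂ = 0 := fun _ => Expr.eval_const (by omega)
  have c1 : ∀ s₂, (Expr.const 1).eval E s₂ = 1 := fun _ => Expr.eval_const (by omega)
  have h5 : ∀ (s₂ : State) (er : Expr) (r' : ℕ), r' ≤ P.R + 1 → s₂.reg 17 = e → s₂.mem = s.mem →
      er.eval E s₂ = r' → (Expr.load (.adr 5 (.reg 17) er (.const 0) (.const 0))).eval E s₂ =
        furthest (MatchIn P a b) P.N P.R e r' := by
    intro s₂ er r' hr' h17' hm her
    rw [← H.entry e r' (.inl le_rfl), ← hm]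
    exact Expr.eval_load (Expr.eval_adr hM (Expr.eval_reg h17') her (c0 _) (c0 _) (by omega)
      (by omega) (by omega) (by omega) (by omega))
  have hle := furthest_le (good := MatchIn P a b) (N := P.N) (R := P.R) (e := e) (r := r)
  unfold entryProg
  refine Runs.le (.seq_assign (h5 s _ r (by omega) h17 rfl (Expr.eval_reg h18)) <|
    .seq_mid (T' := 800) (runs_jumpProg hE hb (e := e) (r := r) (r₀ := r)
      (p := furthest (MatchIn P a b) P.N P.R e r)
      (hs.setReg (.inr (by norm_num))) (by simpa using h17) (by simpa using h18)
      (by simp) (by omega) hr H) fun s₁ ⟨k1, k2, k3, k4, k5⟩ => ?_) ?_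
  · rw [State.setReg_mem] at k5
    refine Runs.le (.seq_mid (T' := 600) (runs_maxProg k4 (h5 s₁ _ (r - 1) (by omega) k2 k5
      (Expr.eval_sub_of_le (Expr.eval_reg k3) (c1 _) hr1 (by omega))))
      fun s₂ ⟨l1, l2, l3⟩ => ?_) (by simp)
    rw [k5] at l3
    refine Runs.le (.seq_mid (T' := 400) (runs_maxProg l1 (h5 s₂ _ (r + 1) (by omega)
      (by rw [l2 _ (by norm_num) (by norm_num), k2]) l3
      (Expr.eval_add (Expr.eval_reg (by rw [l2 _ (by norm_num) (by norm_num), k3])) (c1 _)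
        (by omega)))) fun s₃ ⟨m1, m2, m3⟩ => ?_) (by simp)
    rw [l3] at m3
    have hreg : ∀ r', r' ≠ 15 → r' ≠ 16 → s₃.reg r' = s₁.reg r' := fun r' h1 h2 => by
      rw [m2 r' h1 h2, l2 r' h1 h2]
    have n17 : s₃.reg 17 = e := by rw [hreg _ (by norm_num) (by norm_num), k2]
    have n18 : s₃.reg 18 = r := by rw [hreg _ (by norm_num) (by norm_num), k3]
    have nR : P.Regs s₃.reg := k1.of_eq fun r' _ _ => hreg r' (by omega) (by omega)
    have n16 : s₃.reg 16 = furthest (MatchIn P a b) P.N P.R (e + 1) r := by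
      rw [m1, furthest, if_pos ⟨hr1, hr⟩]
    refine Runs.le (.seq_store (x := adr 5 (e + 1) r 0 0) (Expr.eval_adr hM
      (Expr.eval_add (Expr.eval_reg n17) (c1 _) (by omega)) (Expr.eval_reg n18) (c0 _) (c0 _)
      (by omega) (by omega) (by omega) (by omega) (by omega)) (Expr.eval_reg n16) <|
      .assign (v := r + 1) (Expr.eval_add (Expr.eval_reg (by simpa using n18)) (c1 _) (by omega))
      ⟨nR.setReg (.inr (by norm_num)), by simpa using n17, by simp, ?_⟩) (by simp)
    refine ⟨H.final.of_eq fun g u v x y hg => ?_, fun j p hp => ?_, fun e' r' h' => ?_,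
      fun e' r' h' => ?_⟩
    · have : g ≠ 5 := by omega
      simp [this, m3]
    · simpa [m3] using H.name j p hp
    · by_cases hc : e' = e + 1 ∧ r' = r
      · simp [hc]
      · simpa [m3, hc] using H.entry e' r' (by omega)
    · have : r' ≠ r := by omega
      simpa [m3, this] using H.free e' r' h'
  · simp; omega

theorem runs_tableProg (hE : E.M = P.M) (hb : ∀ i, b i < P.Z) {s : State}
    (hs : P.Regs s.reg) (H : NamesAt P a q b (Nat.log 2 P.N) 0 s.mem) :
    Runs E tableProg s (P.E * (P.R * (Nat.log 2 P.N * 3000 + 1010) + 20) + 10) fun s' =>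
      P.Regs s'.reg ∧ FurthestAt P a q b P.E 1 s'.mem := by
  have h4 := P.four_mul_le
  rw [← hE] at h4
  have hNZ := P.hNEZ
  have hRZ := P.hRZ
  have c0 : ∀ s₂, (Expr.const 0).eval E s₂ = 0 := fun _ => Expr.eval_const (by omega)
  have c1 : ∀ s₂, (Expr.const 1).eval E s₂ = 1 := fun _ => Expr.eval_const (by omega)
  have e10 : ∀ s₂, P.Regs s₂.reg → (Expr.reg 10 + .const 1).eval E s₂ = P.R + 1 :=
    fun s₂ g => Expr.eval_add (Expr.eval_reg g.2.2.2.2.1) (c1 _) (by omega)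
  unfold tableProg
  refine Runs.le (.seq_assign (v := 0) (c0 _) <| (Runs.loop
    (T := P.R * (Nat.log 2 P.N * 3000 + 1010) + 16) P.E
    (fun e s' => P.Regs s'.reg ∧ s'.reg 17 = e ∧ FurthestAt P a q b e 1 s'.mem)
    ?_ ?_ ?_).mono le_rfl fun s' g => ⟨g.1, g.2.2⟩) ?_
  · rintro e he s₁ ⟨k1, k2, k3⟩
    refine ⟨(Expr.eval_less_ne (Expr.eval_reg k2) (Expr.eval_reg k1.2.2.2.2.2)).2 he, ?_⟩
    refine Runs.le (.seq_assign (v := 1) (c1 _) <| .seq_mid (T' := 4) (Runs.loop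
      (T := Nat.log 2 P.N * 3000 + 1000) P.R
      (fun r s' => P.Regs s'.reg ∧ s'.reg 17 = e ∧ s'.reg 18 = r + 1 ∧
        FurthestAt P a q b e (r + 1) s'.mem) ?_ ?_ ⟨k1.setReg (.inr (by norm_num)),
        by simpa using k2, by simp, k3⟩) fun s₂ ⟨l1, l2, l3, l4⟩ => ?_) ?_
    · rintro r hr s₂ ⟨l1, l2, l3, l4⟩
      refine ⟨(Expr.eval_less_ne (Expr.eval_reg l3) (e10 _ l1)).2 (by omega), ?_⟩
      exact runs_entryProg hE hb l1 l2 l3 he (by omega) (by omega) l4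
    · rintro s₂ ⟨l1, l2, l3, -⟩
      exact (Expr.eval_less_eq (Expr.eval_reg l3) (e10 _ l1)).2 le_rfl
    · exact Runs.le (.assign (v := e + 1) (Expr.eval_add (Expr.eval_reg l2) (c1 _) (by omega))
        ⟨l1.setReg (.inr (by norm_num)), by simp, l4.next⟩) (by simp)
    · have : P.R * (Nat.log 2 P.N * 3000 + 1000 + (1 + (1 + 1 + 1) + 1) + 1) ≤
        P.R * (Nat.log 2 P.N * 3000 + 1010) := Nat.mul_le_mul_left _ (by omega)
      simp only [Expr.cost_less, Expr.cost]
      omega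
  · rintro s₁ ⟨k1, k2, -⟩
    exact (Expr.eval_less_eq (Expr.eval_reg k2) (Expr.eval_reg k1.2.2.2.2.2)).2 le_rfl
  · exact ⟨hs.setReg (.inr (by norm_num)), by simp, H.furthestAt⟩
  · have : P.E * (P.R * (Nat.log 2 P.N * 3000 + 1010) + 16 + (1 + 1 + 1) + 1) ≤
      P.E * (P.R * (Nat.log 2 P.N * 3000 + 1010) + 20) := Nat.mul_le_mul_left _ (by omega)
    simp only [Expr.cost_less, Expr.cost]
    omega

theorem runs_answerProg (hE : E.M = P.M) {s : State} (hs : P.Regs s.reg)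
    (H : FurthestAt P a q b P.E 1 s.mem) : Runs E answerProg s (P.R * 200 + 10) fun s' =>
      ((∃ r, 1 ≤ r ∧ r ≤ P.R ∧ P.N ≤ furthest (MatchIn P a b) P.N P.R P.E r) → s'.reg 0 = 1) ∧
      ((∀ r, 1 ≤ r → r ≤ P.R → furthest (MatchIn P a b) P.N P.R P.E r < P.N) → s'.reg 0 = 0) := by
  have hM := P.hM
  rw [← hE] at hM
  have h4 := P.four_mul_le
  rw [← hE] at h4
  have hNZ := P.hNEZ
  have hRZ := P.hRZ
  have h6Z := P.h6Z
  have c0 : ∀ s₂, (Expr.const 0).eval E s₂ = 0 := fun _ => Expr.eval_const (by omega)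
  have c1 : ∀ s₂, (Expr.const 1).eval E s₂ = 1 := fun _ => Expr.eval_const (by omega)
  have e10 : ∀ s₂, P.Regs s₂.reg → (Expr.reg 10 + .const 1).eval E s₂ = P.R + 1 :=
    fun s₂ g => Expr.eval_add (Expr.eval_reg g.2.2.2.2.1) (c1 _) (by omega)
  set D := furthest (MatchIn P a b) P.N P.R P.E with hD
  unfold answerProg
  refine Runs.le (.seq_assign (v := 0) (c0 _) <| .seq_assign (v := 1) (c1 _) <| (Runs.loop
    (T := 190) P.R (fun r s' => P.Regs s'.reg ∧ s'.reg 18 = r + 1 ∧ s'.mem = s.mem ∧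
      ((∃ r', 1 ≤ r' ∧ r' ≤ r ∧ P.N ≤ D r') → s'.reg 0 = 1) ∧
      ((∀ r', 1 ≤ r' → r' ≤ r → D r' < P.N) → s'.reg 0 = 0)) ?_ ?_ ?_).mono le_rfl
      fun s' g => g.2.2.2) ?_
  · rintro r hr s₁ ⟨k1, k2, k3, k4, k5⟩
    refine ⟨(Expr.eval_less_ne (Expr.eval_reg k2) (e10 _ k1)).2 (by omega), ?_⟩
    have ev : (Expr.load (.adr 5 (.reg 11) (.reg 18) (.const 0) (.const 0))).eval E s₁ =
        D (r + 1) := by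
      rw [hD, ← H.entry P.E (r + 1) (.inl le_rfl), ← k3]
      exact Expr.eval_load (Expr.eval_adr hM (Expr.eval_reg k1.2.2.2.2.2) (Expr.eval_reg k2) (c0 _)
        (c0 _) (by omega) (by omega) (by omega) (by omega) (by omega))
    refine Runs.le (.seq_mid (T' := 10) (R := fun s' => P.Regs s'.reg ∧ s'.reg 18 = r + 1 ∧
      s'.mem = s.mem ∧
      ((∃ r', 1 ≤ r' ∧ r' ≤ r + 1 ∧ P.N ≤ D r') → s'.reg 0 = 1) ∧
      ((∀ r', 1 ≤ r' → r' ≤ r + 1 → D r' < P.N) → s'.reg 0 = 0))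
      (.ite (T := 10) (fun h0 => (Runs.skip ⟨k1, k2, k3, ?_, ?_⟩).le (by norm_num))
      (fun h0 => (Runs.assign (v := 1) (c1 _) ⟨k1.setReg (.inl (by norm_num)), by simpa using k2,
        k3, ?_, ?_⟩).le (by simp))) fun s₂ ⟨l1, l2, l3, l4, l5⟩ => ?_) (by simp)
    · exact Runs.le (.assign (v := r + 1 + 1) (Expr.eval_add (Expr.eval_reg l2) (c1 _) (by omega))
        ⟨l1.setReg (.inr (by norm_num)), by simp, l3, by simpa using l4, by simpa using l5⟩)
        (by simp)
    · have hlt := (Expr.eval_less_ne ev (Expr.eval_reg k1.2.1)).1 h0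
      rintro ⟨r', h1, h2, h3⟩
      have : r' ≠ r + 1 := by rintro rfl; omega
      exact k4 ⟨r', h1, by omega, h3⟩
    · exact fun h => k5 fun r' h1 h2 => h r' h1 (by omega)
    · simp
    · have hge := (Expr.eval_less_eq ev (Expr.eval_reg k1.2.1)).1 h0
      intro h
      have := h (r + 1) (by omega) le_rfl
      omega
  · rintro s₁ ⟨k1, k2, -⟩
    exact (Expr.eval_less_eq (Expr.eval_reg k2) (e10 _ k1)).2 le_rfl
  · exact ⟨(hs.setReg (.inl (by norm_num))).setReg (.inr (by norm_num)), by simp, rfl,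
      by rintro ⟨r', h1, h2, -⟩; omega, by simp⟩
  · simp; omega

/-! ### Computing the parameters from the input -/

theorem lt_log_succ_iff {x i : ℕ} (hx : 0 < x) : x / 2 ^ i ≠ 0 ↔ i < Nat.log 2 x + 1 := by
  rw [Nat.div_ne_zero_iff, Nat.lt_succ_iff, Nat.le_log_iff_pow_le (by norm_num) hx.ne']
  simp

/-- Repeated halving of `n` counts `log n + 1` rounds in register 4, which must start at `0`;
doubling while `2 l ≤ ℓ` gives the largest power of two up to ℓ. The bounds by `E.M` keep all
intermediate values below the number of words. -/
theorem runs_setupProg {a n k ℓ L l K T : ℕ} (hn : 0 < n) (hℓ : 0 < ℓ)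
    (hL : L = Nat.log 2 n + 1) (hl : l = 2 ^ Nat.log 2 ℓ) (hK : K = a * L ^ a * k)
    (hM3 : 3 < E.M) (hLM : L < E.M) (hℓM : 2 * ℓ < E.M) (haM : a < E.M)
    (hpM : L ^ a < E.M)
    (hapM : a * L ^ a < E.M) (hKM : K * 2 + 1 < E.M) (hEM : (L + 2) * (K + 1) < E.M) {s : State}
    (h0 : s.reg 0 = n) (h1 : s.reg 1 = k) (h2 : s.reg 2 = ℓ) (h4 : s.reg 4 = 0)
    (hT : T = L * 20 + Nat.log 2 ℓ * 20 + a * 2 + 100) :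
    Runs E (setupProg a) s T fun s' =>
      s'.reg 5 = l ∧ s'.reg 6 = n / l ∧ s'.reg 7 = K ∧ s'.reg 9 = K * 2 + 1 ∧
      s'.reg 10 = K * 2 / l + 1 ∧ s'.reg 11 = (L + 2) * (K + 1) ∧ s'.mem = s.mem ∧
      s'.used = s.used := by
  have c1 : ∀ s₂, (Expr.const 1).eval E s₂ = 1 := fun _ => Expr.eval_const (by omega)
  have c2 : ∀ s₂, (Expr.const 2).eval E s₂ = 2 := fun _ => Expr.eval_const (by omega)
  have hlℓ : l ≤ ℓ := hl ▸ Nat.pow_log_le_self 2 hℓ.ne'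
  unfold setupProg
  refine Runs.le (.seq_assign (v := n) (Expr.eval_reg h0) <| .seq_mid
    (T' := Nat.log 2 ℓ * 20 + a * 2 + 80)
    (Runs.loop (T := 10) L (fun i s' => s'.reg 0 = n ∧ s'.reg 1 = k ∧ s'.reg 2 = ℓ ∧ s'.reg 4 = i ∧
      s'.reg 12 = n / 2 ^ i ∧ s'.mem = s.mem ∧ s'.used = s.used) ?_ ?_ ?_)
    fun s₁ ⟨k0, k1, k2, k4, _, km, ku⟩ => ?_) ?_
  · rintro i hi s₁ ⟨k0, k1, k2, k4, k12, km, ku⟩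
    refine ⟨?_, Runs.le (.seq_assign (v := n / 2 ^ (i + 1)) ?_ <|
      .assign (v := i + 1) (Expr.eval_add (Expr.eval_reg (by simpa using k4)) (c1 _) (by omega))
      ⟨by simpa using k0, by simpa using k1, by simpa using k2, by simp, by simp, km, ku⟩)
      (by simp)⟩
    · rw [Expr.eval_reg k12, lt_log_succ_iff hn, ← hL]
      exact hi
    · rw [Expr.eval_div (Expr.eval_reg k12) (c2 _), Nat.div_div_eq_div_mul, pow_succ]
  · rintro s₁ ⟨k0, k1, k2, k4, k12, km, ku⟩
    rw [Expr.eval_reg k12]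
    by_contra h
    have := (lt_log_succ_iff hn).1 h
    omega
  · exact ⟨by simpa using h0, by simpa using h1, by simpa using h2, by simpa using h4, by simp, rfl,
      rfl⟩
  · refine Runs.le (.seq_assign (v := 1) (c1 _) <| .seq_mid (T' := a * 2 + 60)
      (Runs.loop (T := 4) (Nat.log 2 ℓ) (fun i s' => s'.reg 0 = n ∧ s'.reg 1 = k ∧ s'.reg 2 = ℓ ∧
        s'.reg 4 = L ∧ s'.reg 5 = 2 ^ i ∧ s'.mem = s.mem ∧ s'.used = s.used) ?_ ?_
        ⟨by simpa using k0, by simpa using k1, by simpa using k2, by simpa using k4, by simp, km, ku⟩)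
      fun s₂ ⟨l0, l1, l2, l4, l5, lm, lu⟩ => ?_) ?_
    · rintro i hi s₂ ⟨l0, l1, l2, l4, l5, lm, lu⟩
      have := (two_pow_succ_le_iff hℓ).2 hi
      refine ⟨(Expr.eval_less_ne (Expr.eval_mul (Expr.eval_reg l5) (c2 _) (by omega))
        (Expr.eval_add (Expr.eval_reg l2) (c1 _) (by omega))).2 (by omega), Runs.le
        (.assign (v := 2 ^ i * 2) (Expr.eval_mul (Expr.eval_reg l5) (c2 _) (by omega))
        ⟨by simpa using l0, by simpa using l1, by simpa using l2, by simpa using l4,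
        by simp [pow_succ], lm, lu⟩) (by simp)⟩
    · rintro s₂ ⟨l0, l1, l2, l4, l5, lm, lu⟩
      have := (two_pow_succ_le_iff hℓ (i := Nat.log 2 ℓ)).not.2 (lt_irrefl _)
      exact (Expr.eval_less_eq (Expr.eval_mul (Expr.eval_reg l5) (c2 _) (by omega))
        (Expr.eval_add (Expr.eval_reg l2) (c1 _) (by omega))).2 (by omega)
    · rw [← hl] at l5
      refine Runs.le (.seq_assign (v := n / l) (Expr.eval_div (Expr.eval_reg l0) (Expr.eval_reg l5))
        <| .seq_assign (v := K) ?_ <| .seq_assign (v := K * 2 + 1) ?_ <|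
        .seq_assign (v := K * 2 / l + 1) ?_ <| .assign (v := (L + 2) * (K + 1)) ?_
        ⟨by simpa using l5, by simp, by simp, by simp, by simp, by simp, lm, lu⟩) ?_
      · rw [hK]
        exact Expr.eval_mul (Expr.eval_mul (Expr.eval_const haM) (Expr.eval_pow
          (Expr.eval_reg (by simpa using l4)) (by omega) a hpM) hapM)
          (Expr.eval_reg (by simpa using l1)) (by rw [← hK]; omega)
      · exact Expr.eval_add (Expr.eval_mul (Expr.eval_reg (by simp)) (c2 _) (by omega)) (c1 _) hKM
      · refine Expr.eval_add (Expr.eval_div (Expr.eval_mul (Expr.eval_reg (by simp)) (c2 _)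
          (by omega)) (Expr.eval_reg (by simpa using l5))) (c1 _) ?_
        have := Nat.div_le_self (K * 2) l
        omega
      · have : L + 2 ≤ (L + 2) * (K + 1) := Nat.le_mul_of_pos_right _ (by omega)
        exact Expr.eval_mul (Expr.eval_add (Expr.eval_reg (by simpa using l4)) (c2 _) (by omega))
          (Expr.eval_add (Expr.eval_reg (by simp)) (c1 _) (by omega)) hEM
      · simp [Expr.cost_pow]; omega
    · simp; omega
  · simp; omega

end GapEditDistance

namespace GapEditDistance

/-! ### Small edit distance -/

/-- An edit sequence gives, for every position of the second string, a shift and the cost so far: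
the shift changes by at most the change of the cost, and characters match where the cost is
unchanged. -/
theorem exists_shift_of_editSeq {α : Type*} {xs ys : List α} {d : ℕ} (h : EditSeq xs ys d) :
    ∃ (sh : ℕ → ℤ) (cost : ℕ → ℕ), |sh 0| ≤ cost 0 ∧ cost ys.length ≤ d ∧
      ∀ x < ys.length, cost x ≤ cost (x + 1) ∧ |sh (x + 1) - sh x| ≤ cost (x + 1) - cost x ∧
        (cost (x + 1) = cost x → ∃ y : ℕ, (y : ℤ) = x + sh x ∧ xs[y]? = ys[x]?) := by
  induction h with
  | refl => exact ⟨fun _ => 0, fun _ => 0, by simp, by simp, fun x _ => ⟨le_rfl, by simp,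
      fun _ => ⟨x, by simp, rfl⟩⟩⟩
  | step _ hs ih =>
    obtain ⟨sh, cost, h0, hd, hx⟩ := ih
    cases hs with
    | insert u v c =>
      -- Positions behind the inserted character come from their predecessors, with the same partner
      -- in the first string, hence the shift decreases by one. The cost rises across the inserted
      -- character.
      refine ⟨fun x => if x ≤ u.length then sh x else sh (x - 1) - 1,
        fun x => if x ≤ u.length then cost x else cost (x - 1) + 1, by simpa using h0, ?_, ?_⟩
      · simp only [List.length_append, List.length_cons] at hd ⊢
        rw [if_neg (by omega), show u.length + (v.length + 1) - 1 = u.length + v.length by omega]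
        omega
      · intro x hxl
        simp only [List.length_append, List.length_cons] at hx hxl
        rcases lt_trichotomy x u.length with hlt | heq | hgt
        · simp only [if_pos hlt.le, if_pos (show x + 1 ≤ u.length from hlt)]
          rw [List.getElem?_append_left hlt]
          have := hx x (by omega)
          rwa [List.getElem?_append_left hlt] at this
        · subst heq
          simp
        · simp only [if_neg (show ¬ x ≤ u.length by omega),
            if_neg (show ¬ x + 1 ≤ u.length by omega)]
          obtain ⟨z, rfl⟩ : ∃ z, x = z + 1 := ⟨x - 1, by omega⟩
          obtain ⟨g1, g2, g3⟩ := hx z (by omega)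
          simp only [Nat.add_sub_cancel]
          refine ⟨by omega, ?_, fun g => ?_⟩
          · rw [show sh (z + 1) - 1 - (sh z - 1) = sh (z + 1) - sh z by ring]
            push_cast; linarith
          · obtain ⟨y, hy, hy'⟩ := g3 (by omega)
            refine ⟨y, by push_cast; linarith, hy'.trans ?_⟩
            rw [List.getElem?_append_right (by omega), List.getElem?_append_right (by omega),
              show z + 1 - u.length = z - u.length + 1 by omega, List.getElem?_cons_succ]
    | delete u v c =>
      -- Positions from the deletion on come from their successors. If `u` is empty this includes
      -- position `0`, so an initial shift can arise; hence the induction carries `|sh 0| ≤ cost 0`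
      -- instead of `sh 0 = 0`.
      refine ⟨fun x => if x < u.length then sh x else sh (x + 1) + 1,
        fun x => if x < u.length then cost x else cost (x + 1) + 1, ?_, ?_, ?_⟩
      · simp only [List.length_append, List.length_cons] at hx
        by_cases hu : 0 < u.length
        · simpa only [if_pos hu] using h0
        · simp only [if_neg hu]
          obtain ⟨g1, g2, -⟩ := hx 0 (by omega)
          rw [abs_le] at *
          push_cast
          constructor <;> linarith [g2.1, g2.2, h0.1, h0.2]
      · simp only [List.length_append, List.length_cons] at hd ⊢
        rw [if_neg (by omega), add_assoc]
        omega
      · intro x hxl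
        simp only [List.length_append, List.length_cons] at hx hxl
        rcases lt_trichotomy (x + 1) u.length with hlt | heq | hgt
        · have hlt' : x < u.length := by omega
          simp only [if_pos hlt, if_pos hlt']
          rw [List.getElem?_append_left hlt']
          have := hx x (by omega)
          rwa [List.getElem?_append_left hlt'] at this
        · simp only [if_neg (show ¬ x + 1 < u.length by omega), if_pos (show x < u.length by omega)]
          obtain ⟨g1, g2, -⟩ := hx x (by omega)
          obtain ⟨g3, g4, -⟩ := hx (x + 1) (by omega)
          refine ⟨by omega, ?_, fun g => by omega⟩
          rw [abs_le] at *
          push_cast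
          constructor <;> linarith [g2.1, g2.2, g4.1, g4.2]
        · simp only [if_neg (show ¬ x + 1 < u.length by omega),
            if_neg (show ¬ x < u.length by omega)]
          obtain ⟨g1, g2, g3⟩ := hx (x + 1) (by omega)
          refine ⟨by omega, ?_, fun g => ?_⟩
          · rw [show sh (x + 1 + 1) + 1 - (sh (x + 1) + 1) = sh (x + 1 + 1) - sh (x + 1) by ring]
            push_cast; linarith
          · obtain ⟨y, hy, hy'⟩ := g3 (by omega)
            refine ⟨y, by push_cast at hy; linarith, hy'.trans ?_⟩
            rw [List.getElem?_append_right (by omega), List.getElem?_append_right (by omega),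
              show x + 1 - u.length = x - u.length + 1 by omega, List.getElem?_cons_succ]
    | subst u v c c' =>
      refine ⟨sh, fun x => if x ≤ u.length then cost x else cost x + 1, by simpa using h0, ?_, ?_⟩
      · simp only [List.length_append, List.length_cons] at hd ⊢
        rw [if_neg (by omega)]
        omega
      · intro x hxl
        simp only [List.length_append, List.length_cons] at hx hxl
        obtain ⟨g1, g2, g3⟩ := hx x (by omega)
        rcases lt_trichotomy x u.length with hlt | heq | hgt
        · simp only [if_pos hlt.le, if_pos (show x + 1 ≤ u.length from hlt)]
          rw [List.getElem?_append_left hlt] at g3 ⊢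
          exact ⟨g1, g2, g3⟩
        · simp only [if_neg (show ¬ x + 1 ≤ u.length by omega), if_pos (show x ≤ u.length by omega)]
          exact ⟨by omega, by push_cast; linarith, fun g => by omega⟩
        · simp only [if_neg (show ¬ x + 1 ≤ u.length by omega),
            if_neg (show ¬ x ≤ u.length by omega)]
          refine ⟨by omega, by push_cast; linarith, fun g => ?_⟩
          obtain ⟨y, hy, hy'⟩ := g3 (by omega)
          refine ⟨y, hy, hy'.trans ?_⟩
          rw [List.getElem?_append_right (by omega), List.getElem?_append_right (by omega),
            show x - u.length = x - u.length - 1 + 1 by omega, List.getElem?_cons_succ,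
            List.getElem?_cons_succ]

section
variable {good : ℕ → ℕ → ℕ → Prop} {N R e r p i j : ℕ}

theorem le_jump : p + 1 ≤ jump good p r i := by
  induction i with
  | zero => exact le_rfl
  | succ i ih =>
    unfold jump
    have := Nat.one_le_two_pow (n := i)
    split_ifs <;> omega

theorem le_jump_of_good (hj : j < i) (h : good (2 ^ j * 2) p r) :
    p + 2 ^ j * 2 ≤ jump good p r i := by
  induction i with
  | zero => omega
  | succ i ih =>
    unfold jump
    have := Nat.pow_le_pow_right (n := 2) (by norm_num) (Nat.lt_succ_iff.1 hj)
    split_ifs with h1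
    · omega
    · refine ih ?_
      by_contra hge
      obtain rfl : j = i := by omega
      exact h1 h

theorem furthest_succ (h1 : 1 ≤ r) (hR : r ≤ R) : furthest good N R (e + 1) r =
    max (max (jump good (furthest good N R e r) r (Nat.log 2 (N - furthest good N R e r)))
      (furthest good N R e (r - 1))) (furthest good N R e (r + 1)) := by
  rw [furthest, if_pos ⟨h1, hR⟩]

theorem furthest_add_one_le (h1 : 1 ≤ r) (hR : r ≤ R) :
    furthest good N R e r + 1 ≤ furthest good N R (e + 1) r := by
  rw [furthest_succ h1 hR]
  have := le_jump (good := good) (p := furthest good N R e r) (r := r)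
    (i := Nat.log 2 (N - furthest good N R e r))
  omega

theorem furthest_mono (h1 : 1 ≤ r) (hR : r ≤ R) {e' : ℕ} (he : e ≤ e') :
    furthest good N R e r ≤ furthest good N R e' r := by
  induction e', he using Nat.le_induction with
  | base => exact le_rfl
  | succ e' _ ih => exact ih.trans (by have := furthest_add_one_le (good := good) (N := N) (e := e')
                                          h1 hR; omega)

/-- Each round takes over the values of the neighbouring classes, so one round per unit of distance
between the classes is enough; spare rounds do no harm by monotonicity. -/
theorem furthest_move {δ r' : ℕ} (h1 : 1 ≤ r) (hR : r ≤ R) (h1' : 1 ≤ r') (hR' : r' ≤ R)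
    (h : r ≤ r' + δ) (h' : r' ≤ r + δ) :
    furthest good N R e r ≤ furthest good N R (e + δ) r' := by
  induction δ generalizing r' with
  | zero =>
    obtain rfl : r = r' := by omega
    exact le_rfl
  | succ δ ih =>
    rw [← add_assoc, furthest_succ h1' hR']
    rcases lt_trichotomy r r' with hlt | heq | hgt
    · exact (ih (by omega) (by omega) (by omega) (by omega)).trans
        ((le_max_right _ _).trans (le_max_left _ _))
    · subst heq
      rw [← furthest_succ h1' hR']
      exact furthest_mono h1 hR (by omega)
    · exact (ih (by omega) (by omega) (by omega) (by omega)).trans (le_max_right _ _)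

/-- In a run of leaf blocks that match for the same class, the distance to its end is halved in
every round. -/
theorem furthest_run {i₀ : ℕ} (h1 : 1 ≤ r) (hR : r ≤ R) (hi : i ≤ N)
    (hgood : ∀ p h, i₀ ≤ p → p + h ≤ i → good h p r) (h0 : i₀ ≤ furthest good N R e r) (u : ℕ) :
    i ≤ furthest good N R (e + u) r + (i - i₀) / 2 ^ u := by
  induction u with
  | zero => simp; omega
  | succ u ih =>
    rw [pow_succ, ← Nat.div_div_eq_div_mul, ← add_assoc]
    set m := (i - i₀) / 2 ^ u
    have hp0 := h0.trans (furthest_mono (good := good) (N := N) h1 hR (Nat.le_add_right e u))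
    have hstep := furthest_add_one_le (good := good) (N := N) (e := e + u) h1 hR
    set p := furthest good N R (e + u) r with hp
    rcases Nat.lt_or_ge p i with hlt | hge
    · obtain hj | hj := Nat.eq_zero_or_pos (Nat.log 2 (i - p))
      -- Fewer than two leaf blocks remain, and the unconditional advance by one passes them.
      · rw [Nat.log_eq_zero_iff] at hj
        omega
      · obtain ⟨j, hj'⟩ : ∃ j, Nat.log 2 (i - p) = j + 1 := ⟨_, (Nat.succ_pred hj.ne').symm⟩
        have l1 := Nat.pow_log_le_self 2 (show i - p ≠ 0 by omega)
        have l2 := Nat.lt_pow_succ_log_self (b := 2) (by norm_num) (i - p)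
        rw [pow_succ, hj'] at l2
        rw [hj'] at l1
        rw [pow_succ] at l1 l2
        -- The largest power of two up to `i - p` is among the lengths that are tried because `i ≤
        -- N`; its block matches and covers more than half of the remaining distance.
        have hN : Nat.log 2 (i - p) ≤ Nat.log 2 (N - p) := Nat.log_mono_right (by omega)
        have hle : p + 2 ^ j * 2 ≤ furthest good N R (e + u + 1) r := by
          rw [furthest_succ h1 hR, ← hp]
          exact (le_jump_of_good (by omega) (hgood _ _ hp0 (by omega))).trans
            ((le_max_left _ _).trans (le_max_left _ _))
        omega
    · omega
end

/-- If the strings can be aligned block by block with cost at most `K`, the end is reached. -/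
theorem exists_furthest_of_shifts {P : Params} {a : ℕ → ℕ → ℕ} {b t c : ℕ → ℕ} {L : ℕ}
    (hL : P.N < 2 ^ L) (hE : P.E = (L + 2) * (P.K + 1)) (ht : ∀ i ≤ P.N, t i < P.T)
    (hc : ∀ i < P.N, c i ≤ c (i + 1))
    (htc : ∀ i < P.N, t (i + 1) ≤ t i + (c (i + 1) - c i) ∧ t i ≤ t (i + 1) + (c (i + 1) - c i))
    (hab : ∀ i < P.N, c (i + 1) = c i → a i (t i) = b i) (hK : c P.N ≤ P.K) :
    ∃ r, 1 ≤ r ∧ r ≤ P.R ∧ P.N ≤ furthest (MatchIn P a b) P.N P.R P.E r := by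
  have hcls : ∀ i ≤ P.N, t i / P.l + 1 ≤ P.R := fun i hi => by
    have := ht i hi
    rw [P.hR]
    have := Nat.div_le_div_right (c := P.l) (show t i ≤ 2 * P.K by have := P.hT; omega)
    omega
  have hmono : ∀ i ≤ P.N, ∀ i' ≤ i, c i' ≤ c i := by
    intro i hi i' hi'
    induction i, hi' using Nat.le_induction with
    | base => exact le_rfl
    | succ i _ ih => exact (ih (by omega)).trans (hc i (by omega))
  -- Constant cost from `i₀` to `i` forces a constant shift, so these leaf blocks are one run for
  -- the class of `t i`. As `i ≤ N < 2 ^ L`, `L` halvings leave no distance.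
  have hrun : ∀ i ≤ P.N, ∀ i₀ ≤ i, c i₀ = c i →
      i₀ ≤ furthest (MatchIn P a b) P.N P.R ((L + 2) * c i) (t i / P.l + 1) →
      i ≤ furthest (MatchIn P a b) P.N P.R ((L + 2) * c i + L) (t i / P.l + 1) := by
    intro i hi i₀ hi₀ hci h
    have hteq : ∀ x, i₀ ≤ x → x ≤ i → t x = t i := by
      intro x hx hxi
      induction hxi using Nat.decreasingInduction with
      | self => rfl
      | of_succ x hxi ih =>
        rw [← ih (by omega)]
        have h1 := hmono i hi (x + 1) (by omega)
        have h2 := hmono x (by omega) i₀ hx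
        have h3 := hc x (by omega)
        have := htc x (by omega)
        omega
    have key := furthest_run (good := MatchIn P a b) (N := P.N) (R := P.R) (e := (L + 2) * c i)
      (r := t i / P.l + 1) (Nat.le_add_left 1 _) (hcls i hi) hi (i₀ := i₀) (fun p h hp hph => ?_) h L
    · have : (i - i₀) / 2 ^ L = 0 := Nat.div_eq_of_lt (by omega)
      omega
    · refine ⟨t i, ht i hi, rfl, fun x hx hxh => ?_⟩
      have h1 := hmono i hi (x + 1) (by omega)
      have h2 := hmono x (by omega) i₀ (by omega)
      have h3 := hc x (by omega)
      rw [← hteq x (by omega) (by omega)]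
      exact hab x (by omega) (by omega)
  -- Here `i₀` is a start of the current run of constant cost. Only reaching `i₀` is charged to the
  -- budget of `L + 2` rounds per unit of cost; the `L` rounds along the run are charged to the next
  -- increase.
  have hmain : ∀ i ≤ P.N, ∃ i₀ ≤ i, c i₀ = c i ∧
      i₀ ≤ furthest (MatchIn P a b) P.N P.R ((L + 2) * c i) (t i / P.l + 1) := by
    intro i
    induction i with
    | zero => exact fun _ => ⟨0, le_rfl, rfl, Nat.zero_le _⟩
    | succ i ih =>
      intro hi
      obtain ⟨i₀, h1, h2, h3⟩ := ih (by omega)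
      have hci := hc i (by omega)
      have htci := htc i (by omega)
      rcases hci.eq_or_lt with heq | hlt
      · refine ⟨i₀, by omega, by omega, ?_⟩
        rwa [← heq, show t (i + 1) = t i by omega]
      · refine ⟨i + 1, le_rfl, rfl, ?_⟩
        obtain ⟨δ, hδ⟩ : ∃ δ, c (i + 1) = c i + (δ + 1) := ⟨c (i + 1) - c i - 1, by omega⟩
        have g1 := hrun i (by omega) i₀ h1 h2 h3
        have g2 := furthest_add_one_le (good := MatchIn P a b) (N := P.N) (R := P.R)
          (e := (L + 2) * c i + L) (Nat.le_add_left 1 (t i / P.l)) (hcls i (by omega))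
        have hdiv : ∀ x y, x ≤ y + (δ + 1) → x / P.l + 1 ≤ y / P.l + 1 + (δ + 1) := by
          intro x y hxy
          have : x / P.l ≤ (y + (δ + 1) * P.l) / P.l := Nat.div_le_div_right
            (hxy.trans (Nat.add_le_add_left (Nat.le_mul_of_pos_right _ P.hl) _))
          rw [Nat.add_mul_div_right _ _ P.hl] at this
          omega
        have g3 := furthest_move (good := MatchIn P a b) (N := P.N) (R := P.R)
          (e := (L + 2) * c i + L + 1) (δ := δ + 1) (Nat.le_add_left 1 (t i / P.l))
          (hcls i (by omega)) (Nat.le_add_left 1 (t (i + 1) / P.l)) (hcls (i + 1) hi)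
          (hdiv _ _ (by omega)) (hdiv _ _ (by omega))
        -- An increase of the cost by `δ + 1` uses `L` rounds to finish the run, one to pass leaf
        -- block `i`, and `δ + 1` to change the class.
        have g4 : (L + 2) * c i + L + 1 + (δ + 1) ≤ (L + 2) * c (i + 1) := by
          rw [hδ]; nlinarith
        have g5 := furthest_mono (good := MatchIn P a b) (N := P.N)
          (Nat.le_add_left 1 (t (i + 1) / P.l)) (hcls (i + 1) hi) g4
        omega
  obtain ⟨i₀, h1, h2, h3⟩ := hmain P.N le_rfl
  refine ⟨t P.N / P.l + 1, Nat.le_add_left 1 _, hcls _ le_rfl, (hrun P.N le_rfl i₀ h1 h2 h3).trans ?_⟩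
  refine furthest_mono (Nat.le_add_left 1 _) (hcls _ le_rfl) ?_
  rw [hE]
  nlinarith

/-- Take the shift and the cost of the alignment at the boundaries of the leaf blocks. If the cost
does not change across a leaf block, the shift is constant in it and every character matches, so the
sample matches wherever it lies; no probability is involved. The shift at the start is paid for by
the cost at the start, so all shifts are at most `d ≤ K` in absolute value, and adding `K` makes
them indices below `T`. -/
theorem exists_furthest_of_editSeq {P : Params} {n σ L d : ℕ} {A B : Fin n → Fin σ}
    {a : ℕ → ℕ → ℕ} {b q : ℕ → ℕ} (hL : P.N < 2 ^ L) (hE : P.E = (L + 2) * (P.K + 1))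
    (hN : P.N * P.l ≤ n) (hnM : n ≤ P.M) (hq : ∀ i, i * P.l ≤ q i ∧ q i < i * P.l + P.l)
    (ha : ∀ i t, a i t = charAt A ((q i + t + P.M - P.K) % P.M))
    (hb : ∀ i, b i = charAt B (q i)) (h : EditSeq (List.ofFn A) (List.ofFn B) d) (hd : d ≤ P.K) :
    ∃ r, 1 ≤ r ∧ r ≤ P.R ∧ P.N ≤ furthest (MatchIn P a b) P.N P.R P.E r := by
  obtain ⟨sh, cost, h0, hc, hx⟩ := exists_shift_of_editSeq h
  rw [List.length_ofFn] at hc hx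
  have hmono : ∀ x ≤ n, ∀ x' ≤ x, cost x' ≤ cost x ∧ |sh x - sh x'| ≤ cost x - cost x' := by
    intro x hxn x' hx'
    induction x, hx' using Nat.le_induction with
    | base => simp
    | succ x _ ih =>
      obtain ⟨g1, g2⟩ := ih (by omega)
      obtain ⟨g3, g4, -⟩ := hx x (by omega)
      refine ⟨g1.trans g3, ?_⟩
      calc |sh (x + 1) - sh x'| ≤ |sh (x + 1) - sh x| + |sh x - sh x'| := abs_sub_le _ _ _
        _ ≤ _ := by linarith
  have hsh : ∀ x ≤ n, |sh x| ≤ P.K := by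
    intro x hxn
    have g1 := (hmono x hxn 0 (Nat.zero_le _)).2
    have g2 := (hmono n le_rfl x hxn).1
    have g3 : (cost x : ℤ) ≤ P.K := by exact_mod_cast g2.trans (hc.trans hd)
    calc |sh x| = |(sh x - sh 0) + sh 0| := by rw [sub_add_cancel]
      _ ≤ |sh x - sh 0| + |sh 0| := abs_add_le _ _
      _ ≤ P.K := by linarith
  have hin : ∀ i ≤ P.N, i * P.l ≤ n := fun i hi => (Nat.mul_le_mul_right _ hi).trans hN
  refine exists_furthest_of_shifts (t := fun i => (sh (i * P.l) + P.K).toNat)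
    (c := fun i => cost (i * P.l)) hL hE ?_ ?_ ?_ ?_ ?_
  · intro i hi
    have := abs_le.1 (hsh _ (hin i hi))
    have := P.hT
    omega
  · exact fun i hi => (hmono _ (hin _ hi) _ (Nat.mul_le_mul_right _ (Nat.le_succ i))).1
  · intro i hi
    have g1 := abs_le.1 (hsh _ (hin i hi.le))
    have g2 := abs_le.1 (hsh _ (hin (i + 1) hi))
    obtain ⟨g3, g4⟩ := hmono _ (hin _ hi) _ (Nat.mul_le_mul_right P.l (Nat.le_succ i))
    have g5 := abs_le.1 g4
    simp only [Nat.succ_eq_add_one] at *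
    omega
  · intro i hi hci
    have hil := hin (i + 1) hi
    rw [Nat.succ_mul] at hil hci
    obtain ⟨hq1, hq2⟩ := hq i
    have g1 := hmono (q i) (by omega) (i * P.l) hq1
    have g2 := hmono (i * P.l + P.l) hil (q i + 1) (by omega)
    obtain ⟨g3, -, g4⟩ := hx (q i) (by omega)
    obtain ⟨y, hy, hy'⟩ := g4 (by omega)
    have g5 := abs_le.1 g1.2
    have hsheq : sh (q i) = sh (i * P.l) := by omega
    have hK := abs_le.1 (hsh _ (hin i hi.le))
    have hqn : q i < n := by omega
    have hyn : y < n := by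
      by_contra hyn
      rw [List.getElem?_ofFn, List.getElem?_ofFn, dif_neg hyn, dif_pos hqn] at hy'
      simp at hy'
    have hKM : P.K < P.M := by
      have := P.four_mul_le
      have := P.hTZ
      have := P.hT
      omega
    rw [ha, hb, show q i + (sh (i * P.l) + P.K).toNat + P.M - P.K = y + P.M by omega,
      Nat.add_mod_right, Nat.mod_eq_of_lt (by omega)]
    rw [List.getElem?_ofFn, List.getElem?_ofFn, dif_pos hyn, dif_pos hqn] at hy'
    rw [charAt, charAt, dif_pos hyn, dif_pos hqn, Option.some.inj hy']
  · exact (hmono n le_rfl _ hN).1.trans (hc.trans hd)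

end GapEditDistance

/-! ### Operations on edit sequences -/

section
variable {α : Type*} {xs ys zs w : List α} {d d' : ℕ}

theorem EditSeq.append_right (h : EditSeq xs ys d) (w : List α) :
    EditSeq (xs ++ w) (ys ++ w) d := by
  induction h with
  | refl => exact .refl _
  | step _ hs ih =>
    refine .step ih ?_
    cases hs with
    | insert u v c => simpa using EditStep.insert u (v ++ w) c
    | delete u v c => simpa using EditStep.delete u (v ++ w) c
    | subst u v c c' => simpa using EditStep.subst u (v ++ w) c c'

theorem EditSeq.head (h : EditStep xs ys) (h' : EditSeq ys zs d) : EditSeq xs zs (d + 1) := by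
  induction h' with
  | refl => exact .step (.refl _) h
  | step _ hs ih => exact .step ih hs

end

namespace GapEditDistance

/-! ### Large edit distance -/

section
variable {α : Type*} {A B : List α} {x x' : ℤ} {y d d' δ : ℕ}

/-- The first `x` characters of `A` can be turned into the first `y` characters of `B` with at most
`d` edits. -/
def PrefixDist (A B : List α) (x : ℤ) (y d : ℕ) : Prop :=
  ∃ d' ≤ d, EditSeq (A.take x.toNat) (B.take y) d'

theorem PrefixDist.mono (h : PrefixDist A B x y d) (hd : d ≤ d') : PrefixDist A B x y d' := by
  obtain ⟨e, he, h⟩ := h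
  exact ⟨e, he.trans hd, h⟩

theorem toNat_add_one (x : ℤ) : (x + 1).toNat = x.toNat ∨ (x + 1).toNat = x.toNat + 1 := by
  omega

/-- Beyond the end `take` stays constant, as `toNat` does below `0`. Therefore the moves of
`PrefixDist` need no range conditions, and a truncated move is harmless. -/
theorem take_succ_cases (A : List α) (m : ℕ) :
    A.take (m + 1) = A.take m ∨ ∃ c, A.take (m + 1) = A.take m ++ [c] := by
  rw [List.take_add_one]
  cases A[m]? with
  | none => exact .inl (by simp)
  | some c => exact .inr ⟨c, by simp⟩

theorem PrefixDist.left_succ (h : PrefixDist A B x y d) : PrefixDist A B (x + 1) y (d + 1) := by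
  rcases toNat_add_one x with hx | hx
  · unfold PrefixDist
    rw [hx]
    exact h.mono (Nat.le_succ d)
  · obtain ⟨e, he, h⟩ := h
    unfold PrefixDist
    rw [hx]
    rcases take_succ_cases A x.toNat with hA | ⟨c, hA⟩
    · rw [hA]; exact ⟨e, by omega, h⟩
    · rw [hA]
      exact ⟨e + 1, by omega, .head (by simpa using EditStep.delete (A.take x.toNat) [] c) h⟩

theorem PrefixDist.left_pred (h : PrefixDist A B (x + 1) y d) : PrefixDist A B x y (d + 1) := by
  rcases toNat_add_one x with hx | hx
  · refine PrefixDist.mono ?_ (Nat.le_succ d)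
    unfold PrefixDist at *
    rwa [hx] at h
  · obtain ⟨e, he, h⟩ := h
    rw [hx] at h
    rcases take_succ_cases A x.toNat with hA | ⟨c, hA⟩
    · rw [hA] at h; exact ⟨e, by omega, h⟩
    · rw [hA] at h
      exact ⟨e + 1, by omega, .head (by simpa using EditStep.insert (A.take x.toNat) [] c) h⟩

theorem PrefixDist.left_move (h : PrefixDist A B x y d) (hx : |x' - x| ≤ δ) :
    PrefixDist A B x' y (d + δ) := by
  induction δ generalizing x' with
  | zero =>
    obtain rfl : x' = x := by have := abs_le.1 hx; push_cast at this; omega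
    exact h
  | succ δ ih =>
    have hx := abs_le.1 hx
    push_cast at hx
    rcases lt_trichotomy x' x with hlt | heq | hgt
    · exact (ih (x' := x' + 1) (abs_le.2 ⟨by omega, by omega⟩)).left_pred
    · subst heq
      exact h.mono (by omega)
    · have := (ih (x' := x' - 1) (abs_le.2 ⟨by omega, by omega⟩)).left_succ
      rwa [sub_add_cancel] at this

theorem PrefixDist.right_succ (h : PrefixDist A B x y d) : PrefixDist A B x (y + 1) (d + 1) := by
  obtain ⟨e, he, h⟩ := h
  rcases take_succ_cases B y with hB | ⟨c, hB⟩
  · exact ⟨e, by omega, by rwa [hB]⟩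
  · refine ⟨e + 1, by omega, .step h ?_⟩
    rw [hB]
    simpa using EditStep.insert (B.take y) [] c

theorem PrefixDist.right_move (h : PrefixDist A B x y d) (δ : ℕ) :
    PrefixDist A B x (y + δ) (d + δ) := by
  induction δ with
  | zero => exact h
  | succ δ ih => exact ih.right_succ

theorem PrefixDist.both_succ (h : PrefixDist A B x y d) :
    PrefixDist A B (x + 1) (y + 1) (d + 1) := by
  rcases toNat_add_one x with hx | hx
  · have := h.right_succ
    unfold PrefixDist at *
    rwa [hx]
  · rcases take_succ_cases A x.toNat with hA | ⟨c, hA⟩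
    · have := h.right_succ
      unfold PrefixDist at *
      rwa [hx, hA]
    · rcases take_succ_cases B y with hB | ⟨c', hB⟩
      · have := h.left_succ
        unfold PrefixDist at *
        rwa [hB]
      · obtain ⟨e, he, h⟩ := h
        unfold PrefixDist
        rw [hx, hA, hB]
        refine ⟨e + 1, by omega, .step (h.append_right [c]) ?_⟩
        exact EditStep.subst (B.take y) [] c c'

/-- The character of `A` at an integer position. -/
def charOf (A : List α) (x : ℤ) : Option α := if x < 0 then none else A[x.toNat]?

theorem PrefixDist.both_match (h : PrefixDist A B x y d) (hc : charOf A x = B[y]?) :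
    PrefixDist A B (x + 1) (y + 1) d := by
  obtain ⟨e, he, h⟩ := h
  refine ⟨e, he, ?_⟩
  rw [List.take_add_one, ← hc]
  unfold charOf
  split_ifs with hx
  · rw [show (x + 1).toNat = x.toNat by omega]
    simpa using h
  · rw [show (x + 1).toNat = x.toNat + 1 by omega, List.take_add_one]
    exact h.append_right _

/-- Walk along the diagonal: a position in `S` is paid for by at most one edit, every other position
is free. -/
theorem PrefixDist.block (h : PrefixDist A B x y d) (m : ℕ) (S : Finset ℕ)
    (hS : ∀ z < m, z ∉ S → charOf A (x + z) = B[y + z]?) :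
    PrefixDist A B (x + m) (y + m) (d + S.card) := by
  have key : ∀ m' ≤ m, PrefixDist A B (x + m') (y + m') (d + (S.filter (· < m')).card) := by
    intro m'
    induction m' with
    | zero => intro; simpa using h
    | succ m' ih =>
      intro hm'
      push_cast
      rw [← add_assoc, ← add_assoc]
      by_cases hz : m' ∈ S
      · refine (ih (by omega)).both_succ.mono ?_
        rw [add_assoc, add_le_add_iff_left]
        refine Finset.card_lt_card (Finset.ssubset_iff_of_subset ?_ |>.2 ⟨m', ?_, ?_⟩)
        · intro z
          simp only [Finset.mem_filter]
          exact fun g => ⟨g.1, by omega⟩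
        · simp [hz]
        · simp
      · refine ((ih (by omega)).both_match (hS m' (by omega) hz)).mono ?_
        refine Nat.add_le_add_left (Finset.card_le_card fun z => ?_) d
        simp only [Finset.mem_filter]
        exact fun g => ⟨g.1, by omega⟩
  exact (key m le_rfl).mono (Nat.add_le_add_left (Finset.card_filter_le _ _) d)

theorem PrefixDist.both_move (h : PrefixDist A B x y d) (m : ℕ) :
    PrefixDist A B (x + m) (y + m) (d + m) := by
  induction m with
  | zero => simpa using h
  | succ m ih =>
    push_cast
    rw [← add_assoc]
    exact ih.both_succ

end

/-! ### From the table of furthest positions to an alignment -/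

theorem jump_cases {good : ℕ → ℕ → ℕ → Prop} {p r : ℕ} (i : ℕ) :
    jump good p r i = p + 1 ∨
      ∃ j < i, good (2 ^ j * 2) p r ∧ jump good p r i = p + 2 ^ j * 2 := by
  induction i with
  | zero => exact .inl rfl
  | succ i ih =>
    unfold jump
    split_ifs with h
    · exact .inr ⟨i, by omega, h, rfl⟩
    · rcases ih with ih | ⟨j, hj, h1, h2⟩
      · exact .inl ih
      · exact .inr ⟨j, by omega, h1, h2⟩

/-- The characters at position `x` of `B` and at the position of `A` shifted by `t - K` differ. -/
def Mismatch {n σ : ℕ} (P : Params) (A B : Fin n → Fin σ) (t x : ℕ) : Prop :=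
  charAt A ((x + t + P.M - P.K) % P.M) ≠ charAt B x

open Classical in
/-- The number of mismatches in the block of `h` leaf blocks at `p`. -/
noncomputable def mismatches {n σ : ℕ} (P : Params) (A B : Fin n → Fin σ) (h p t : ℕ) : ℕ :=
  ((Finset.range (h * P.l)).filter fun z => Mismatch P A B t (p * P.l + z)).card

/-- A position left of A wraps around to at least `M - K`, which is beyond `n` by `n + T < M`, so it
shows the padding symbol `σ`. For `x < n` the character of B is below `σ`; hence agreement is never
agreement with padding. -/
theorem charOf_eq_of_not_mismatch {n σ t x : ℕ} {P : Params} {A B : Fin n → Fin σ}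
    (hx : x < n) (ht : t < P.T) (hnM : n + P.T < P.M) (h : ¬ Mismatch P A B t x) :
    charOf (List.ofFn A) (x + (t - P.K : ℤ)) = (List.ofFn B)[x]? := by
  have hT := P.hT
  rw [Mismatch, not_not] at h
  rw [List.getElem?_ofFn, dif_pos hx]
  unfold charOf
  rw [charAt, charAt, dif_pos hx] at h
  have hB := (B ⟨x, hx⟩).isLt
  by_cases h0 : (x : ℤ) + (t - P.K) < 0
  · have e1 : (x + t + P.M - P.K) % P.M = x + t + P.M - P.K := Nat.mod_eq_of_lt (by omega)
    rw [dif_neg (by omega)] at h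
    omega
  · rw [if_neg h0]
    have e1 : (x + t + P.M - P.K) % P.M = (x + (t - P.K : ℤ)).toNat := by
      rw [show x + t + P.M - P.K = (x + (t - P.K : ℤ)).toNat + P.M by omega, Nat.add_mod_right,
        Nat.mod_eq_of_lt (by omega)]
    simp only [e1] at h
    split_ifs at h with hlt
    · rw [List.getElem?_ofFn, dif_pos hlt, Fin.ext h]
    · omega

section
variable {P : Params} {n σ H : ℕ} {A B : Fin n → Fin σ} {a : ℕ → ℕ → ℕ} {b : ℕ → ℕ}

open Classical in
-- Class `r` is represented by its least shift `(r - 1) l - K`, and every shift of the class is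
-- within `l` of it. A jump therefore costs `l` to reach the matching shift, at most `H l` for
-- hidden mismatches, and `l` to return. Passing one leaf block or changing to a neighbouring class
-- costs `l`. The initial shift accounts for `K + l`. The classes `0` and `R + 1` are included
-- because the recursion reads them.
theorem prefixDist_furthest (hN : P.N * P.l ≤ n) (hnM : n + P.T < P.M)
    (hab : ∀ j p t, p + 2 ^ j ≤ P.N → t < P.T → (∀ i, p ≤ i → i < p + 2 ^ j → a i t = b i) →
      mismatches P A B (2 ^ j) p t ≤ H * P.l) (e r : ℕ) (hr : r ≤ P.R + 1) :
    PrefixDist (List.ofFn A) (List.ofFn B)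
      ((furthest (MatchIn P a b) P.N P.R e r * P.l : ℕ) + ((r - 1 : ℤ) * P.l - P.K))
      (furthest (MatchIn P a b) P.N P.R e r * P.l) (P.K + P.l + e * ((H + 2) * P.l)) := by
  have hRl : P.R * P.l ≤ 2 * P.K + P.l := by
    rw [P.hR, Nat.add_mul, one_mul]
    exact Nat.add_le_add_right (Nat.div_mul_le_self _ _) _
  have base : ∀ r ≤ P.R + 1, ∀ e, PrefixDist (List.ofFn A) (List.ofFn B)
      ((0 * P.l : ℕ) + ((r - 1 : ℤ) * P.l - P.K)) (0 * P.l)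
      (P.K + P.l + e * ((H + 2) * P.l)) := by
    intro r hr e
    have h0 : PrefixDist (List.ofFn A) (List.ofFn B) 0 0 0 := ⟨0, le_rfl, by simpa using .refl _⟩
    have h1 : (r : ℤ) * P.l ≤ 2 * P.K + 2 * P.l := by
      have : r * P.l ≤ (P.R + 1) * P.l := Nat.mul_le_mul_right _ hr
      rw [Nat.add_mul, one_mul] at this
      exact_mod_cast (show r * P.l ≤ 2 * P.K + 2 * P.l by omega)
    have h2 : (0 : ℤ) ≤ r * P.l := by positivity
    rw [zero_mul]
    refine (h0.left_move (δ := P.K + P.l) ?_).mono (by omega)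
    rw [abs_le]
    push_cast
    constructor <;> nlinarith
  induction e generalizing r with
  | zero => exact base r hr 0
  | succ e ih =>
    by_cases hrR : 1 ≤ r ∧ r ≤ P.R
    · have hU : P.K + P.l + (e + 1) * ((H + 2) * P.l) =
          P.K + P.l + e * ((H + 2) * P.l) + (H * P.l + P.l + P.l) := by ring
      rw [hU]
      set C := P.K + P.l + e * ((H + 2) * P.l)
      have hlU : P.l ≤ H * P.l + P.l + P.l := by omega
      rw [furthest_succ hrR.1 hrR.2]
      set p := furthest (MatchIn P a b) P.N P.R e r with hp
      have ihr : PrefixDist (List.ofFn A) (List.ofFn B) ((p * P.l : ℕ) + ((r - 1 : ℤ) * P.l - P.K))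
        (p * P.l) C := ih r hr
      rcases max_choice (max (jump (MatchIn P a b) p r (Nat.log 2 (P.N - p)))
        (furthest (MatchIn P a b) P.N P.R e (r - 1))) (furthest (MatchIn P a b) P.N P.R e (r + 1))
        with h1 | h1 <;> rw [h1]
      · rcases max_choice (jump (MatchIn P a b) p r (Nat.log 2 (P.N - p)))
          (furthest (MatchIn P a b) P.N P.R e (r - 1)) with h2 | h2 <;> rw [h2]
        · rcases jump_cases (good := MatchIn P a b) (p := p) (r := r) (Nat.log 2 (P.N - p)) with
            h3 | ⟨j, hj, hgood, h3⟩ <;> rw [h3]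
          · have := (ihr.both_move P.l).mono (Nat.add_le_add_left hlU _)
            rw [Nat.succ_mul]
            push_cast at this ⊢
            rwa [add_right_comm]
          · obtain ⟨t, ht, htr, hm⟩ := hgood
            have hpN : p + 2 ^ (j + 1) ≤ P.N := by
              have hne : 0 < P.N - p := by
                by_contra h
                rw [show P.N - p = 0 by omega, Nat.log_zero_right] at hj
                omega
              have := (two_pow_succ_le_iff hne).2 hj
              rw [pow_succ]
              omega
            have hmis := hab (j + 1) p t hpN ht (by rwa [pow_succ])
            rw [pow_succ] at hmis hpN
            have hdm := Nat.div_add_mod t P.l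
            have hml := Nat.mod_lt t P.hl
            have htr' : (r - 1 : ℤ) * P.l = (P.l * (t / P.l) : ℕ) := by
              rw [← htr]; push_cast; ring
            obtain ⟨w, hw⟩ : ∃ w, w = P.l * (t / P.l) := ⟨_, rfl⟩
            rw [← hw] at hdm htr'
            have g1 := ihr.left_move (x' := (p * P.l : ℕ) + (t - P.K : ℤ)) (δ := P.l) (by
              rw [htr', abs_le]; constructor <;> omega)
            have g2 := g1.block (2 ^ j * 2 * P.l) ((Finset.range (2 ^ j * 2 * P.l)).filter
              fun z => Mismatch P A B t (p * P.l + z)) fun z hz hzS => by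
                rw [Finset.mem_filter, Finset.mem_range, not_and] at hzS
                have : (p + 2 ^ j * 2) * P.l ≤ P.N * P.l := Nat.mul_le_mul_right _ hpN
                rw [Nat.add_mul] at this
                rw [← charOf_eq_of_not_mismatch (by omega) ht hnM (hzS hz)]
                congr 1
                push_cast
                ring
            have g3 := g2.left_move (x' := ((p + 2 ^ j * 2) * P.l : ℕ) + ((r - 1 : ℤ) * P.l - P.K))
              (δ := P.l) (by
                rw [htr', abs_le, Nat.add_mul]; push_cast; constructor <;> push_cast at * <;> omega)
            rw [Nat.add_mul] at g3 ⊢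
            refine g3.mono ?_
            rw [mismatches] at hmis
            omega
        · have g := (ih (r - 1) (by omega)).left_move
            (x' := ((furthest (MatchIn P a b) P.N P.R e (r - 1) * P.l : ℕ) : ℤ) +
              ((r - 1 : ℤ) * P.l - P.K)) (δ := P.l) (by
              rw [Nat.cast_sub hrR.1, abs_le]; push_cast; constructor <;> nlinarith)
          exact g.mono (by omega)
      · have g := (ih (r + 1) (by omega)).left_move
            (x' := ((furthest (MatchIn P a b) P.N P.R e (r + 1) * P.l : ℕ) : ℤ) +
              ((r - 1 : ℤ) * P.l - P.K)) (δ := P.l) (by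
              rw [abs_le]; push_cast; constructor <;> nlinarith)
        exact g.mono (by omega)
    · rw [furthest, if_neg hrR]
      exact base r hr (e + 1)

theorem PrefixDist.editDist_le {d : ℕ} {x : ℤ} {y : ℕ}
    (h : PrefixDist (List.ofFn A) (List.ofFn B) x y d) (hx : (n : ℤ) ≤ x) (hy : n ≤ y) :
    editDist A B ≤ d := by
  obtain ⟨e, he, h⟩ := h
  rw [List.take_of_length_le (by rw [List.length_ofFn]; omega),
    List.take_of_length_le (by simpa using hy)] at h
  exact (Nat.sInf_le h).trans he

/-- Beyond the bound for the table, `l` edits cover the rest of B behind the last leaf block, and `K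
+ l` edits bring the position in A to the end if it falls short. -/
theorem editDist_le_of_furthest (hN : P.N * P.l ≤ n) (hN' : n < P.N * P.l + P.l)
    (hnM : n + P.T < P.M)
    (hab : ∀ j p t, p + 2 ^ j ≤ P.N → t < P.T → (∀ i, p ≤ i → i < p + 2 ^ j → a i t = b i) →
      mismatches P A B (2 ^ j) p t ≤ H * P.l) {r : ℕ} (h1 : 1 ≤ r) (hr : r ≤ P.R)
    (hD : P.N ≤ furthest (MatchIn P a b) P.N P.R P.E r) :
    editDist A B ≤ 2 * P.K + 3 * P.l + P.E * ((H + 2) * P.l) := by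
  have h := prefixDist_furthest hN hnM hab P.E r (by omega)
  set p := furthest (MatchIn P a b) P.N P.R P.E r
  have hpN : P.N * P.l ≤ p * P.l := Nat.mul_le_mul_right _ hD
  have hr0 : (0 : ℤ) ≤ (r - 1 : ℤ) * P.l := mul_nonneg (by omega) (by omega)
  have g := h.right_move P.l
  set x : ℤ := ((p * P.l : ℕ) : ℤ) + ((r - 1 : ℤ) * P.l - P.K) with hx
  have hxn : (n : ℤ) ≤ x + (P.K + P.l) := by omega
  rcases le_or_gt (n : ℤ) x with hle | hgt
  · exact (g.editDist_le hle (by omega)).trans (by omega)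
  · have g2 := g.left_move (x' := n) (δ := P.K + P.l) (by
      rw [abs_le]; push_cast; constructor <;> omega)
    exact (g2.editDist_le le_rfl (by omega)).trans (by omega)

/-- The infimum of an empty set of numbers would be `0`, so it must be seen to be attained: editing
position by position gives some sequence. -/
theorem exists_editSeq (A B : Fin n → Fin σ) :
    EditSeq (List.ofFn A) (List.ofFn B) (editDist A B) := by
  have h0 : PrefixDist (List.ofFn A) (List.ofFn B) 0 0 0 := ⟨0, le_rfl, by simpa using .refl _⟩
  obtain ⟨d, -, h⟩ := h0.both_move n
  rw [List.take_of_length_le (by simp), List.take_of_length_le (by simp)] at h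
  exact Nat.sInf_mem ⟨d, h⟩

end

end GapEditDistance
namespace GapEditDistance

/-! ### Random samples detect blocks with many mismatches -/

open MeasureTheory

theorem count_mod (l c : ℕ) (S : ℕ → Prop) [DecidablePred S] :
    Nat.count (fun x => S (x % l)) (c * l) = c * Nat.count S l := by
  induction c with
  | zero => simp
  | succ c ih =>
    rw [Nat.succ_mul, Nat.count_add, ih, Nat.succ_mul]
    congr 1
    simp only [Nat.count_eq_card_filter_range]
    congr 1
    refine Finset.filter_congr fun x hx => ?_
    rw [Nat.add_comm, Nat.add_mul_mod_self_right, Nat.mod_eq_of_lt (Finset.mem_range.1 hx)]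

open Classical in
/-- A uniformly random position of a leaf block avoids the set `S` with small probability. -/
theorem uniform_avoid_le {w l : ℕ} (hl : 0 < l) (hw : l ∣ 2 ^ w) (S : ℕ → Prop) :
    (PMF.uniformOfFintype (Fin (2 ^ w))).toMeasure {x | ¬ S ((x : ℕ) % l)} ≤
      ENNReal.ofReal (Real.exp (-((Nat.count S l : ℝ) / l))) := by
  obtain ⟨c, hc⟩ := hw
  rw [mul_comm] at hc
  have hc0 : 0 < c := Nat.pos_of_ne_zero fun h => by
    rw [h, zero_mul] at hc
    exact absurd hc (pow_pos two_pos w).ne'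
  rw [PMF.toMeasure_uniformOfFintype_apply _ (MeasurableSet.of_discrete), Fintype.card_fin]
  -- As `l` divides the number of words, every residue is hit by exactly `c` words; the remainder of
  -- a random word is exactly uniform.
  have hcard : Fintype.card ↑{x : Fin (2 ^ w) | ¬ S ((x : ℕ) % l)} =
      c * Nat.count (fun x => ¬ S x) l := by
    rw [← count_mod l c fun x => ¬ S x, ← hc, Nat.count_eq_card_filter_range,
      Finset.card_filter, ← Fin.sum_univ_eq_sum_range fun x => if ¬ S (x % l) then 1 else 0,
      ← Finset.card_filter]
    exact Fintype.card_subtype _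
  have hcount : Nat.count (fun x => ¬ S x) l + Nat.count S l = l := by
    simp only [Nat.count_eq_card_filter_range]
    rw [add_comm, Finset.card_filter_add_card_filter_not, Finset.card_range]
  rw [hcard, hc]
  have hlR : (0 : ℝ) < l := by exact_mod_cast hl
  have hcR : (0 : ℝ) < c := by exact_mod_cast hc0
  have hR : (Nat.count (fun x => ¬ S x) l : ℝ) + Nat.count S l = l := by exact_mod_cast hcount
  rw [← ENNReal.ofReal_natCast, ← ENNReal.ofReal_natCast, ← ENNReal.ofReal_div_of_pos
    (by push_cast; positivity)]
  refine ENNReal.ofReal_le_ofReal (le_trans (le_of_eq ?_) (Real.one_sub_le_exp_neg _))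
  push_cast
  rw [← hR] at hlR ⊢
  field_simp
  ring

theorem sum_block_mismatches {n σ : ℕ} (P : Params) (A B : Fin n → Fin σ) (h p t : ℕ) :
    ∑ i ∈ Finset.Ico p (p + h), mismatches P A B 1 i t = mismatches P A B h p t := by
  classical
  induction h with
  | zero => simp [mismatches]
  | succ h ih =>
    rw [← add_assoc, Finset.sum_Ico_succ_top (Nat.le_add_right p h), ih]
    unfold mismatches
    rw [← Nat.count_eq_card_filter_range, ← Nat.count_eq_card_filter_range,
      ← Nat.count_eq_card_filter_range, add_mul h, Nat.count_add, one_mul]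
    simp only [add_mul, add_assoc]

/-- The event is a product of events on distinct coordinates of the tape. The bounds for single leaf
blocks multiply, and their exponents add up to the number of mismatches in the whole block. -/
theorem block_avoid_le {n σ w : ℕ} {P : Params} (A B : Fin n → Fin σ) (hw : P.l ∣ 2 ^ w)
    (h p t : ℕ) :
    tapeMeasure w {ω | ∀ i, p ≤ i → i < p + h → ¬ Mismatch P A B t (i * P.l + (ω i : ℕ) % P.l)} ≤
      ENNReal.ofReal (Real.exp (-((mismatches P A B h p t : ℝ) / P.l))) := by
  classical
  have hset : {ω : ℕ → Fin (2 ^ w) | ∀ i, p ≤ i → i < p + h →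
      ¬ Mismatch P A B t (i * P.l + (ω i : ℕ) % P.l)} =
      Set.pi (Finset.Ico p (p + h)) fun i =>
        {x : Fin (2 ^ w) | ¬ Mismatch P A B t (i * P.l + (x : ℕ) % P.l)} := by
    ext ω
    simp [Set.mem_pi]
  rw [hset, tapeMeasure, Measure.infinitePi_pi _ fun _ _ => MeasurableSet.of_discrete]
  refine (Finset.prod_le_prod' fun i _ => uniform_avoid_le P.hl hw
    fun z => Mismatch P A B t (i * P.l + z)).trans (le_of_eq ?_)
  rw [← ENNReal.ofReal_prod_of_nonneg fun _ _ => (Real.exp_pos _).le, ← Real.exp_sum,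
    ← sum_block_mismatches, Finset.sum_neg_distrib, ← Finset.sum_div]
  push_cast
  simp only [mismatches, one_mul, Nat.count_eq_card_filter_range]

/-- The sampled positions detect every block with many mismatches. -/
def Detecting {n σ : ℕ} (P : Params) (A B : Fin n → Fin σ) (H : ℕ) (q : ℕ → ℕ) : Prop :=
  ∀ j p t, p + 2 ^ j ≤ P.N → t < P.T →
    (∀ i, p ≤ i → i < p + 2 ^ j → ¬ Mismatch P A B t (q i)) → mismatches P A B (2 ^ j) p t ≤ H * P.l

/-- Union bound over the triples of exponent, position and shift. A triple with more than `H l`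
mismatches is missed with probability at most `exp (-H) ≤ 2 ^ (-H)`; the other triples cannot fail.
-/
theorem tapeMeasure_detecting {n σ w H : ℕ} {P : Params} (A B : Fin n → Fin σ) (hn : 0 < n)
    (hw : P.l ∣ 2 ^ w) (hH : n * (P.N * P.N * P.T) ≤ 2 ^ H) :
    ENNReal.ofReal (1 - 1 / (n : ℝ)) ≤ tapeMeasure w
      {ω | Detecting P A B H fun i => i * P.l + (ω i : ℕ) % P.l} := by
  have : IsProbabilityMeasure (tapeMeasure w) := by unfold tapeMeasure; infer_instance
  set good := {ω : ℕ → Fin (2 ^ w) | Detecting P A B H fun i => i * P.l + (ω i : ℕ) % P.l}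
  let I := Finset.range P.N ×ˢ Finset.range P.N ×ˢ Finset.range P.T
  let bad : ℕ × ℕ × ℕ → Set (ℕ → Fin (2 ^ w)) := fun x =>
    {ω | H * P.l < mismatches P A B (2 ^ x.1) x.2.1 x.2.2 ∧ ∀ i, x.2.1 ≤ i → i < x.2.1 + 2 ^ x.1 →
      ¬ Mismatch P A B x.2.2 (i * P.l + (ω i : ℕ) % P.l)}
  -- Covering the whole space and using subadditivity gives the lower bound for `good` without any
  -- measurability.
  have hcover : (Set.univ : Set (ℕ → Fin (2 ^ w))) ⊆ good ∪ ⋃ x ∈ I, bad x := by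
    intro ω _
    by_cases h : ω ∈ good
    · exact Or.inl h
    · right
      simp only [good, Detecting, Set.mem_ofPred_eq, not_forall, not_le] at h
      obtain ⟨j, p, t, hp, ht, hi, hm⟩ := h
      -- From `j < 2 ^ j ≤ N`, the exponents may crudely be indexed by the numbers below `N`.
      have := Nat.lt_two_pow_self (n := j)
      refine Set.mem_biUnion (x := (j, p, t)) ?_ ⟨hm, hi⟩
      simp only [I, Finset.coe_product, Set.mem_prod, Finset.coe_range, Set.mem_Iio]
      omega
  have hbad : ∀ x ∈ I, tapeMeasure w (bad x) ≤ ENNReal.ofReal ((1 / 2 : ℝ) ^ H) := by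
    intro x _
    by_cases h : H * P.l < mismatches P A B (2 ^ x.1) x.2.1 x.2.2
    · refine (measure_mono fun ω hω => hω.2).trans ((block_avoid_le A B hw _ _ _).trans
        (ENNReal.ofReal_le_ofReal ?_))
      have hl : (0 : ℝ) < P.l := by exact_mod_cast P.hl
      have h1 : (H : ℝ) ≤ (mismatches P A B (2 ^ x.1) x.2.1 x.2.2 : ℝ) / P.l := by
        rw [le_div_iff₀ hl]
        exact_mod_cast h.le
      calc Real.exp (-((mismatches P A B (2 ^ x.1) x.2.1 x.2.2 : ℝ) / P.l))
          ≤ Real.exp (-(H : ℝ)) := Real.exp_le_exp.2 (neg_le_neg h1)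
        _ = (Real.exp (-1)) ^ H := by rw [← Real.exp_nat_mul]; ring_nf
        _ ≤ (1 / 2) ^ H := by
          gcongr
          rw [Real.exp_neg, ← one_div]
          have := Real.add_one_le_exp (1 : ℝ)
          gcongr
          linarith
    · have : bad x = ∅ := Set.eq_empty_of_forall_notMem fun ω hω => h hω.1
      rw [this, measure_empty]
      exact zero_le
  have hsum : tapeMeasure w (⋃ x ∈ I, bad x) ≤ ENNReal.ofReal (1 / (n : ℝ)) := by
    refine (measure_biUnion_finset_le I bad).trans ((Finset.sum_le_sum hbad).trans ?_)
    rw [Finset.sum_const, nsmul_eq_mul, ← ENNReal.ofReal_natCast, ← ENNReal.ofReal_mul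
      (Nat.cast_nonneg _)]
    refine ENNReal.ofReal_le_ofReal ?_
    have hn' : (0 : ℝ) < n := by exact_mod_cast hn
    have : (n : ℝ) * (P.N * P.N * P.T) ≤ 2 ^ H := by exact_mod_cast hH
    simp only [I, Finset.card_product, Finset.card_range]
    rw [one_div, one_div, inv_pow, ← div_eq_mul_inv, div_le_iff₀ (by positivity), inv_mul_eq_div,
      le_div_iff₀ hn']
    push_cast
    linarith
  have h1 : 1 ≤ tapeMeasure w good + ENNReal.ofReal (1 / (n : ℝ)) := by
    rw [← measure_univ (μ := tapeMeasure w)]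
    exact (measure_mono hcover).trans ((measure_union_le _ _).trans (by gcongr))
  rw [ENNReal.ofReal_sub _ (by positivity), ENNReal.ofReal_one]
  exact tsub_le_iff_right.2 h1

end GapEditDistance
namespace GapEditDistance

/-! ### The two programs on the word RAM -/

theorem charAt_le {n σ : ℕ} (A : Fin n → Fin σ) (i : ℕ) : charAt A i ≤ σ := by
  unfold charAt
  split
  · exact (A _).2.le
  · exact le_rfl

/-- The parameters are those that the programs compute from the input. -/
structure Params.Fits (P : Params) (a n k ℓ w : ℕ) : Prop where
  hℓ : 0 < ℓ
  hℓk : ℓ ≤ k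
  hkn : k ≤ n
  hl : P.l = 2 ^ Nat.log 2 ℓ
  hN : P.N = n / P.l
  hK : P.K = a * (Nat.log 2 n + 1) ^ a * k
  hE : P.E = (Nat.log 2 n + 1 + 2) * (P.K + 1)
  hM : P.M = 2 ^ w
  haZ : a + (Nat.log 2 n + 1) ^ a + a * (Nat.log 2 n + 1) ^ a < P.Z
  hnZ : n < P.Z

/-- With `V = 2 ^ (log n + log σ + 1)`, all quantities are bounded by small multiples of `V ^ (2a +
2)`, so `Z = V ^ (2a + 7)` leaves a factor `V ^ 5 ≥ 32`. The word size is chosen so that `M = V ^ 14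
* Z ^ 8`, and `V ≥ 2`. -/
theorem exists_params {a n k ℓ σ : ℕ} (hℓ : 0 < ℓ) (hℓk : ℓ ≤ k) (hkn : k ≤ n) :
    ∃ P : Params, P.Fits a n k ℓ (wordBits (16 * a + 70) n σ) ∧ σ < P.Z := by
  set L := Nat.log 2 n + 1 with hL
  set V := 2 ^ (Nat.log 2 n + Nat.log 2 σ + 1) with hV
  have hV2 : 2 ≤ V := Nat.le_self_pow (Nat.succ_ne_zero _) 2
  have hnV : n < V := (Nat.lt_pow_succ_log_self (by norm_num) n).trans_le
    (Nat.pow_le_pow_right (by norm_num) (by omega))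
  have hσV : σ < V := (Nat.lt_pow_succ_log_self (by norm_num) σ).trans_le
    (Nat.pow_le_pow_right (by norm_num) (by omega))
  have hLV : L ≤ V := by
    have := Nat.log_lt_self 2 (x := n) (by omega)
    omega
  have haV : a ≤ V ^ a := Nat.lt_two_pow_self.le.trans (Nat.pow_le_pow_left hV2 a)
  have hLa : L ^ a ≤ V ^ a := Nat.pow_le_pow_left hLV a
  have hpow : ∀ {i j}, i ≤ j → V ^ i ≤ V ^ j := fun h => Nat.pow_le_pow_right (by omega) h
  have h0 : V ^ a ≤ V ^ (2 * a + 2) := hpow (by omega)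
  have h1 : V ≤ V ^ (2 * a + 2) := Nat.le_self_pow (by omega) V
  have h2 : a * L ^ a ≤ V ^ (2 * a) := by
    rw [two_mul, pow_add]; exact Nat.mul_le_mul haV hLa
  have h3 : a * L ^ a * k ≤ V ^ (2 * a + 1) := by
    rw [pow_succ]; exact Nat.mul_le_mul h2 (by omega)
  have h4 : L * (a * L ^ a * k) ≤ V ^ (2 * a + 2) := by
    rw [pow_succ, mul_comm L]; exact Nat.mul_le_mul h3 hLV
  have h2' := h2.trans (hpow (j := 2 * a + 2) (by omega))
  have h3' := h3.trans (hpow (j := 2 * a + 2) (by omega))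
  have h5 : 32 * V ^ (2 * a + 2) ≤ V ^ (2 * a + 7) := by
    rw [show 2 * a + 7 = 5 + (2 * a + 2) by ring, pow_add V 5]
    exact Nat.mul_le_mul_right _ (Nat.pow_le_pow_left hV2 5)
  set l := 2 ^ Nat.log 2 ℓ with hl
  have hlℓ : l ≤ ℓ := Nat.pow_log_le_self 2 hℓ.ne'
  have hl0 : 0 < l := by positivity
  have hNl := Nat.div_mul_le_self n l
  have hNn := Nat.div_le_self n l
  have hRK := Nat.div_le_self (2 * (a * L ^ a * k)) l
  have hE : (L + 2) * (a * L ^ a * k + 1) = L * (a * L ^ a * k) + L + 2 * (a * L ^ a * k) + 2 := by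
    ring
  refine ⟨{
    l := l, N := n / l, K := a * L ^ a * k, T := 2 * (a * L ^ a * k) + 1
    R := 2 * (a * L ^ a * k) / l + 1, E := (L + 2) * (a * L ^ a * k + 1)
    Z := V ^ (2 * a + 7), M := 2 ^ wordBits (16 * a + 70) n σ
    hl := hl0, hN := Nat.div_pos (by omega) hl0, hT := rfl, hR := rfl
    hNlZ := by omega, hNEZ := by omega, hTZ := by omega, hRZ := by omega
    h6Z := by omega, hM := ?_ }, ⟨hℓ, hℓk, hkn, hl, rfl, rfl, rfl, rfl, by dsimp only; rw [← hL]; omega,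
      by dsimp only; omega⟩, by dsimp only; omega⟩
  rw [wordBits, mul_comm (16 * a + 70), pow_mul, ← hV, ← pow_mul,
    show 16 * a + 70 = 14 + (2 * a + 7) * 8 by ring, pow_add]
  exact Nat.mul_le_mul_right _ (Nat.pow_le_pow_left hV2 14)

section
variable {P : Params} {a n k ℓ w σ : ℕ}

theorem Params.Fits.runs_setupProg (F : P.Fits a n k ℓ w) {E : Env} (hE : E.M = P.M) {s : State}
    (hs : s.reg = inputRegs n k ℓ σ) :
    Runs E (setupProg a) s ((Nat.log 2 n + 1) * 40 + a * 2 + 100) fun s' =>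
      P.Regs s'.reg ∧ s'.mem = s.mem ∧ s'.used = s.used := by
  have h4 := P.four_mul_le
  have h6Z := P.h6Z
  have hNEZ := P.hNEZ
  have hTZ := P.hTZ
  have hT := P.hT
  have hEE := F.hE
  have h1 := F.haZ
  have h2 := F.hnZ
  have h3 := F.hkn
  have h5 := F.hℓk
  have h6 := F.hℓ
  have h7 := Nat.log_lt_self 2 (x := n) (by omega)
  have h8 := Nat.log_mono_right (b := 2) (h5.trans h3)
  rw [← hE] at h4
  refine (GapEditDistance.runs_setupProg (n := n) (k := k) (ℓ := ℓ) (by omega) h6 rfl F.hl F.hK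
    (by omega) (by omega) (by omega) (by omega) (by omega) (by omega) (by omega) (by omega)
    (by rw [hs]; rfl) (by rw [hs]; rfl) (by rw [hs]; rfl) (by rw [hs]; rfl) rfl).mono (by omega) ?_
  rintro s' ⟨g5, g6, g7, g9, g10, g11, gm, gu⟩
  refine ⟨⟨g5, g6.trans F.hN.symm, g7, ?_, ?_, g11.trans F.hE.symm⟩, gm, gu⟩
  · rw [g9, hT]; ring
  · rw [g10, P.hR, mul_comm]

/-- The memory that the preprocessing leaves. -/
def Preprocessed (P : Params) (A : Fin n → Fin σ) (q : ℕ → ℕ) (mem : ℕ → ℕ) : Prop :=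
  FinalTables P (fun i t => charAt A ((q i + t + P.M - P.K) % P.M)) q mem ∧
    ∀ g u v x y, 4 ≤ g → mem (adr g u v x y) = 0

/-- Both the time bound and the contents of the memory hold for every tape, so the expected time
will need no probability. -/
theorem Params.Fits.runs_preProg (F : P.Fits a n k ℓ w) (hσ : σ < P.Z) (A : Fin n → Fin σ)
    (ω : ℕ → Fin (2 ^ w)) :
    Runs (preEnv w A ω) (preProg a) (preInit n k ℓ σ)
      ((2 * a + 7000) * ((Nat.log 2 n + 1) * (P.N * P.T)))
      fun s => Preprocessed P A (fun i => i * P.l + (ω i : ℕ) % P.l) s.mem := by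
  have hE : (preEnv w A ω).M = P.M := F.hM.symm
  refine (Runs.seq_mid (F.runs_setupProg hE rfl) fun s ⟨hs, hm, hu⟩ =>
    Runs.seq_mid (runs_sampleProg hE (fun i => rfl) (fun i t => ?_) hs (hu.trans rfl)
      fun x => by rw [hm]; rfl) fun s ⟨hs, H⟩ =>
    (runs_levelsProg hE (TablesAt P (fun i t => charAt A ((i * P.l + (ω i : ℕ) % P.l +
      t + P.M - P.K) % P.M)) fun i => i * P.l + (ω i : ℕ) % P.l)
      (fun i p s hp hs h12 h13 H => runs_shiftsProg hE (fun i t => (charAt_le A _).trans_lt hσ)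
        hp hs h12 h13 H) (fun i mem hi h => h.next hi) hs H).mono le_rfl
      fun s h => h.2.final).le ?_
  swap
  · rw [hE]; rfl
  · have hN := P.hN
    have hT := P.hT
    have hlog : Nat.log 2 P.N ≤ Nat.log 2 n + 1 :=
      (Nat.log_mono_right (F.hN ▸ Nat.div_le_self _ _)).trans (Nat.le_succ _)
    generalize Nat.log 2 P.N = g at *
    have hL : 0 < Nat.log 2 n + 1 := Nat.succ_pos _
    generalize Nat.log 2 n + 1 = L at *
    have hNT : P.N ≤ P.N * P.T := Nat.le_mul_of_pos_right _ (by omega)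
    have h1 : P.N * P.T ≤ L * (P.N * P.T) := Nat.le_mul_of_pos_left _ hL
    have h2 : L ≤ L * (P.N * P.T) := Nat.le_mul_of_pos_right _ (by omega)
    have h3 : g * (P.N * (P.T * 6004 + 10 + 20) + 40) ≤ 6074 * (L * (P.N * P.T)) := by
      calc g * (P.N * (P.T * 6004 + 10 + 20) + 40)
          = g * (6004 * (P.N * P.T) + 30 * P.N + 40) := by ring
        _ ≤ L * (6074 * (P.N * P.T)) := Nat.mul_le_mul hlog (by omega)
        _ = _ := by ring
    have h4 : P.N * (P.T * 200 + 300) = 200 * (P.N * P.T) + 300 * P.N := by ring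
    have h5 : a * 1 ≤ a * (L * (P.N * P.T)) := Nat.mul_le_mul_left _ (by omega)
    have h6 : (2 * a + 7000) * (L * (P.N * P.T)) =
      2 * (a * (L * (P.N * P.T))) + 7000 * (L * (P.N * P.T)) := by ring
    omega

/-- The answer for small distance is unconditional. Only the answer for large distance needs
`Detecting`, which is kept as a hypothesis so that halting and time hold for every outcome. -/
theorem Params.Fits.runs_queryProg (F : P.Fits a n k ℓ w) (hσ : σ < P.Z) (A B : Fin n → Fin σ)
    {q : ℕ → ℕ} (hq : ∀ i, i * P.l ≤ q i ∧ q i < i * P.l + P.l) {s : State}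
    (hs : Preprocessed P A q s.mem) :
    Runs (queryEnv w A B) (queryProg a) (queryInit n k ℓ σ s)
      ((2 * a + 10000) * ((Nat.log 2 n + 1) * (P.N + P.E * P.R)))
      fun s' => (editDist A B ≤ P.K → s'.reg 0 = 1) ∧
        ∀ H, Detecting P A B H q → 2 * P.K + 3 * P.l + P.E * ((H + 2) * P.l) < editDist A B →
          s'.reg 0 = 0 := by
  have hE : (queryEnv w A B).M = P.M := F.hM.symm
  have hb : ∀ i, charAt B (q i) < P.Z := fun i => (charAt_le B _).trans_lt hσ
  have hNl : P.N * P.l ≤ n := F.hN ▸ Nat.div_mul_le_self _ _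
  have hNl' : n < P.N * P.l + P.l := by
    have := Nat.lt_div_mul_add (a := n) P.hl
    rwa [← F.hN] at this
  have h4 := P.four_mul_le
  have hnZ := F.hnZ
  have hTZ := P.hTZ
  refine (Runs.seq_mid (F.runs_setupProg hE rfl) fun s₁ ⟨hs₁, hm, hu⟩ =>
    Runs.seq_mid (runs_readProg (b := fun i => charAt B (q i)) hE (fun i => rfl) hs₁
      (by rw [hm]; exact hs.1) fun u v x y => by rw [hm]; exact hs.2 5 u v x y (by norm_num))
      fun s₂ ⟨hs₂, H⟩ =>
    Runs.seq_mid (runs_levelsProg hE (NamesAt P (fun i t => charAt A ((q i + t + P.M - P.K) % P.M)) q fun i => charAt B (q i))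
      (fun i p s hp hs h12 h13 H => runs_lookupProg hE hb hp hs h12 h13 H)
      (fun i mem hi h => h.next_level hi) hs₂ H) fun s₃ ⟨hs₃, H⟩ =>
    Runs.seq_mid (runs_tableProg hE hb hs₃ H) fun s₄ ⟨hs₄, H⟩ =>
    (runs_answerProg hE hs₄ H).mono le_rfl fun s' h =>
      ⟨fun hd => h.1 ?_, fun H hH hd => h.2 ?_⟩).le ?_
  rotate_left
  · refine exists_furthest_of_editSeq ?_ F.hE hNl (by omega) hq (fun i t => rfl) (fun i => rfl)
      (exists_editSeq A B) hd
    exact (F.hN ▸ Nat.div_le_self _ _ : P.N ≤ n).trans_lt (Nat.lt_pow_succ_log_self (by norm_num) n)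
  · intro r h1 hr
    by_contra hD
    refine absurd (editDist_le_of_furthest hNl hNl' (by omega) (fun j p t hp ht hab => hH j p t hp ht
      fun i hpi hip => ?_) h1 hr (not_lt.1 hD)) (not_le.2 hd)
    exact not_not.2 (hab i hpi hip)
  · have hN := P.hN
    have hR : 0 < P.R := P.hR ▸ Nat.succ_pos _
    have hlog : Nat.log 2 P.N ≤ Nat.log 2 n + 1 :=
      (Nat.log_mono_right (F.hN ▸ Nat.div_le_self _ _)).trans (Nat.le_succ _)
    have hE0 : 0 < P.E := by rw [F.hE]; positivity
    generalize Nat.log 2 P.N = g at *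
    have hL : 0 < Nat.log 2 n + 1 := Nat.succ_pos _
    generalize Nat.log 2 n + 1 = L at *
    have hER : P.E ≤ P.E * P.R := Nat.le_mul_of_pos_right _ hR
    have hER' : P.R ≤ P.E * P.R := Nat.le_mul_of_pos_left _ hE0
    have h1 : P.N + P.E * P.R ≤ L * (P.N + P.E * P.R) := Nat.le_mul_of_pos_left _ hL
    have h2 : L ≤ L * (P.N + P.E * P.R) := Nat.le_mul_of_pos_right _ (by omega)
    have h3 : g * (P.N * (5000 + 20) + 40) ≤ 5060 * (L * (P.N + P.E * P.R)) := by
      calc g * (P.N * (5000 + 20) + 40)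
          ≤ L * (5060 * (P.N + P.E * P.R)) := Nat.mul_le_mul hlog (by omega)
        _ = _ := by ring
    have h4 : P.E * (P.R * (g * 3000 + 1010) + 20) ≤
        3000 * (L * (P.N + P.E * P.R)) + 1010 * (P.E * P.R) + 20 * P.E := by
      calc P.E * (P.R * (g * 3000 + 1010) + 20)
          = 3000 * (g * (P.E * P.R)) + 1010 * (P.E * P.R) + 20 * P.E := by ring
        _ ≤ _ := Nat.add_le_add_right (Nat.add_le_add_right (Nat.mul_le_mul_left _
          (Nat.mul_le_mul hlog (Nat.le_add_left _ _))) _) _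
    have h5 : a * 1 ≤ a * (L * (P.N + P.E * P.R)) := Nat.mul_le_mul_left _ (by omega)
    have h6 : (2 * a + 10000) * (L * (P.N + P.E * P.R)) =
      2 * (a * (L * (P.N + P.E * P.R))) + 10000 * (L * (P.N + P.E * P.R)) := by ring
    omega

/-! ### The bounds in terms of the input -/

theorem Params.Fits.le_ℓ (F : P.Fits a n k ℓ w) : P.l ≤ ℓ :=
  F.hl ▸ Nat.pow_log_le_self 2 F.hℓ.ne'

theorem Params.Fits.ℓ_le (F : P.Fits a n k ℓ w) : ℓ ≤ 2 * P.l := by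
  have := Nat.lt_pow_succ_log_self (b := 2) (by norm_num) ℓ
  rw [pow_succ, ← F.hl] at this
  omega

/-- The bounds below are multiplied by ℓ instead of divided. Rounding ℓ down to a power of two costs
the factor two. -/
theorem Params.Fits.N_mul_ℓ_le (F : P.Fits a n k ℓ w) : P.N * ℓ ≤ 2 * n := by
  have h : P.N * P.l ≤ n := F.hN ▸ Nat.div_mul_le_self _ _
  calc P.N * ℓ ≤ P.N * (2 * P.l) := Nat.mul_le_mul_left _ F.ℓ_le
    _ = 2 * (P.N * P.l) := by ring
    _ ≤ 2 * n := Nat.mul_le_mul_left _ h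

theorem Params.Fits.T_le (F : P.Fits a n k ℓ w) : P.T ≤ (2 * a + 1) * ((Nat.log 2 n + 1) ^ a * k) := by
  have h : 1 * 1 ≤ (Nat.log 2 n + 1) ^ a * k :=
    Nat.mul_le_mul (Nat.one_le_pow _ _ (Nat.succ_pos _)) (F.hℓ.trans_le F.hℓk)
  rw [P.hT, F.hK]
  calc _ ≤ 2 * (a * (Nat.log 2 n + 1) ^ a * k) + (Nat.log 2 n + 1) ^ a * k := by omega
    _ = _ := by ring

theorem Params.Fits.E_le (F : P.Fits a n k ℓ w) :
    P.E ≤ 3 * (a + 1) * ((Nat.log 2 n + 1) ^ (a + 1) * k) := by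
  have h : 1 * 1 ≤ (Nat.log 2 n + 1) ^ a * k :=
    Nat.mul_le_mul (Nat.one_le_pow _ _ (Nat.succ_pos _)) (F.hℓ.trans_le F.hℓk)
  rw [F.hE, F.hK]
  calc _ ≤ (3 * (Nat.log 2 n + 1)) * (a * (Nat.log 2 n + 1) ^ a * k + (Nat.log 2 n + 1) ^ a * k) :=
        Nat.mul_le_mul (by omega) (by omega)
    _ = _ := by ring

theorem Params.Fits.R_mul_ℓ_le (F : P.Fits a n k ℓ w) :
    P.R * ℓ ≤ (4 * a + 2) * ((Nat.log 2 n + 1) ^ a * k) := by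
  have h : 1 * k ≤ (Nat.log 2 n + 1) ^ a * k :=
    Nat.mul_le_mul_right _ (Nat.one_le_pow _ _ (Nat.succ_pos _))
  have h1 := Nat.div_mul_le_self (2 * P.K) P.l
  have h2 := F.le_ℓ
  have h3 := F.hℓk
  calc P.R * ℓ ≤ P.R * (2 * P.l) := Nat.mul_le_mul_left _ F.ℓ_le
    _ = 2 * (2 * P.K / P.l * P.l) + 2 * P.l := by rw [P.hR]; ring
    _ ≤ 4 * P.K + 2 * ((Nat.log 2 n + 1) ^ a * k) := by omega
    _ = _ := by rw [F.hK]; ring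

theorem Params.Fits.pre_time_le (F : P.Fits a n k ℓ w) :
    (2 * a + 7000) * ((Nat.log 2 n + 1) * (P.N * P.T)) * ℓ ≤
      (2 * a + 7000) * 2 * (2 * a + 1) * (Nat.log 2 n + 1) ^ (a + 1) * (n * k) := by
  calc _ = (2 * a + 7000) * (Nat.log 2 n + 1) * ((P.N * ℓ) * P.T) := by ring
    _ ≤ (2 * a + 7000) * (Nat.log 2 n + 1) *
        ((2 * n) * ((2 * a + 1) * ((Nat.log 2 n + 1) ^ a * k))) :=
      Nat.mul_le_mul_left _ (Nat.mul_le_mul F.N_mul_ℓ_le F.T_le)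
    _ = _ := by ring

theorem Params.Fits.query_time_le (F : P.Fits a n k ℓ w) :
    (2 * a + 10000) * ((Nat.log 2 n + 1) * (P.N + P.E * P.R)) * ℓ ≤
      (2 * a + 10000) * (2 + 3 * (a + 1) * (4 * a + 2)) * (Nat.log 2 n + 1) ^ (2 * a + 2) *
        (n + k ^ 2) := by
  have h : n * 1 ≤ n * (Nat.log 2 n + 1) ^ (2 * a + 1) :=
    Nat.mul_le_mul_left _ (Nat.one_le_pow _ _ (Nat.succ_pos _))
  calc _ = (2 * a + 10000) * (Nat.log 2 n + 1) * (P.N * ℓ + P.E * (P.R * ℓ)) := by ring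
    _ ≤ (2 * a + 10000) * (Nat.log 2 n + 1) * (2 * (n * (Nat.log 2 n + 1) ^ (2 * a + 1)) +
        (3 * (a + 1) * ((Nat.log 2 n + 1) ^ (a + 1) * k)) *
          ((4 * a + 2) * ((Nat.log 2 n + 1) ^ a * k))) :=
      Nat.mul_le_mul_left _ (Nat.add_le_add (F.N_mul_ℓ_le.trans (by omega))
        (Nat.mul_le_mul F.E_le F.R_mul_ℓ_le))
    _ = (2 * a + 10000) * (Nat.log 2 n + 1) ^ (2 * a + 2) *
        (2 * n + (3 * (a + 1) * (4 * a + 2)) * k ^ 2) := by ring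
    _ ≤ (2 * a + 10000) * (Nat.log 2 n + 1) ^ (2 * a + 2) *
        ((2 + 3 * (a + 1) * (4 * a + 2)) * (n + k ^ 2)) := by
      refine Nat.mul_le_mul_left _ ?_
      rw [add_mul _ _ (n + k ^ 2)]
      exact Nat.add_le_add (by omega) (Nat.mul_le_mul_left _ (Nat.le_add_left _ _))
    _ = _ := by ring

/-- The factor `(3a + 5) L` is the value of `H` that the union bound requires. -/
theorem Params.Fits.large_le (F : P.Fits a n k ℓ w) :
    2 * P.K + 3 * P.l + P.E * (((3 * a + 5) * (Nat.log 2 n + 1) + 2) * P.l) ≤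
      (2 * a + 3 + 3 * (a + 1) * (3 * a + 7)) * (Nat.log 2 n + 1) ^ (a + 2) * (k * ℓ) := by
  have hL : 1 ≤ Nat.log 2 n + 1 := Nat.succ_pos _
  have hK := F.hK
  have hEL := F.E_le
  have hl := F.le_ℓ
  have hk : 0 < k := F.hℓ.trans_le F.hℓk
  generalize Nat.log 2 n + 1 = L at *
  have h1 : P.K ≤ a * (L ^ (a + 2) * (k * ℓ)) := by
    rw [hK, mul_assoc]
    exact Nat.mul_le_mul_left _ (Nat.mul_le_mul (Nat.pow_le_pow_right hL (by omega))
      (Nat.le_mul_of_pos_right _ F.hℓ))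
  have h2 : P.l ≤ L ^ (a + 2) * (k * ℓ) := hl.trans ((Nat.le_mul_of_pos_left _ hk).trans
    (Nat.le_mul_of_pos_left _ (by positivity)))
  have h3 : P.E * (((3 * a + 5) * L + 2) * P.l) ≤
      3 * (a + 1) * (3 * a + 7) * (L ^ (a + 2) * (k * ℓ)) := by
    calc _ ≤ (3 * (a + 1) * (L ^ (a + 1) * k)) * (((3 * a + 7) * L) * ℓ) := by
          refine Nat.mul_le_mul hEL (Nat.mul_le_mul ?_ hl)
          have : (3 * a + 7) * L = (3 * a + 5) * L + 2 * L := by ring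
          omega
      _ = _ := by ring
  calc _ ≤ 2 * (a * (L ^ (a + 2) * (k * ℓ))) + 3 * (L ^ (a + 2) * (k * ℓ)) +
        3 * (a + 1) * (3 * a + 7) * (L ^ (a + 2) * (k * ℓ)) := by omega
    _ = _ := by ring

/-- Each of `n`, `N`, `N` contributes one factor `2 ^ L`, and `T` at most `3a + 2` of them. -/
theorem Params.Fits.union_le (F : P.Fits a n k ℓ w) :
    n * (P.N * P.N * P.T) ≤ 2 ^ ((3 * a + 5) * (Nat.log 2 n + 1)) := by
  have hT := F.T_le
  have hn : n < 2 ^ (Nat.log 2 n + 1) := Nat.lt_pow_succ_log_self (by norm_num) n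
  have hN : P.N ≤ n := F.hN ▸ Nat.div_le_self _ _
  have hk := F.hkn
  have hL : 1 ≤ Nat.log 2 n + 1 := Nat.succ_pos _
  generalize Nat.log 2 n + 1 = L at *
  have hLL : L ≤ 2 ^ L := Nat.lt_two_pow_self.le
  have h2 : 2 ≤ 2 ^ L := Nat.le_self_pow (by omega) 2
  have ha : 2 * a + 1 ≤ (2 ^ L) ^ (2 * a + 1) :=
    Nat.lt_two_pow_self.le.trans (Nat.pow_le_pow_left h2 _)
  have hT' : P.T ≤ (2 ^ L) ^ (2 * a + 1) * ((2 ^ L) ^ a * 2 ^ L) :=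
    hT.trans (Nat.mul_le_mul ha (Nat.mul_le_mul (Nat.pow_le_pow_left hLL a) (by omega)))
  calc n * (P.N * P.N * P.T)
      ≤ 2 ^ L * (2 ^ L * 2 ^ L * ((2 ^ L) ^ (2 * a + 1) * ((2 ^ L) ^ a * 2 ^ L))) :=
        Nat.mul_le_mul hn.le (Nat.mul_le_mul (Nat.mul_le_mul (by omega) (by omega)) hT')
    _ = (2 ^ L) ^ (3 * a + 5) := by ring
    _ = 2 ^ ((3 * a + 5) * L) := by rw [← pow_mul, mul_comm]

theorem polylog_bound {x C e b n y : ℕ} (h : x ≤ C * (Nat.log 2 n + 1) ^ e * y) (hC : C ≤ b)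
    (he : e ≤ b) : x ≤ polylog b n * y :=
  h.trans (Nat.mul_le_mul_right _ (Nat.mul_le_mul hC (Nat.pow_le_pow_right (Nat.succ_pos _) he)))

end

end GapEditDistance

/-! ### The theorem -/

theorem mainTheorem4 (a : ℕ) :
    ∃ (c b : ℕ) (pre query : Prog), 0 < c ∧ query.RandomFree ∧
      ∀ n k ℓ σ : ℕ, 1 ≤ ℓ → ℓ ≤ k → k ≤ n → ∀ A : Fin n → Fin σ,
        -- expected preprocessing time
        (∫⁻ ω, runningTime (preEnv (wordBits c n σ) A ω) pre (preInit n k ℓ σ)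
            ∂(tapeMeasure (wordBits c n σ))
          ≤ ENNReal.ofReal (polylog b n * ((n : ℝ) * k / ℓ))) ∧
        ∀ B : Fin n → Fin σ,
          -- query time, for every outcome of preprocessing
          (∀ (ω : ℕ → Fin (2 ^ wordBits c n σ)) (s : State) (t : ℕ),
            Exec (preEnv (wordBits c n σ) A ω) pre (preInit n k ℓ σ) s t →
            ∃ (s' : State) (t' : ℕ),
              Exec (queryEnv (wordBits c n σ) A B) query (queryInit n k ℓ σ s) s' t' ∧
              (t' : ℝ) ≤ polylog b n * (((n : ℝ) + (k : ℝ) ^ 2) / ℓ)) ∧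
          -- success probability, over the random words used in preprocessing
          ENNReal.ofReal (1 - 1 / (n : ℝ)) ≤
            tapeMeasure (wordBits c n σ)
              {ω | ∃ (s s' : State) (t t' : ℕ),
                Exec (preEnv (wordBits c n σ) A ω) pre (preInit n k ℓ σ) s t ∧
                Exec (queryEnv (wordBits c n σ) A B) query (queryInit n k ℓ σ s) s' t' ∧
                CorrectAnswer (editDist A B) (polylog a n * (k : ℝ))
                  (polylog b n * ((k : ℝ) * ℓ)) s'} := by
  open GapEditDistance MeasureTheory in
  -- The three constants come from preprocessing time, query time and the threshold for LARGE, and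
  -- the last condition covers all exponents. The third inequality is strict because the query is
  -- known to answer LARGE only when the distance strictly exceeds the bound.
  obtain ⟨b, hb1, hb2, hb3, hb4⟩ : ∃ b, (2 * a + 7000) * 2 * (2 * a + 1) ≤ b ∧
      (2 * a + 10000) * (2 + 3 * (a + 1) * (4 * a + 2)) ≤ b ∧
      2 * a + 3 + 3 * (a + 1) * (3 * a + 7) < b ∧ 2 * a + 2 ≤ b :=
    ⟨(2 * a + 7000) * 2 * (2 * a + 1) + (2 * a + 10000) * (2 + 3 * (a + 1) * (4 * a + 2)) +
      (2 * a + 3 + 3 * (a + 1) * (3 * a + 7)) + 1 + (2 * a + 2), by omega, by omega, by omega,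
      by omega⟩
  refine ⟨16 * a + 70, b, preProg a, queryProg a, by omega, queryProg_randomFree a,
    fun n k ℓ σ hℓ hℓk hkn A => ?_⟩
  obtain ⟨P, F, hσ⟩ := exists_params (a := a) (σ := σ) hℓ hℓk hkn
  generalize wordBits (16 * a + 70) n σ = w at *
  have hℓR : (0 : ℝ) < ℓ := by exact_mod_cast hℓ
  have hpre := F.runs_preProg hσ A
  -- Both are powers of two, so it is enough that `l` is smaller than the number of words.
  have hw : P.l ∣ 2 ^ w := by
    have h4 := P.four_mul_le
    have hZ := F.hnZ
    have hle := F.le_ℓ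
    rw [F.hM] at h4
    rw [F.hl] at hle ⊢
    exact pow_dvd_pow 2 ((Nat.pow_le_pow_iff_right (a := 2) (by norm_num)).1 (by omega))
  have hquery := fun (B : Fin n → Fin σ) (ω : ℕ → Fin (2 ^ w)) (s : State)
      (hs : Preprocessed P A (fun i => i * P.l + (ω i : ℕ) % P.l) s.mem) =>
    F.runs_queryProg hσ A B (fun i => ⟨Nat.le_add_right _ _,
      Nat.add_lt_add_left (Nat.mod_lt _ P.hl) _⟩) hs
  refine ⟨?_, fun B => ⟨fun ω s t hst => ?_, ?_⟩⟩
  · have : IsProbabilityMeasure (tapeMeasure w) := by unfold tapeMeasure; infer_instance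
    calc _ ≤ ∫⁻ _, ((((2 * a + 7000) * ((Nat.log 2 n + 1) * (P.N * P.T)) : ℕ) : ℕ) : ENNReal)
          ∂(tapeMeasure w) := by
          refine lintegral_mono fun ω => ?_
          obtain ⟨s, t, hst, ht, -⟩ := hpre ω
          exact (iInf₂_le t ⟨s, hst⟩).trans (by exact_mod_cast ht)
      _ = ENNReal.ofReal (((2 * a + 7000) * ((Nat.log 2 n + 1) * (P.N * P.T)) : ℕ) : ℝ) := by
          rw [lintegral_const, measure_univ, mul_one, ENNReal.ofReal_natCast]
      _ ≤ _ := by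
          refine ENNReal.ofReal_le_ofReal ?_
          rw [← mul_div_assoc, le_div_iff₀ hℓR]
          exact_mod_cast polylog_bound F.pre_time_le hb1 (by omega)
  · obtain ⟨s₁, t₁, hst₁, -, hs₁⟩ := hpre ω
    -- The given run of the preprocessing is the one constructed, since execution is determined by
    -- the tape; so its memory holds the tables.
    obtain ⟨rfl, rfl⟩ := hst.unique hst₁
    obtain ⟨s', t', hst', ht', -⟩ := hquery B ω s hs₁
    refine ⟨s', t', hst', ?_⟩
    rw [← mul_div_assoc, le_div_iff₀ hℓR]
    exact_mod_cast polylog_bound ((Nat.mul_le_mul_right ℓ ht').trans F.query_time_le) hb2 hb4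
  · refine (tapeMeasure_detecting A B (by omega) hw F.union_le).trans
      (measure_mono fun ω hω => ?_)
    obtain ⟨s, t, hst, -, hs⟩ := hpre ω
    obtain ⟨s', t', hst', -, hsmall, hlarge⟩ := hquery B ω s hs
    refine ⟨s, s', t, t', hst, hst', fun h => hsmall ?_, fun h => hlarge _ hω ?_⟩
    · rw [F.hK]
      exact_mod_cast h
    · have h' : polylog b n * (k * ℓ) ≤ editDist A B := by exact_mod_cast h
      refine lt_of_lt_of_le ?_ h'
      have hpos : 0 < (Nat.log 2 n + 1) ^ (a + 2) * (k * ℓ) := by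
        have : 0 < k := by omega
        positivity
      refine lt_of_lt_of_le (Nat.lt_succ_of_le F.large_le) ?_
      refine polylog_bound (C := 2 * a + 3 + 3 * (a + 1) * (3 * a + 7) + 1) (e := a + 2) ?_ hb3
        (by omega)
      generalize 2 * a + 3 + 3 * (a + 1) * (3 * a + 7) = C
      rw [mul_assoc, mul_assoc, Nat.succ_mul]
      exact Nat.add_le_add_left hpos _
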